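/- Let $M,Q\in\mathbb R$ with $|Q|<M$, $\mu=\sqrt{M^2-Q^2}>0$, $f(r)=1-\frac{2M}{r}+\frac{Q^2}{r^2}$, and consider the exterior $r>M+\mu$ of the Reissner–Nordström black hole $g=-f\,dt^2+\frac{dr^2}{f}+r^2d\Omega^2$ (Schwarzschild if $Q=0$), with optical metric $h_{\rm opt}=f^{-1}\bigl(\frac{dr^2}{f}+r^2d\Omega^2\bigr)$. Let $B$ be the open unit ball of $\mathbb R^3$ with centre $O=0$ and the hyperbolic metric in Beltrami coordinates, $h=\frac{|dx|^2}{1-|x|^2}+\frac{(x\cdot dx)^2}{(1-|x|^2)^2}$, with distance $\cosh D(x,y)=\frac{1-x\cdot y}{\sqrt{1-|x|^2}\sqrt{1-|y|^2}}$. Let $V_O(x)=\frac1{4\pi|x|}$ and $\sqrt\mu\,H=4\pi\mu V_O+M$. Laplacians are $\Delta_g=\frac1{\sqrt{\det g}}\partial_i\sqrt{\det g}\,g^{ij}\partial_j$; a Green's function $G$ of $-\Delta_g$ on an open set $U$ with pole $x_0$ is a locally integrable function on $U$, smooth off $x_0$, with $-\Delta_gG=\delta_{x_0}$ in the sense of distributions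 on $U$ (the delta function being normalised with respect to $d\mathrm{vol}_g$). Then: 1. $x\mapsto r\,x/|x|$ with $r=M+\mu/|x|$ is a smooth bijection of $B\setminus\{O\}$ onto the exterior, under which $h_{\rm opt}=H^4h$; $H$ is positive and $\Delta_hH=0$ on $B\setminus\{O\}$. (The asymptotically flat end is at $O$, the horizon at $|x|=1$.) 2. $V_O$ is the unique Green's function of $-\Delta_h$ on $B$ with pole $O$ that tends to $\frac1{4\pi}$ as $D(x,O)\to\infty$. 3. Let $x_0\in B\setminus\{O\}$. There is an isometry $T_{x_0}$ of $(B,h)$ with $T_{x_0}(x_0)=O$, and for every such isometry the function $$\widetilde G(x,x_0)=\frac{1}{H(x)H(x_0)}\left(V_O(T_{x_0}(x))+\frac{M}{4\pi\mu}\right)$$ is the unique function $\Phi$ on $B\setminus\{O,x_0\}$ with the following properties: (a) $\Phi$ is a Green's function of $-\Delta_{h_{\rm opt}}$ on $B\setminus\{O\}$ with pole $x_0$; (b) $\Phi\to0$ as $x\to O$; (c) the field $F=d(\Phi\,dt)$ is regular at the horizon, i.e. its components in the ingoing Eddington–Finkelstein coordinates $(v,x)$, $dv=dt+dr/f$, extend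 smoothly across $|x|=1$; (d) Gauss's law: the flux $\int_\Sigma\star_{h_{\rm opt}}d\Phi$ vanishes for every sphere $\Sigma=\{|x|=R\}$, $|x_0|<R<1$ (which encloses the hole but not $x_0$), i.e. the hole carries no net charge. The one-form $A=\widetilde G(\cdot,x_0)\,dt$ solves Maxwell's equations $\nabla_aF^{ab}=J^b$, $F=dA$, on the exterior with the metric $g$ in the sense of distributions, $J$ being the current of a unit point charge at rest at $x_0$. 4. For all real $a,b$ the function $\frac{V_O(T_{x_0}(x))+a}{H(x)H(x_0)}+b$ satisfies (a) and (c), and tends to $b$ as $x\to O$; its flux through a sphere as in (d) vanishes if and only if $a=\frac{M}{4\pi\mu}$. 5. As $x_0$ approaches the horizon, the potential tends to the spherically symmetric potential $\frac1{4\pi r}$ exponentially fast in $D(x_0,O)$: for every $R$ there is a constant $C$ (depending only on $M,Q,R$) such that for all $x_0,x\in B\setminus\{O\}$ with $D(x_0,O)\ge R+1$ and $D(x,O)\le R$, and every isometry $T_{x_0}$ with $T_{x_0}(x_0)=O$, the quantities $$\Bigl|V_O(T_{x_0}(x))-\tfrac1{4\pi}\Bigr|,\qquad \Bigl|\widetilde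 G(x,x_0)-\tfrac{1}{4\pi r(x)}\Bigr|,$$ and the modulus at $x$ of the non-monopole part of $\widetilde G(\cdot,x_0)$ (the function minus its mean over the sphere about $O$ through $x$) are all at most $C\,e^{-2D(x_0,O)}$. -/

import Mathlib

open MeasureTheory Filter Topology Set
open scoped ContDiff Matrix

noncomputable section

namespace OpticalBH

/-- Euclidean three-space, used as a coordinate space. -/
abbrev E3 : Type := EuclideanSpace ℝ (Fin 3)

/-- The open unit ball: the domain of Beltrami coordinates on hyperbolic three-space. -/
def hball : Set E3 := Metric.ball 0 1

/-- The unit ball without its centre `O = 0`: the black hole exterior. The asymptotically flat end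
is at `O`, the horizon at the conformal boundary `‖x‖ = 1`. -/
def ext : Set E3 := hball \ {0}

/-! ### Riemannian metrics in a coordinate domain -/

/-- Coordinate partial derivative. -/
def pd (i : Fin 3) (f : E3 → ℝ) (x : E3) : ℝ :=
  fderiv ℝ f x (EuclideanSpace.single i 1)

/-- Jacobian matrix of a map. -/
def jac (T : E3 → E3) (x : E3) : Matrix (Fin 3) (Fin 3) ℝ :=
  Matrix.of fun i j => (fderiv ℝ T x (EuclideanSpace.single j 1)) i

/-- Pullback `T^* g` of a metric (a field of component matrices). -/
def pullback (T : E3 → E3) (g : E3 → Matrix (Fin 3) (Fin 3) ℝ) (x : E3) :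
    Matrix (Fin 3) (Fin 3) ℝ :=
  (jac T x)ᵀ * g (T x) * jac T x

/-- Density of the Riemannian volume with respect to Lebesgue measure. -/
def volDensity (g : E3 → Matrix (Fin 3) (Fin 3) ℝ) (x : E3) : ℝ := √(g x).det

/-- The density `√(det g) g^{ij} ∂_j f`; this vector density represents the two-form `⋆_g df`. -/
def gradDensity (g : E3 → Matrix (Fin 3) (Fin 3) ℝ) (f : E3 → ℝ) (i : Fin 3) (x : E3) : ℝ :=
  ∑ j, volDensity g x * (g x)⁻¹ i j * pd j f x

/-- The Laplace–Beltrami operator `(det g)^{-1/2} ∂_i ((det g)^{1/2} g^{ij} ∂_j f)`. -/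
def laplacian (g : E3 → Matrix (Fin 3) (Fin 3) ℝ) (f : E3 → ℝ) (x : E3) : ℝ :=
  (volDensity g x)⁻¹ * ∑ i, pd i (gradDensity g f i) x

/-- `G` is a Green's function of `-Δ_g` on the open set `U` with pole `x₀`: it is smooth away from
`x₀`, locally integrable, and `-Δ_g G = δ_{(g)}(·, x₀)` as distributions on `U`. -/
structure IsGreen (g : E3 → Matrix (Fin 3) (Fin 3) ℝ) (U : Set E3) (x₀ : E3) (G : E3 → ℝ) :
    Prop where
  smooth : ContDiffOn ℝ ∞ G (U \ {x₀})
  locInt : LocallyIntegrableOn G U volume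
  eqn : ∀ φ : E3 → ℝ, ContDiff ℝ ∞ φ → HasCompactSupport φ → tsupport φ ⊆ U →
    -(∫ x in U, G x * laplacian g φ x * volDensity g x) = φ x₀

/-- Surface measure of the Euclidean unit sphere. -/
def sphereMeasure : Measure (Metric.sphere (0 : E3) 1) := (volume : Measure E3).toSphere

/-- The flux `∫_Σ ⋆_g dΦ` through the sphere `Σ = {‖x‖ = R}`. -/
def flux (g : E3 → Matrix (Fin 3) (Fin 3) ℝ) (Φ : E3 → ℝ) (R : ℝ) : ℝ :=
  ∫ n, (∑ i, gradDensity g Φ i (R • (n : E3)) * (n : E3) i) * R ^ 2 ∂sphereMeasure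

/-- The part of `Φ` orthogonal to the spherically symmetric functions about `O`: `Φ` minus its mean
over the spheres centred at `O`. -/
def nonMonopole (Φ : E3 → ℝ) (x : E3) : ℝ :=
  Φ x - ⨍ n, Φ (‖x‖ • (n : E3)) ∂sphereMeasure

/-! ### Hyperbolic three-space in Beltrami coordinates -/

/-- The hyperbolic metric of radius one,
`h = dx² / (1 - |x|²) + (x · dx)² / (1 - |x|²)²`, on the unit ball. -/
def hyp (x : E3) : Matrix (Fin 3) (Fin 3) ℝ :=
  Matrix.of fun i j =>
    (if i = j then 1 / (1 - ‖x‖ ^ 2) else 0) + x i * x j / (1 - ‖x‖ ^ 2) ^ 2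

/-- Hyperbolic distance,
`cosh D(x, y) = (1 - x · y) / (√(1 - |x|²) √(1 - |y|²))`. -/
def hdist (x y : E3) : ℝ :=
  Real.arcosh ((1 - inner ℝ x y) / (√(1 - ‖x‖ ^ 2) * √(1 - ‖y‖ ^ 2)))

/-- Isometries of hyperbolic space: diffeomorphisms `T` of the ball with `T^* h = h`. -/
structure IsHypIsometry (T : E3 → E3) : Prop where
  smooth : ContDiffOn ℝ ∞ T hball
  mapsTo : MapsTo T hball hball
  inverse : ∃ S : E3 → E3, ContDiffOn ℝ ∞ S hball ∧ MapsTo S hball hball ∧ InvOn S T hball hball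
  isom : ∀ x ∈ hball, pullback T hyp x = hyp x

/-- The function `1 / (4 π |x|)` in Beltrami coordinates. -/
def VO (x : E3) : ℝ := 1 / (4 * Real.pi * ‖x‖)

/-! ### The Reissner–Nordström exterior -/

/-- `μ = √(M² - Q²)`. -/
def mu (M Q : ℝ) : ℝ := √(M ^ 2 - Q ^ 2)

/-- `f(r) = 1 - 2M/r + Q²/r²`, minus the `tt` component of the metric. -/
def lapseSq (M Q r : ℝ) : ℝ := 1 - 2 * M / r + Q ^ 2 / r ^ 2

/-- The spatial metric `dr²/f(r) + r² dΩ²` at the point `y` with `r = |y|`, in the Cartesian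
coordinates `y` associated with the polar coordinates `(r, θ, φ)`. -/
def rnSpatial (M Q : ℝ) (y : E3) : Matrix (Fin 3) (Fin 3) ℝ :=
  Matrix.of fun i j =>
    (if i = j then 1 else 0) + (1 / lapseSq M Q ‖y‖ - 1) * (y i * y j / ‖y‖ ^ 2)

/-- The optical metric `f^{-1} (dr²/f + r² dΩ²)`. -/
def rnOptical (M Q : ℝ) (y : E3) : Matrix (Fin 3) (Fin 3) ℝ :=
  (lapseSq M Q ‖y‖)⁻¹ • rnSpatial M Q y

/-- The area radius `r = M + μ/|x|` as a function of the Beltrami coordinate. -/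
def radius (M Q : ℝ) (x : E3) : ℝ := M + mu M Q / ‖x‖

/-- The change of coordinates from Beltrami coordinates `x` to `y = r x/|x|`. -/
def toRN (M Q : ℝ) (x : E3) : E3 := (radius M Q x / ‖x‖) • x

/-- The optical metric in Beltrami coordinates. -/
def opt (M Q : ℝ) : E3 → Matrix (Fin 3) (Fin 3) ℝ := pullback (toRN M Q) (rnOptical M Q)

/-- The function `H` with `√μ H = 4 π μ V_O + M`. -/
def HH (M Q : ℝ) (x : E3) : ℝ := (4 * Real.pi * mu M Q * VO x + M) / √(mu M Q)

/-- `Φ` is regular at the horizon: the components of `F = d(Φ dt)` in ingoing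
Eddington–Finkelstein coordinates `(v, x)`, `dv = dt + dr/f`, namely
`F_{iv} = ∂_iΦ` and `F_{ij} = -(∂_iΦ ∂_j r - ∂_jΦ ∂_i r)/f`,
extend smoothly across the horizon `‖x‖ = 1`. -/
def HorizonRegular (M Q : ℝ) (Φ : E3 → ℝ) : Prop :=
  ∃ U : Set E3, IsOpen U ∧ Metric.sphere 0 1 ⊆ U ∧
    ∃ (Fv : Fin 3 → E3 → ℝ) (Fs : Fin 3 → Fin 3 → E3 → ℝ),
      (∀ i, ContDiffOn ℝ ∞ (Fv i) U) ∧ (∀ i j, ContDiffOn ℝ ∞ (Fs i j) U) ∧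
      ∀ x ∈ U ∩ hball,
        (∀ i, Fv i x = pd i Φ x) ∧
        ∀ i j, Fs i j x = -(pd i Φ x * pd j (radius M Q) x - pd j Φ x * pd i (radius M Q) x) /
          lapseSq M Q (radius M Q x)

/-- `Φ` is the electrostatic potential of a unit point charge at `x₀` outside a hole without net
charge: it solves `-Δ Φ = δ_{x₀}` for the optical metric, vanishes at the asymptotically flat end,
is regular at the horizon, and has no flux through the spheres that enclose the horizon but not
`x₀`. -/
structure IsPointChargePotential (M Q : ℝ) (x₀ : E3) (Φ : E3 → ℝ) : Prop where
  green : IsGreen (opt M Q) ext x₀ Φ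
  infinity : Tendsto Φ (𝓝[≠] 0) (𝓝 0)
  horizon : HorizonRegular M Q Φ
  gauss : ∀ R : ℝ, ‖x₀‖ < R → R < 1 → flux (opt M Q) Φ R = 0

/-- `(V_O(T x) + A) / (H(x) H(x₀)) + B`. -/
def greenFamily (M Q : ℝ) (T : E3 → E3) (x₀ : E3) (A B : ℝ) (x : E3) : ℝ :=
  (VO (T x) + A) / (HH M Q x * HH M Q x₀) + B

/-- `(V_O(T x) + M/(4πμ)) / (H(x) H(x₀))`. -/
def Gtilde (M Q : ℝ) (T : E3 → E3) (x₀ : E3) (x : E3) : ℝ :=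
  (VO (T x) + M / (4 * Real.pi * mu M Q)) / (HH M Q x * HH M Q x₀)

/-! ### Maxwell's equations on the spacetime -/

/-- Spacetime indices: `t` and the three spatial ones. -/
abbrev Idx : Type := Unit ⊕ Fin 3

/-- Coordinate directions of `(t, x)`. -/
def dir : Idx → ℝ × E3
  | Sum.inl _ => (1, 0)
  | Sum.inr i => (0, EuclideanSpace.single i 1)

/-- The Reissner–Nordström metric `-f dt² + dr²/f + r² dΩ²` in the coordinates `(t, x)`, with `x`
the Beltrami coordinate. -/
def rnSpacetime (M Q : ℝ) (p : ℝ × E3) : Matrix Idx Idx ℝ :=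
  Matrix.fromBlocks (Matrix.of fun _ _ => -lapseSq M Q (radius M Q p.2)) 0 0
    (pullback (toRN M Q) (rnSpatial M Q) p.2)

/-- Components `F_{ab} = ∂_a A_b - ∂_b A_a` of `dA`. -/
def extDer (A : ℝ × E3 → Idx → ℝ) (p : ℝ × E3) (a b : Idx) : ℝ :=
  fderiv ℝ (fun q => A q b) p (dir a) - fderiv ℝ (fun q => A q a) p (dir b)

/-- `½ √|det g| g^{ac} g^{bd} (dA)_{cd} (dα)_{ab}`. -/
def maxwellDensity (g : ℝ × E3 → Matrix Idx Idx ℝ) (A α : ℝ × E3 → Idx → ℝ) (p : ℝ × E3) : ℝ :=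
  1 / 2 * √|(g p).det| *
    ∑ a, ∑ b, ∑ c, ∑ d, (g p)⁻¹ a c * (g p)⁻¹ b d * extDer A p c d * extDer α p a b

/-- The one-form `Φ dt`. -/
def staticForm (Φ : E3 → ℝ) (p : ℝ × E3) : Idx → ℝ := Sum.elim (fun _ => Φ p.2) (fun _ => 0)

/-- `F = dA` satisfies `∇_a F^{ab} = J^b` on `ℝ × U` in the sense of distributions, `J` being the
current of a unit charge at rest at `x₀`, i.e. `∫ J^b α_b dvol = ∫ α_t(t, x₀) dt`. -/
def SolvesMaxwellStaticCharge (g : ℝ × E3 → Matrix Idx Idx ℝ) (U : Set E3) (x₀ : E3)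
    (A : ℝ × E3 → Idx → ℝ) : Prop :=
  ∀ α : ℝ × E3 → Idx → ℝ, ContDiff ℝ ∞ α → HasCompactSupport α → tsupport α ⊆ univ ×ˢ U →
    Integrable (maxwellDensity g A α) ∧
    -(∫ p, maxwellDensity g A α p) = ∫ t : ℝ, α (t, x₀) (Sum.inl ())

end OpticalBH

end

open MeasureTheory Filter Topology Set
open scoped ContDiff Matrix

noncomputable section

namespace OpticalBH

/-! ### Partial derivatives and rotationally covariant matrices -/

/-! In the coordinate `x` with `r = M + μ/|x|` one has `f = ((r - M)² - μ²)/r²`, which vanishes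
exactly at `|x| = 1`, and the optical metric becomes `H⁴ h` with `H = r/√μ` (`opt_eq`). Since `H` is
harmonic for `h`, the Laplacians are conjugate: `Δ_{H⁴h} φ = H⁻⁵ Δ_h(Hφ)` (`lapDensity_opt`). Hence
a hyperbolic Green's function, plus a constant, divided by `H(x) H(x₀)` is a Green's function of the
optical metric.

The hyperbolic side is made explicit. An isometry carrying `a` to the centre has `|T x|` independent
of the choice of `T`: maps preserving `h` and fixing the centre do not increase the distance to it
(`norm_le_of_hypForm_eq`), so `T` can be compared with the explicit reflection `swap a`. This gives
`V_O ∘ T = coulomb a = (1 - a·x)/(4π√q)` with `q = quad a x` (`IsHypIsometry.VO_comp`). Geodesics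
are straight in Beltrami coordinates, and correspondingly the gradient density `efield a` is a
multiple of `(x - a)/q^{3/2}`. A linear map turns `q` into the Euclidean square norm, so the charge
of this field is that of the Euclidean Coulomb field, found by integrating along rays
(`integral_fderiv_efield`). Integration by parts across the pole, done by regularising `q` to `q +
ε`, yields the distributional equations. Maxwell's equations for `Φ dt` reduce to them because all
powers of `f` cancel (`maxwellDensity_staticForm`).

Uniqueness rests on three facts. (i) A weakly harmonic function on the ball tending to zero at the
boundary vanishes where it is continuous (`eq_zero_of_weakly_harmonic`): testing with functions of
`W = coulomb a` shows that its averages over a shell near `a` and over a shell near the boundary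
agree. (ii) A singularity `o(1/|x|)` at the centre is removable (`weakly_harmonic_of_removable`).
(iii) A potential regular at the horizon tends to a constant there (`HorizonRegular.exists_limit`):
smoothness of `F_{ij}`, which carries a factor `1/f`, forces the tangential derivative to be `O(1 -
|x|²)`. For two candidates `Φ`, `P` the function `H(Φ - P) - c` then vanishes for a suitable `c`, as
`H` is of order `1/|x|` at `O` while `Φ - P → 0`. One additive constant `A` is left, and the flux,
computed from the flux and the spherical mean of `coulomb a`, is affine in `A` and independent of
the radius (`flux_coulombFamily`), so Gauss's law fixes it.

The decay comes from rationalising `coulomb a x - 1/(4π)`, whose numerator is `(1 - |x|²)(1 -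
|a|²)`, together with `1 - |a|² = 1/cosh² D(a, O)`. -/

lemma fderiv_eq_sum_pd (f : E3 → ℝ) (x v : E3) : fderiv ℝ f x v = ∑ i, v i * pd i f x := by
  conv_lhs => rw [← (EuclideanSpace.basisFun (Fin 3) ℝ).sum_repr v]
  simp [map_sum, pd]

lemma inner_eq_sum (x v : E3) : inner ℝ x v = ∑ i, x i * v i := by
  simp [PiLp.inner_apply, mul_comm]

lemma normSq_eq_sum (x : E3) : ‖x‖ ^ 2 = ∑ i, x i * x i := by
  rw [← inner_eq_sum, real_inner_self_eq_norm_sq]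

lemma isOpen_hball : IsOpen hball := Metric.isOpen_ball

lemma isOpen_ext : IsOpen ext := isOpen_hball.sdiff isClosed_singleton

lemma ext_subset : ext ⊆ hball := sdiff_subset

lemma mem_hball {x : E3} : x ∈ hball ↔ ‖x‖ < 1 := by simp [hball]

lemma zero_mem_hball : (0 : E3) ∈ hball := by simp [hball]

lemma mem_ext {x : E3} : x ∈ ext ↔ ‖x‖ < 1 ∧ x ≠ 0 := by simp [ext, mem_hball]

lemma one_sub_normSq_pos {x : E3} (hx : x ∈ hball) : 0 < 1 - ‖x‖ ^ 2 := by
  have := mem_hball.1 hx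
  nlinarith [norm_nonneg x]

lemma pd_congr {f g : E3 → ℝ} {x : E3} (h : f =ᶠ[𝓝 x] g) (i : Fin 3) : pd i f x = pd i g x := by
  rw [pd, pd, h.fderiv_eq]

/-- The matrix `α 1 + κ x xᵀ`. -/
def radMat (α κ : ℝ) (x : E3) : Matrix (Fin 3) (Fin 3) ℝ :=
  Matrix.of fun i j => (if i = j then α else 0) + κ * (x i * x j)

lemma radMat_eq (α κ : ℝ) (x : E3) :
    radMat α κ x = α • 1 + κ • Matrix.vecMulVec x x := by
  ext i j
  simp [radMat, Matrix.vecMulVec_apply, Matrix.one_apply]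

lemma radMat_mul (α κ β γ : ℝ) (x : E3) :
    radMat α κ x * radMat β γ x = radMat (α * β) (α * γ + κ * β + κ * γ * ‖x‖ ^ 2) x := by
  have h : Matrix.vecMulVec x x * Matrix.vecMulVec x x = ‖x‖ ^ 2 • Matrix.vecMulVec x.ofLp x := by
    rw [Matrix.vecMulVec_mul_vecMulVec, normSq_eq_sum]
    ext i j
    simp [dotProduct, Matrix.vecMulVec_apply, mul_left_comm]
  simp only [radMat_eq, add_mul, mul_add, smul_mul_assoc, mul_smul_comm, h, one_mul, mul_one,
    smul_smul]
  module

lemma radMat_transpose (α κ : ℝ) (x : E3) : (radMat α κ x)ᵀ = radMat α κ x := by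
  ext i j
  simp [radMat, mul_comm (x i), eq_comm (a := i)]

lemma radMat_one (x : E3) : radMat 1 0 x = 1 := by simp [radMat_eq]

lemma smul_radMat (c α κ : ℝ) (x : E3) : c • radMat α κ x = radMat (c * α) (c * κ) x := by
  simp [radMat_eq, smul_smul]

lemma det_radMat (α κ : ℝ) (x : E3) :
    (radMat α κ x).det = α ^ 2 * (α + κ * ‖x‖ ^ 2) := by
  rw [Matrix.det_fin_three, normSq_eq_sum]
  simp [radMat, Fin.sum_univ_three]
  ring

/-- The Sherman–Morrison formula for a rank-one perturbation of a scalar matrix. -/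
lemma inv_radMat {α κ : ℝ} {x : E3} (hα : α ≠ 0) (h : α + κ * ‖x‖ ^ 2 ≠ 0) :
    (radMat α κ x)⁻¹ = radMat α⁻¹ (-κ / (α * (α + κ * ‖x‖ ^ 2))) x := by
  apply Matrix.inv_eq_right_inv
  rw [radMat_mul, ← radMat_one x]
  congr 1
  · field_simp
  · field_simp
    ring

lemma hyp_eq_radMat (x : E3) :
    hyp x = radMat (1 - ‖x‖ ^ 2)⁻¹ ((1 - ‖x‖ ^ 2) ^ 2)⁻¹ x := by
  ext i j
  simp [hyp, radMat, div_eq_mul_inv]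
  ring

lemma det_hyp {x : E3} (hx : x ∈ hball) : (hyp x).det = ((1 - ‖x‖ ^ 2) ^ 4)⁻¹ := by
  have := one_sub_normSq_pos hx
  rw [hyp_eq_radMat, det_radMat]
  field_simp
  ring

lemma volDensity_hyp {x : E3} (hx : x ∈ hball) :
    volDensity hyp x = ((1 - ‖x‖ ^ 2) ^ 2)⁻¹ := by
  have := one_sub_normSq_pos hx
  rw [volDensity, det_hyp hx, show (1 - ‖x‖ ^ 2) ^ 4 = ((1 - ‖x‖ ^ 2) ^ 2) ^ 2 by ring, ← inv_pow,
    Real.sqrt_sq (by positivity)]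

lemma inv_hyp {x : E3} (hx : x ∈ hball) :
    (hyp x)⁻¹ = radMat (1 - ‖x‖ ^ 2) (-(1 - ‖x‖ ^ 2)) x := by
  have := one_sub_normSq_pos hx
  have h2 : (1 - ‖x‖ ^ 2)⁻¹ + ((1 - ‖x‖ ^ 2) ^ 2)⁻¹ * ‖x‖ ^ 2 = ((1 - ‖x‖ ^ 2) ^ 2)⁻¹ := by
    field_simp
    ring
  rw [hyp_eq_radMat, inv_radMat (by positivity) (by rw [h2]; positivity), h2]
  congr 1
  · simp
  · field_simp

lemma sum_radMat (α κ : ℝ) (x : E3) (w : Fin 3 → ℝ) (i : Fin 3) :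
    ∑ j, radMat α κ x i j * w j = α * w i + κ * x i * ∑ j, x j * w j := by
  simp only [radMat, Matrix.of_apply, add_mul, Finset.sum_add_distrib, ite_mul, zero_mul,
    Finset.sum_ite_eq, Finset.mem_univ, if_true, Finset.mul_sum]
  congr 1
  exact Finset.sum_congr rfl fun j _ => by ring

/-- The powers of `1 - |x|²` combine so that `√(det h) h⁻¹ = (1 - |x|²)⁻¹ (1 - x xᵀ)`. Later
computations with the hyperbolic metric use only this form. -/
lemma gradDensity_hyp {x : E3} (hx : x ∈ hball) (f : E3 → ℝ) (i : Fin 3) :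
    gradDensity hyp f i x = (1 - ‖x‖ ^ 2)⁻¹ * (pd i f x - x i * fderiv ℝ f x x) := by
  have := one_sub_normSq_pos hx
  simp only [gradDensity, mul_assoc, ← Finset.mul_sum, inv_hyp hx, sum_radMat, volDensity_hyp hx,
    fderiv_eq_sum_pd f x x]
  field_simp
  ring

lemma laplacian_mul_volDensity {g : E3 → Matrix (Fin 3) (Fin 3) ℝ} {x : E3}
    (h : volDensity g x ≠ 0) (f : E3 → ℝ) :
    laplacian g f x * volDensity g x = ∑ i, pd i (gradDensity g f i) x := by
  rw [laplacian]
  field_simp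

lemma gradDensity_congr {g : E3 → Matrix (Fin 3) (Fin 3) ℝ} {f₁ f₂ : E3 → ℝ} {x : E3}
    (h : f₁ =ᶠ[𝓝 x] f₂) (i : Fin 3) : gradDensity g f₁ i x = gradDensity g f₂ i x := by
  simp only [gradDensity, pd_congr h]

/-- The energy density `√(det h) h^{ij} ∂_i f₁ ∂_j f₂` is symmetric. -/
lemma sum_gradDensity_hyp_comm {x : E3} (hx : x ∈ hball) (f₁ f₂ : E3 → ℝ) :
    ∑ i, gradDensity hyp f₁ i x * pd i f₂ x = ∑ i, pd i f₁ x * gradDensity hyp f₂ i x := by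
  simp only [gradDensity_hyp hx, fderiv_eq_sum_pd _ x x, Fin.sum_univ_three]
  ring

/-! ### The optical metric -/

lemma mu_pos {M Q : ℝ} (h : |Q| < M) : 0 < mu M Q := by
  apply Real.sqrt_pos.2
  have := abs_nonneg Q
  nlinarith [sq_abs Q]

lemma M_pos {M Q : ℝ} (h : |Q| < M) : 0 < M := (abs_nonneg Q).trans_lt h

lemma mu_sq {M Q : ℝ} (h : |Q| < M) : mu M Q ^ 2 = M ^ 2 - Q ^ 2 := by
  apply Real.sq_sqrt
  have := abs_nonneg Q
  nlinarith [sq_abs Q]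

lemma radius_pos {M Q : ℝ} (h : |Q| < M) (x : E3) : 0 < radius M Q x := by
  have := M_pos h
  have := mu_pos h
  have := norm_nonneg x
  unfold radius
  positivity

lemma HH_eq (M Q : ℝ) (x : E3) : HH M Q x = radius M Q x / √(mu M Q) := by
  rw [HH, radius, VO]
  congr 1
  have := Real.pi_pos
  rw [add_comm]
  congr 1
  -- At the centre both quotients are `0` by the convention for division by zero, so the identity
  -- needs no hypothesis on `x`.
  rcases eq_or_ne ‖x‖ 0 with h | h
  · simp [h]
  · field_simp

lemma HH_pos {M Q : ℝ} (h : |Q| < M) (x : E3) : 0 < HH M Q x := by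
  rw [HH_eq]
  exact div_pos (radius_pos h x) (Real.sqrt_pos.2 (mu_pos h))

/-- From `f = ((r - M)² - μ²)/r²` and `r - M = μ/|x|`. The simple zero in `1 - |x|²` governs
everything that happens at the horizon. -/
lemma lapseSq_radius {M Q : ℝ} (h : |Q| < M) {x : E3} (hx : x ≠ 0) :
    lapseSq M Q (radius M Q x) =
      mu M Q ^ 2 * (1 - ‖x‖ ^ 2) / (‖x‖ ^ 2 * radius M Q x ^ 2) := by
  have hr := radius_pos h x
  have hn : 0 < ‖x‖ := norm_pos_iff.2 hx
  have e : mu M Q = (radius M Q x - M) * ‖x‖ := by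
    unfold radius
    field_simp
    ring
  have hq : Q ^ 2 = M ^ 2 - mu M Q ^ 2 := by rw [mu_sq h]; ring
  rw [lapseSq, hq, e]
  field_simp
  ring

lemma norm_toRN {M Q : ℝ} (h : |Q| < M) {x : E3} (hx : x ≠ 0) :
    ‖toRN M Q x‖ = radius M Q x := by
  have hn : 0 < ‖x‖ := norm_pos_iff.2 hx
  have := radius_pos h x
  rw [toRN, norm_smul, Real.norm_eq_abs, abs_of_pos (by positivity)]
  field_simp

lemma hasFDerivAt_norm {x : E3} (hx : x ≠ 0) :
    HasFDerivAt (fun y : E3 => ‖y‖) (‖x‖⁻¹ • innerSL ℝ x) x := by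
  have h := (hasStrictFDerivAt_norm_sq x).hasFDerivAt.sqrt (by simpa using hx)
  have hn : 0 < ‖x‖ := norm_pos_iff.2 hx
  simp only [Real.sqrt_sq (norm_nonneg _)] at h
  refine h.congr_fderiv (ContinuousLinearMap.ext fun v => ?_)
  simp
  field_simp

lemma hasFDerivAt_inv_norm {x : E3} (hx : x ≠ 0) :
    HasFDerivAt (fun y : E3 => ‖y‖⁻¹) (-(‖x‖ ^ 3)⁻¹ • innerSL ℝ x) x := by
  have hn : 0 < ‖x‖ := norm_pos_iff.2 hx
  have h := (hasDerivAt_inv hn.ne').comp_hasFDerivAt x (hasFDerivAt_norm hx)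
  refine h.congr_fderiv (ContinuousLinearMap.ext fun v => ?_)
  simp
  field_simp

lemma hasFDerivAt_radius (M Q : ℝ) {x : E3} (hx : x ≠ 0) :
    HasFDerivAt (radius M Q) (-(mu M Q / ‖x‖ ^ 3) • innerSL ℝ x) x := by
  have h := ((hasFDerivAt_inv_norm hx).const_mul (mu M Q)).const_add M
  refine h.congr_fderiv (ContinuousLinearMap.ext fun v => ?_)
  simp
  ring

lemma jac_toRN (M Q : ℝ) {x : E3} (hx : x ≠ 0) :
    jac (toRN M Q) x = radMat (radius M Q x / ‖x‖)
      (-(mu M Q / ‖x‖ ^ 4 + radius M Q x / ‖x‖ ^ 3)) x := by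
  have hn : 0 < ‖x‖ := norm_pos_iff.2 hx
  have h := ((hasFDerivAt_radius M Q hx).mul (hasFDerivAt_inv_norm hx)).smul (hasFDerivAt_id x)
  ext i j
  have e : toRN M Q = (radius M Q * fun y => ‖y‖⁻¹) • id := by
    ext y
    simp [toRN, div_eq_mul_inv]
  rw [jac, Matrix.of_apply, e, HasFDerivAt.fderiv h]
  by_cases hij : i = j
  · subst hij
    simp [radMat, inner_eq_sum]
    field_simp
  · simp [radMat, hij, inner_eq_sum]
    field_simp

lemma rnSpatial_toRN {M Q : ℝ} (h : |Q| < M) {x : E3} (hx : x ≠ 0) :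
    rnSpatial M Q (toRN M Q x) =
      radMat 1 ((1 / lapseSq M Q (radius M Q x) - 1) / ‖x‖ ^ 2) x := by
  have hn : 0 < ‖x‖ := norm_pos_iff.2 hx
  have hr := radius_pos h x
  ext i j
  simp only [rnSpatial, radMat, norm_toRN h hx, Matrix.of_apply]
  congr 1
  simp only [toRN, PiLp.smul_apply, smul_eq_mul]
  generalize lapseSq M Q (radius M Q x) = f
  field_simp

/-- The radial and angular parts of the spatial metric in Beltrami coordinates. -/
lemma pullback_rnSpatial {M Q : ℝ} (h : |Q| < M) {x : E3} (hx : x ∈ ext) :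
    pullback (toRN M Q) (rnSpatial M Q) x =
      (lapseSq M Q (radius M Q x) * HH M Q x ^ 4) • hyp x := by
  obtain ⟨hx1, hx0⟩ := mem_ext.1 hx
  have hn : 0 < ‖x‖ := norm_pos_iff.2 hx0
  have hr := radius_pos h x
  have hm := mu_pos h
  have hb := one_sub_normSq_pos (ext_subset hx)
  have hs : √(mu M Q) ^ 4 = mu M Q ^ 2 := by
    rw [show √(mu M Q) ^ 4 = (√(mu M Q) ^ 2) ^ 2 by ring, Real.sq_sqrt hm.le]
  have hf := lapseSq_radius h hx0
  have e : mu M Q = (radius M Q x - M) * ‖x‖ := by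
    unfold radius
    field_simp
    ring
  rw [pullback, rnSpatial_toRN h hx0, jac_toRN M Q hx0, radMat_transpose, radMat_mul, radMat_mul,
    hyp_eq_radMat, smul_radMat, HH_eq, div_pow, hs, hf]
  congr 1
  · field_simp
  · field_simp
    ring

lemma lapseSq_radius_pos {M Q : ℝ} (h : |Q| < M) {x : E3} (hx : x ∈ ext) :
    0 < lapseSq M Q (radius M Q x) := by
  obtain ⟨hx1, hx0⟩ := mem_ext.1 hx
  have hn : 0 < ‖x‖ := norm_pos_iff.2 hx0
  have hr := radius_pos h x
  have hm := mu_pos h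
  have hb := one_sub_normSq_pos (ext_subset hx)
  rw [lapseSq_radius h hx0]
  positivity

lemma opt_eq_smul_pullback {M Q : ℝ} (h : |Q| < M) {x : E3} (hx : x ∈ ext) :
    opt M Q x = (lapseSq M Q (radius M Q x))⁻¹ • pullback (toRN M Q) (rnSpatial M Q) x := by
  simp [opt, pullback, rnOptical, norm_toRN h (mem_ext.1 hx).2]

lemma opt_eq {M Q : ℝ} (h : |Q| < M) {x : E3} (hx : x ∈ ext) :
    opt M Q x = HH M Q x ^ 4 • hyp x := by
  rw [opt_eq_smul_pullback h hx, pullback_rnSpatial h hx, smul_smul,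
    inv_mul_cancel_left₀ (lapseSq_radius_pos h hx).ne']

lemma det_opt {M Q : ℝ} (h : |Q| < M) {x : E3} (hx : x ∈ ext) :
    volDensity (opt M Q) x = HH M Q x ^ 6 * volDensity hyp x := by
  have hH := HH_pos h x
  rw [volDensity, volDensity, opt_eq h hx, Matrix.det_smul, Fintype.card_fin, Real.sqrt_mul
    (by positivity), show (HH M Q x ^ 4) ^ 3 = (HH M Q x ^ 6) ^ 2 by ring,
    Real.sqrt_sq (by positivity)]

lemma volDensity_hyp_ne_zero {x : E3} (hx : x ∈ hball) : volDensity hyp x ≠ 0 := by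
  have := one_sub_normSq_pos hx
  rw [volDensity_hyp hx]
  positivity

lemma volDensity_opt_ne_zero {M Q : ℝ} (h : |Q| < M) {x : E3} (hx : x ∈ ext) :
    volDensity (opt M Q) x ≠ 0 := by
  rw [det_opt h hx]
  exact mul_ne_zero (pow_pos (HH_pos h x) 6).ne' (volDensity_hyp_ne_zero (ext_subset hx))

/-- In dimension three the volume density scales by `H⁶` and the inverse metric by `H⁻⁴`, which
leaves `H²`. -/
lemma gradDensity_opt {M Q : ℝ} (h : |Q| < M) {x : E3} (hx : x ∈ ext) (f : E3 → ℝ) (i : Fin 3) :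
    gradDensity (opt M Q) f i x = HH M Q x ^ 2 * gradDensity hyp f i x := by
  have hH := HH_pos h x
  have hu : IsUnit (hyp x).det := by
    rw [det_hyp (ext_subset hx)]
    have := one_sub_normSq_pos (ext_subset hx)
    exact (IsUnit.mk0 _ (by positivity))
  have hi : (opt M Q x)⁻¹ = (HH M Q x ^ 4)⁻¹ • (hyp x)⁻¹ := by
    rw [opt_eq h hx]
    apply Matrix.inv_eq_right_inv
    rw [smul_mul_smul_comm, Matrix.mul_nonsing_inv _ hu, mul_inv_cancel₀ (by positivity), one_smul]
  simp only [gradDensity, hi, det_opt h hx, Finset.mul_sum, Matrix.smul_apply, smul_eq_mul]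
  refine Finset.sum_congr rfl fun j _ => ?_
  field_simp

lemma bijOn_toRN {M Q : ℝ} (h : |Q| < M) : BijOn (toRN M Q) ext {y | M + mu M Q < ‖y‖} := by
  have hm := mu_pos h
  have hM := M_pos h
  refine ⟨fun x hx => ?_, fun x hx x' hx' e => ?_, fun y hy => ?_⟩
  · obtain ⟨h1, h0⟩ := mem_ext.1 hx
    have hn : 0 < ‖x‖ := norm_pos_iff.2 h0
    rw [mem_ofPred_eq, norm_toRN h h0, radius]
    have : mu M Q < mu M Q / ‖x‖ := by rw [lt_div_iff₀ hn]; nlinarith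
    linarith
  · have h0 := (mem_ext.1 hx).2
    have h0' := (mem_ext.1 hx').2
    have hn : 0 < ‖x‖ := norm_pos_iff.2 h0
    have hn' : 0 < ‖x'‖ := norm_pos_iff.2 h0'
    have e1 := congrArg norm e
    rw [norm_toRN h h0, norm_toRN h h0'] at e1
    have e2 : ‖x‖ = ‖x'‖ := by
      unfold radius at e1
      have := add_left_cancel e1
      field_simp at this
      exact this.symm
    unfold toRN at e
    rw [e1, e2] at e
    exact smul_right_injective E3 (div_pos (radius_pos h x') hn').ne' e
  · rw [mem_ofPred_eq] at hy
    have hy0 : 0 < ‖y‖ := by linarith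
    have hd : 0 < ‖y‖ - M := by linarith
    -- Solving `|y| = M + μ/|x|` gives `|x| = μ/(|y| - M)`, in the direction of `y`.
    set x : E3 := (mu M Q / ((‖y‖ - M) * ‖y‖)) • y with hx
    have hnx : ‖x‖ = mu M Q / (‖y‖ - M) := by
      rw [hx, norm_smul, Real.norm_eq_abs, abs_of_pos (by positivity)]
      field_simp
    have hnp : 0 < ‖x‖ := by rw [hnx]; positivity
    refine ⟨x, mem_ext.2 ⟨?_, norm_pos_iff.1 hnp⟩, ?_⟩
    · rw [hnx, div_lt_one hd]
      linarith
    · rw [toRN, radius, hnx, hx, smul_smul]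
      convert one_smul ℝ y
      field_simp
      ring

lemma contDiffAt_radius (M Q : ℝ) {x : E3} (hx : x ≠ 0) : ContDiffAt ℝ ∞ (radius M Q) x := by
  unfold radius
  exact contDiffAt_const.add (contDiffAt_const.div (contDiffAt_norm ℝ hx) (norm_ne_zero_iff.2 hx))

lemma contDiffOn_toRN (M Q : ℝ) : ContDiffOn ℝ ∞ (toRN M Q) ext := fun _ hx =>
  have hx := (mem_ext.1 hx).2
  (((contDiffAt_radius M Q hx).div (contDiffAt_norm ℝ hx) (norm_ne_zero_iff.2 hx)).smul
    contDiffAt_id).contDiffWithinAt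

lemma contDiffAt_HH (M Q : ℝ) {x : E3} (hx : x ≠ 0) : ContDiffAt ℝ ∞ (HH M Q) x := by
  rw [show HH M Q = fun y => radius M Q y / √(mu M Q) from funext (HH_eq M Q)]
  exact (contDiffAt_radius M Q hx).div_const _

/-! ### Isometries of hyperbolic space -/

/-- The hyperbolic metric as a bilinear form. -/
def hypForm (x u v : E3) : ℝ :=
  inner ℝ u v / (1 - ‖x‖ ^ 2) + inner ℝ x u * inner ℝ x v / (1 - ‖x‖ ^ 2) ^ 2

lemma dotProduct_hyp_mulVec (x u v : E3) : u ⬝ᵥ (hyp x *ᵥ v) = hypForm x u v := by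
  have h : hyp x *ᵥ v = fun i => (1 - ‖x‖ ^ 2)⁻¹ * v i +
      ((1 - ‖x‖ ^ 2) ^ 2)⁻¹ * x i * ∑ j, x j * v j := by
    ext i
    rw [hyp_eq_radMat, Matrix.mulVec, dotProduct, sum_radMat]
  rw [h, hypForm, inner_eq_sum, inner_eq_sum, inner_eq_sum]
  simp only [dotProduct, Fin.sum_univ_three]
  ring

lemma jac_mulVec (T : E3 → E3) (x v : E3) : jac T x *ᵥ v = fderiv ℝ T x v := by
  ext i
  conv_rhs => rw [← (EuclideanSpace.basisFun (Fin 3) ℝ).sum_repr v]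
  simp [map_sum, jac, Matrix.mulVec, dotProduct, mul_comm]

lemma dotProduct_pullback_mulVec (T : E3 → E3) (x u v : E3) :
    u ⬝ᵥ (pullback T hyp x *ᵥ v) = hypForm (T x) (fderiv ℝ T x u) (fderiv ℝ T x v) := by
  rw [← dotProduct_hyp_mulVec, ← jac_mulVec, ← jac_mulVec, pullback, ← Matrix.mulVec_mulVec,
    ← Matrix.mulVec_mulVec, Matrix.dotProduct_mulVec, Matrix.vecMul_transpose]

lemma pullback_hyp_eq_iff {T : E3 → E3} {x : E3} :
    pullback T hyp x = hyp x ↔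
      ∀ u v, hypForm (T x) (fderiv ℝ T x u) (fderiv ℝ T x v) = hypForm x u v := by
  refine ⟨fun h u v => by rw [← dotProduct_pullback_mulVec, h, dotProduct_hyp_mulVec],
    fun h => ?_⟩
  ext i j
  have := h (EuclideanSpace.single i 1) (EuclideanSpace.single j 1)
  rw [← dotProduct_pullback_mulVec, ← dotProduct_hyp_mulVec] at this
  simpa using this

/-! ### Explicit isometries exchanging the centre with a given point -/

/-- The hyperbolic reflection that exchanges `0` and `a`. -/
def swap (a x : E3) : E3 :=
  (1 - inner ℝ a x)⁻¹ •
    (√(1 - ‖a‖ ^ 2) • x + (1 - inner ℝ a x / (1 - √(1 - ‖a‖ ^ 2))) • a)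

lemma one_sub_inner_pos {a x : E3} (ha : a ∈ hball) (hx : ‖x‖ ≤ 1) : 0 < 1 - inner ℝ a x := by
  have := real_inner_le_norm a x
  have h := mem_hball.1 ha
  nlinarith [norm_nonneg a, norm_nonneg x]

lemma sqrt_lt_one_of_mem_ext {a : E3} (ha : a ∈ ext) :
    0 < √(1 - ‖a‖ ^ 2) ∧ √(1 - ‖a‖ ^ 2) < 1 ∧ ‖a‖ ^ 2 = 1 - √(1 - ‖a‖ ^ 2) ^ 2 := by
  have h := one_sub_normSq_pos (ext_subset ha)
  have hn : 0 < ‖a‖ := norm_pos_iff.2 (mem_ext.1 ha).2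
  refine ⟨Real.sqrt_pos.2 h, ?_, ?_⟩
  · rw [Real.sqrt_lt' one_pos]
    nlinarith
  · rw [Real.sq_sqrt h.le]
    ring

/-- `1 - x·y` is, up to sign, the Lorentz product of `(1, x)` and `(1, y)`. The map `swap a` is the
projective action of a Lorentz reflection, so this product is preserved up to the rescalings that
restore the first coordinate to `1`. -/
lemma one_sub_inner_swap {a x y : E3} (ha : a ∈ ext) (hx : ‖x‖ ≤ 1) (hy : ‖y‖ ≤ 1) :
    1 - inner ℝ (swap a x) (swap a y) =
      (1 - ‖a‖ ^ 2) * (1 - inner ℝ x y) / ((1 - inner ℝ a x) * (1 - inner ℝ a y)) := by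
  obtain ⟨h0, h1, h2⟩ := sqrt_lt_one_of_mem_ext ha
  have hx := one_sub_inner_pos (ext_subset ha) hx
  have hy := one_sub_inner_pos (ext_subset ha) hy
  simp only [swap]
  set s := √(1 - ‖a‖ ^ 2)
  have hs : 0 < 1 - s := by linarith
  simp only [inner_add_left, inner_add_right, real_inner_smul_left, real_inner_smul_right,
    real_inner_self_eq_norm_sq, real_inner_comm a x, h2]
  field_simp
  ring

lemma one_sub_normSq_swap {a x : E3} (ha : a ∈ ext) (hx : ‖x‖ ≤ 1) :
    1 - ‖swap a x‖ ^ 2 = (1 - ‖a‖ ^ 2) * (1 - ‖x‖ ^ 2) / (1 - inner ℝ a x) ^ 2 := by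
  rw [← real_inner_self_eq_norm_sq, one_sub_inner_swap ha hx hx, real_inner_self_eq_norm_sq,
    ← sq (1 - inner ℝ a x)]

lemma swap_zero (a : E3) : swap a 0 = a := by simp [swap]

lemma swap_self {a : E3} (ha : a ∈ ext) : swap a a = 0 := by
  obtain ⟨h0, h1, h2⟩ := sqrt_lt_one_of_mem_ext ha
  rw [swap, real_inner_self_eq_norm_sq, ← add_smul]
  set s := √(1 - ‖a‖ ^ 2)
  have hs : 0 < 1 - s := by linarith
  rw [show s + (1 - ‖a‖ ^ 2 / (1 - s)) = 0 by rw [h2]; field_simp; ring]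
  simp

lemma mapsTo_swap {a : E3} (ha : a ∈ ext) : MapsTo (swap a) hball hball := fun x hx => by
  have hx' := (mem_hball.1 hx).le
  have := one_sub_normSq_swap ha hx'
  have h1 := one_sub_normSq_pos (ext_subset ha)
  have h2 := one_sub_normSq_pos hx
  have h3 := one_sub_inner_pos (ext_subset ha) hx'
  have : 0 < 1 - ‖swap a x‖ ^ 2 := by rw [this]; positivity
  rw [mem_hball]
  nlinarith [norm_nonneg (swap a x)]

lemma swap_swap {a x : E3} (ha : a ∈ ext) (hx : x ∈ hball) : swap a (swap a x) = x := by
  have hx' := (mem_hball.1 hx).le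
  have h3 := one_sub_inner_pos (ext_subset ha) hx'
  obtain ⟨h0, h1, h2⟩ := sqrt_lt_one_of_mem_ext ha
  -- Since `a = swap a 0`, the invariance relation at the pair `0`, `x` computes this inner product.
  have e : 1 - inner ℝ a (swap a x) = (1 - ‖a‖ ^ 2) / (1 - inner ℝ a x) := by
    simpa [swap_zero] using one_sub_inner_swap ha (x := 0) (by simp) hx'
  have e' : inner ℝ a (swap a x) = 1 - (1 - ‖a‖ ^ 2) / (1 - inner ℝ a x) := by linarith
  conv_lhs => rw [swap, e, e']
  rw [swap]
  set s := √(1 - ‖a‖ ^ 2)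
  have hs : 0 < 1 - s := by linarith
  rw [h2]
  generalize inner ℝ a x = p at *
  have h4 : (0 : ℝ) < 1 - (1 - s ^ 2) := by nlinarith
  simp only [smul_add, smul_smul, add_assoc, ← add_smul]
  convert add_zero x using 2
  · convert one_smul ℝ x using 2
    field_simp
    ring
  · convert zero_smul ℝ a using 2
    field_simp
    ring

lemma hasFDerivAt_swap {a x : E3} (h : 1 - inner ℝ a x ≠ 0) :
    HasFDerivAt (swap a)
      ((1 - inner ℝ a x)⁻¹ • (√(1 - ‖a‖ ^ 2) • ContinuousLinearMap.id ℝ E3 -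
          (1 - √(1 - ‖a‖ ^ 2))⁻¹ • (innerSL ℝ a).smulRight a) +
        (1 - inner ℝ a x)⁻¹ • (innerSL ℝ a).smulRight (swap a x)) x := by
  have hi : HasFDerivAt (fun y : E3 => inner ℝ a y) (innerSL ℝ a) x := (innerSL ℝ a).hasFDerivAt
  have h1 := (hasDerivAt_inv h).comp_hasFDerivAt x (hi.const_sub 1)
  have h2 := ((hasFDerivAt_id (𝕜 := ℝ) x).const_smul √(1 - ‖a‖ ^ 2)).add
    (((hi.mul_const (1 - √(1 - ‖a‖ ^ 2))⁻¹).const_sub 1).smul_const a)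
  refine (h1.smul h2).congr_fderiv (ContinuousLinearMap.ext fun v => ?_)
  simp [swap]
  simp only [smul_sub, smul_smul, sub_smul, div_eq_mul_inv, ← inv_pow]
  module

lemma hypForm_swap {a x : E3} (ha : a ∈ ext) (hx : x ∈ hball) (u v : E3) :
    hypForm (swap a x) (fderiv ℝ (swap a) x u) (fderiv ℝ (swap a) x v) = hypForm x u v := by
  have hx' := (mem_hball.1 hx).le
  have h3 := one_sub_inner_pos (ext_subset ha) hx'
  have h4 := one_sub_normSq_pos hx
  obtain ⟨h0, h1, h2⟩ := sqrt_lt_one_of_mem_ext ha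
  rw [(hasFDerivAt_swap h3.ne').fderiv, hypForm, one_sub_normSq_swap ha hx', hypForm]
  have key : ∀ w : E3, inner ℝ (swap a x) w = (1 - inner ℝ a x)⁻¹ *
    (√(1 - ‖a‖ ^ 2) * inner ℝ x w + (1 - inner ℝ a x / (1 - √(1 - ‖a‖ ^ 2))) * inner ℝ a w) := by
    intro w
    simp only [swap, inner_add_left, real_inner_smul_left]
  simp only [add_apply, smul_apply,
    sub_apply, ContinuousLinearMap.smulRight_apply, innerSL_apply_apply,
    ContinuousLinearMap.id_apply, inner_add_left, inner_add_right, inner_sub_left,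
    inner_sub_right, real_inner_smul_left, real_inner_smul_right, real_inner_self_eq_norm_sq,
    real_inner_comm (swap a x) _, key, real_inner_comm a u]
  set s := √(1 - ‖a‖ ^ 2)
  rw [h2]
  have hs : 0 < 1 - s := by linarith
  have h5 : (0 : ℝ) < 1 - (1 - s ^ 2) := by nlinarith
  rw [real_inner_comm a x] at *
  generalize inner ℝ x a = p at *
  generalize ‖x‖ ^ 2 = X at *
  field_simp
  ring

lemma contDiffOn_swap {a : E3} (ha : a ∈ hball) : ContDiffOn ℝ ∞ (swap a) hball := fun x hx => by
  have h3 := one_sub_inner_pos ha (mem_hball.1 hx).le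
  have hi : ContDiffAt ℝ ∞ (fun y : E3 => inner ℝ a y) x := (innerSL ℝ a).contDiff.contDiffAt
  exact (((contDiffAt_const.sub hi).inv h3.ne').smul ((contDiffAt_id.const_smul _).add
    ((contDiffAt_const.sub (hi.div_const _)).smul contDiffAt_const))).contDiffWithinAt

lemma isHypIsometry_swap {a : E3} (ha : a ∈ ext) : IsHypIsometry (swap a) where
  smooth := contDiffOn_swap (ext_subset ha)
  mapsTo := mapsTo_swap ha
  inverse := ⟨swap a, contDiffOn_swap (ext_subset ha), mapsTo_swap ha,
    fun _ hx => swap_swap ha hx, fun _ hx => swap_swap ha hx⟩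
  isom _ hx := pullback_hyp_eq_iff.2 (hypForm_swap ha hx)

/-- A metric-preserving map of the ball that fixes the centre does not increase the distance to
the centre. -/
lemma norm_le_of_hypForm_eq {R : E3 → E3} (hd : DifferentiableOn ℝ R hball)
    (hm : MapsTo R hball hball) (h0 : R 0 = 0)
    (hi : ∀ x ∈ hball, ∀ v, hypForm (R x) (fderiv ℝ R x v) (fderiv ℝ R x v) = hypForm x v v)
    {x : E3} (hx : x ∈ hball) : ‖R x‖ ≤ ‖x‖ := by
  rcases eq_or_ne x 0 with rfl | hx0
  · simp [h0]
  have hn : 0 < ‖x‖ := norm_pos_iff.2 hx0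
  have hn1 := mem_hball.1 hx
  have hmem : ∀ t ∈ Icc (0 : ℝ) 1, t • x ∈ hball := fun t ht => by
    rw [mem_hball, norm_smul, Real.norm_eq_abs, abs_of_nonneg ht.1]
    nlinarith [ht.2]
  have hder : ∀ t ∈ Icc (0 : ℝ) 1, HasDerivAt (fun t : ℝ => ‖R (t • x)‖ ^ 2)
      (2 * inner ℝ (R (t • x)) (fderiv ℝ R (t • x) x)) t := fun t ht => by
    have h1 := ((hd _ (hmem t ht)).differentiableAt
      (isOpen_hball.mem_nhds (hmem t ht))).hasFDerivAt
    have h2 : HasDerivAt (fun t : ℝ => t • x) x t := by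
      simpa using (hasDerivAt_id t).smul_const x
    exact (h1.comp_hasDerivAt t h2).norm_sq
  -- The squared norm along the segment to `x` is compared with `(|x| t + ε)²`. Squares avoid the
  -- non-differentiability of the norm at `0`, and `ε` makes the comparison of derivatives strict at
  -- a time of contact.
  have hbound : ∀ ε > 0, ‖R x‖ ≤ ‖x‖ + ε := by
    intro ε hε
    have hB : ∀ t : ℝ, HasDerivAt (fun t : ℝ => (‖x‖ * t + ε) ^ 2)
        (2 * (‖x‖ * t + ε) * ‖x‖) t := fun t => by
      have := (((hasDerivAt_id t).const_mul ‖x‖).add_const ε).fun_pow 2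
      simpa using this
    have key := image_le_of_deriv_right_lt_deriv_boundary' (a := 0) (b := 1)
      (f := fun t : ℝ => ‖R (t • x)‖ ^ 2)
      (f' := fun t => 2 * inner ℝ (R (t • x)) (fderiv ℝ R (t • x) x))
      (B := fun t : ℝ => (‖x‖ * t + ε) ^ 2) (B' := fun t => 2 * (‖x‖ * t + ε) * ‖x‖)
      (fun t ht => (hder t ht).continuousAt.continuousWithinAt)
      (fun t ht => (hder t ⟨ht.1, ht.2.le⟩).hasDerivWithinAt)
      (by simp [h0]; positivity)
      (fun t _ => (hB t).continuousAt.continuousWithinAt)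
      (fun t _ => (hB t).hasDerivWithinAt)
      (fun t ht heq => by
        have htb := hmem t ⟨ht.1, ht.2.le⟩
        have hform := hi _ htb x
        have hp := one_sub_normSq_pos htb
        have hq := one_sub_normSq_pos (hm htb)
        simp only [hypForm, real_inner_smul_left, real_inner_self_eq_norm_sq] at hform
        have hnt : ‖t • x‖ ^ 2 = (t * ‖x‖) ^ 2 := by
          rw [norm_smul, Real.norm_eq_abs, mul_pow, sq_abs, mul_pow]
        rw [hnt] at hform hp
        set y := R (t • x)
        set w := fderiv ℝ R (t • x) x
        set c := inner ℝ y w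
        have hcs : c ^ 2 ≤ ‖y‖ ^ 2 * ‖w‖ ^ 2 := by
          rw [← mul_pow, sq_le_sq]
          exact (abs_real_inner_le_norm y w).trans (le_abs_self _)
        set b := ‖x‖ * t + ε with hb
        have ht0 := ht.1
        have hb0 : 0 < b := by positivity
        rw [heq] at hq hform hcs
        -- The radial length element is `dρ/(1 - ρ²)`. The next inequality says that the radial
        -- speed of the image, measured in this way, is at most the full speed, by Cauchy–Schwarz.
        have e1 : ‖x‖ ^ 2 / (1 - (t * ‖x‖) ^ 2) +
            t * ‖x‖ ^ 2 * (t * ‖x‖ ^ 2) / (1 - (t * ‖x‖) ^ 2) ^ 2 =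
            (‖x‖ / (1 - (t * ‖x‖) ^ 2)) ^ 2 := by
          field_simp
          ring
        rw [e1] at hform
        have e2 : (c / (b * (1 - b ^ 2))) ^ 2 ≤ (‖x‖ / (1 - (t * ‖x‖) ^ 2)) ^ 2 := by
          rw [← hform]
          have : c ^ 2 / b ^ 2 ≤ ‖w‖ ^ 2 := by
            rw [div_le_iff₀ (by positivity)]
            linarith
          have h3 : (c / (b * (1 - b ^ 2))) ^ 2 =
              (c ^ 2 / b ^ 2) / (1 - b ^ 2) + c * c / (1 - b ^ 2) ^ 2 := by
            field_simp
            ring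
          rw [h3]
          gcongr
        have e3 : c / (b * (1 - b ^ 2)) ≤ ‖x‖ / (1 - (t * ‖x‖) ^ 2) :=
          le_of_sq_le_sq e2 (by positivity)
        rw [div_le_iff₀ (by positivity)] at e3
        -- At contact the image lies at radius `b > t|x|`, where `1 - ρ²` is strictly smaller, so
        -- the image moves outwards strictly more slowly than the barrier.
        have e4 : (1 - b ^ 2) / (1 - (t * ‖x‖) ^ 2) < 1 := by
          rw [div_lt_one hp]
          have : 0 ≤ t * ‖x‖ := by positivity
          nlinarith
        calc 2 * c ≤ 2 * b * ‖x‖ * ((1 - b ^ 2) / (1 - (t * ‖x‖) ^ 2)) := by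
              calc 2 * c ≤ 2 * (‖x‖ / (1 - (t * ‖x‖) ^ 2) * (b * (1 - b ^ 2))) := by linarith
                _ = _ := by ring
          _ < 2 * b * ‖x‖ * 1 := by gcongr
          _ = 2 * b * ‖x‖ := by ring)
    have := key (x := 1) (by simp)
    simp only [one_smul, mul_one] at this
    exact le_of_sq_le_sq this (by positivity)
  exact le_of_forall_pos_le_add hbound

lemma hypForm_comp {R T : E3 → E3} {x : E3} (hR : DifferentiableAt ℝ R x)
    (hT : DifferentiableAt ℝ T (R x))
    (hRi : ∀ v, hypForm (R x) (fderiv ℝ R x v) (fderiv ℝ R x v) = hypForm x v v)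
    (hTi : ∀ v, hypForm (T (R x)) (fderiv ℝ T (R x) v) (fderiv ℝ T (R x) v) = hypForm (R x) v v)
    (v : E3) :
    hypForm ((T ∘ R) x) (fderiv ℝ (T ∘ R) x v) (fderiv ℝ (T ∘ R) x v) = hypForm x v v := by
  rw [fderiv_comp x hT hR, ← hRi v, ← hTi]
  rfl

lemma IsHypIsometry.hypForm_eq {T : E3 → E3} (hT : IsHypIsometry T) {x : E3} (hx : x ∈ hball)
    (v : E3) : hypForm (T x) (fderiv ℝ T x v) (fderiv ℝ T x v) = hypForm x v v :=
  pullback_hyp_eq_iff.1 (hT.isom x hx) v v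

lemma differentiableAt_of_contDiffOn_hball {T : E3 → E3} (hT : ContDiffOn ℝ ∞ T hball) {x : E3}
    (hx : x ∈ hball) : DifferentiableAt ℝ T x :=
  (hT.contDiffAt (isOpen_hball.mem_nhds hx)).differentiableAt (by simp)

/-- The distance from `T x` to the centre does not depend on the isometry with `T a = 0`. -/
lemma IsHypIsometry.norm_eq_norm_swap {T : E3 → E3} (hT : IsHypIsometry T) {a : E3} (ha : a ∈ ext)
    (h0 : T a = 0) {x : E3} (hx : x ∈ hball) : ‖T x‖ = ‖swap a x‖ := by
  obtain ⟨S, hS, hSm, hST, hTS⟩ := hT.inverse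
  have hsw := isHypIsometry_swap ha
  have dT := fun y hy => differentiableAt_of_contDiffOn_hball hT.smooth (x := y) hy
  have dS := fun y hy => differentiableAt_of_contDiffOn_hball hS (x := y) hy
  have dsw := fun y hy => differentiableAt_of_contDiffOn_hball hsw.smooth (x := y) hy
  -- The inverse preserves the metric as well: differentiate `T ∘ S = id`.
  have hSi : ∀ y ∈ hball, ∀ v,
      hypForm (S y) (fderiv ℝ S y v) (fderiv ℝ S y v) = hypForm y v v := fun y hy v => by
    have e : (fun z => T (S z)) =ᶠ[𝓝 y] fun z => z := by
      filter_upwards [isOpen_hball.mem_nhds hy] with z hz using hTS hz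
    have e2 := e.fderiv_eq (𝕜 := ℝ)
    rw [show (fun z => T (S z)) = T ∘ S from rfl, fderiv_comp y (dT _ (hSm hy)) (dS y hy),
      fderiv_fun_id] at e2
    have e3 := DFunLike.congr_fun e2 v
    simp only [ContinuousLinearMap.comp_apply, ContinuousLinearMap.id_apply] at e3
    rw [← hT.hypForm_eq (hSm hy), e3, hTS hy]
  -- Both `T ∘ swap a` and `swap a ∘ S` preserve the metric and fix the centre; neither increases
  -- the norm, which gives the two inequalities.
  apply le_antisymm
  · have := norm_le_of_hypForm_eq (R := T ∘ swap a)
      (fun y hy => ((dT _ (hsw.mapsTo hy)).comp y (dsw y hy)).differentiableWithinAt)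
      (hT.mapsTo.comp hsw.mapsTo) (by simp [swap_zero, h0])
      (fun y hy => hypForm_comp (dsw y hy) (dT _ (hsw.mapsTo hy)) (hsw.hypForm_eq hy)
        (hT.hypForm_eq (hsw.mapsTo hy))) (hsw.mapsTo hx)
    simpa [swap_swap ha hx] using this
  · have hS0 : S 0 = a := by rw [← h0, hST (ext_subset ha)]
    have := norm_le_of_hypForm_eq (R := swap a ∘ S)
      (fun y hy => ((dsw _ (hSm hy)).comp y (dS y hy)).differentiableWithinAt)
      (hsw.mapsTo.comp hSm) (by simp [hS0, swap_self ha])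
      (fun y hy => hypForm_comp (dS y hy) (dsw _ (hSm hy)) (hSi y hy)
        (hsw.hypForm_eq (hSm hy))) (hT.mapsTo hx)
    simpa [hST hx] using this

/-! ### The hyperbolic Coulomb potential in closed form -/

/-- The quadratic form `(1 - |a|²)|x - a|² + (a · (x - a))²`, which equals
`(1 - a · x)² tanh² D(x, a)`. -/
def quad (a x : E3) : ℝ := (1 - ‖a‖ ^ 2) * ‖x - a‖ ^ 2 + inner ℝ a (x - a) ^ 2

/-- The function `coth D(x, a) / (4 π)`. -/
def coulomb (a x : E3) : ℝ := (1 - inner ℝ a x) / (4 * Real.pi * √(quad a x))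

/-- The gradient density of `coulomb a`. -/
def efield (a x : E3) : E3 := (-(1 - ‖a‖ ^ 2) / (4 * Real.pi * √(quad a x) ^ 3)) • (x - a)

/-- In this form it is visible that `√(quad a x)` and `1 - a·x` agree on the unit sphere and differ
inside by a quantity proportional to `1 - |x|²`. -/
lemma quad_eq (a x : E3) :
    quad a x = (1 - inner ℝ a x) ^ 2 - (1 - ‖x‖ ^ 2) * (1 - ‖a‖ ^ 2) := by
  rw [quad, norm_sub_sq_real, inner_sub_right, real_inner_self_eq_norm_sq, real_inner_comm a x]
  ring

lemma quad_zero (x : E3) : quad 0 x = ‖x‖ ^ 2 := by simp [quad]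

lemma le_quad (a x : E3) : (1 - ‖a‖ ^ 2) * ‖x - a‖ ^ 2 ≤ quad a x := by
  have := sq_nonneg (inner ℝ a (x - a))
  unfold quad
  linarith

lemma quad_pos {a x : E3} (ha : a ∈ hball) (hx : x ≠ a) : 0 < quad a x := by
  have h1 := one_sub_normSq_pos ha
  have h2 : 0 < ‖x - a‖ := norm_pos_iff.2 (sub_ne_zero.2 hx)
  exact lt_of_lt_of_le (by positivity) (le_quad a x)

lemma quad_nonneg {a : E3} (ha : a ∈ hball) (x : E3) : 0 ≤ quad a x := by
  have h1 := one_sub_normSq_pos ha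
  exact le_trans (by positivity) (le_quad a x)

lemma contDiff_quad (a : E3) : ContDiff ℝ ∞ (quad a) := by
  have h : ContDiff ℝ ∞ fun x : E3 => x - a := contDiff_id.sub contDiff_const
  exact (contDiff_const.mul (h.norm_sq ℝ)).add (((innerSL ℝ a).contDiff.comp h).pow 2)

lemma hasFDerivAt_quad (a x : E3) : HasFDerivAt (quad a)
    ((2 * (1 - ‖a‖ ^ 2)) • innerSL ℝ (x - a) + (2 * inner ℝ a (x - a)) • innerSL ℝ a) x := by
  have h0 : HasFDerivAt (fun y : E3 => y - a) (ContinuousLinearMap.id ℝ E3) x :=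
    (hasFDerivAt_id x).sub_const a
  have h1 := (h0.norm_sq).const_mul (1 - ‖a‖ ^ 2)
  have h2 := HasFDerivAt.pow ((innerSL ℝ a).hasFDerivAt.comp x h0) 2
  refine (h1.fun_add h2).congr_fderiv (ContinuousLinearMap.ext fun v => ?_)
  simp
  ring

lemma hasFDerivAt_sqrt_quad {a x : E3} (ha : a ∈ hball) (hx : x ≠ a) :
    HasFDerivAt (fun y => √(quad a y)) ((√(quad a x))⁻¹ •
      ((1 - ‖a‖ ^ 2) • innerSL ℝ (x - a) + inner ℝ a (x - a) • innerSL ℝ a)) x := by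
  have hq := Real.sqrt_pos.2 (quad_pos ha hx)
  refine ((hasFDerivAt_quad a x).sqrt (quad_pos ha hx).ne').congr_fderiv
    (ContinuousLinearMap.ext fun v => ?_)
  simp
  field_simp

lemma contDiffAt_sqrt_quad {a x : E3} (ha : a ∈ hball) (hx : x ≠ a) :
    ContDiffAt ℝ ∞ (fun y => √(quad a y)) x :=
  (contDiff_quad a).contDiffAt.sqrt (quad_pos ha hx).ne'

lemma contDiff_one_sub_inner (a : E3) : ContDiff ℝ ∞ (fun x : E3 => 1 - inner ℝ a x) :=
  contDiff_const.sub (innerSL ℝ a).contDiff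

lemma contDiffAt_coulomb {a x : E3} (ha : a ∈ hball) (hx : x ≠ a) :
    ContDiffAt ℝ ∞ (coulomb a) x := by
  have hq := Real.sqrt_pos.2 (quad_pos ha hx)
  have := Real.pi_pos
  exact (contDiff_one_sub_inner a).contDiffAt.div
    (contDiffAt_const.mul (contDiffAt_sqrt_quad ha hx)) (by positivity)

lemma contDiffAt_efield {a x : E3} (ha : a ∈ hball) (hx : x ≠ a) :
    ContDiffAt ℝ ∞ (efield a) x := by
  have hq := Real.sqrt_pos.2 (quad_pos ha hx)
  have := Real.pi_pos
  exact (contDiffAt_const.div (contDiffAt_const.mul ((contDiffAt_sqrt_quad ha hx).pow 3))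
    (by positivity)).smul (contDiffAt_id.sub contDiffAt_const)

lemma VO_eq_coulomb (x : E3) : VO x = coulomb 0 x := by
  simp [VO, coulomb, quad_zero]

/-- The norm `|T x|` equals `|swap a x|`, which is `tanh D(x, a)`, that is `√(quad a x)/(1 - a·x)`.
-/
lemma IsHypIsometry.VO_comp {T : E3 → E3} (hT : IsHypIsometry T) {a : E3} (ha : a ∈ ext)
    (h0 : T a = 0) {x : E3} (hx : x ∈ hball) : VO (T x) = coulomb a x := by
  have hy := one_sub_inner_pos (ext_subset ha) (mem_hball.1 hx).le
  have h1 : ‖T x‖ ^ 2 = quad a x / (1 - inner ℝ a x) ^ 2 := by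
    rw [hT.norm_eq_norm_swap ha h0 hx, quad_eq]
    have := one_sub_normSq_swap ha (mem_hball.1 hx).le
    field_simp at this ⊢
    linarith
  have h2 : ‖T x‖ = √(quad a x) / (1 - inner ℝ a x) := by
    rw [← Real.sqrt_sq (norm_nonneg (T x)), h1, Real.sqrt_div (quad_nonneg (ext_subset ha) x),
      Real.sqrt_sq hy.le]
  rw [VO, h2, coulomb]
  field_simp

lemma hasFDerivAt_coulomb {a x : E3} (ha : a ∈ hball) (hx : x ≠ a) :
    HasFDerivAt (coulomb a) (((1 - ‖a‖ ^ 2) / (4 * Real.pi * √(quad a x) ^ 3)) •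
      ((1 - ‖x‖ ^ 2) • innerSL ℝ a - (1 - inner ℝ a x) • innerSL ℝ x)) x := by
  have hq := Real.sqrt_pos.2 (quad_pos ha hx)
  have hpi := Real.pi_pos
  have h1 := (hasDerivAt_inv hq.ne').comp_hasFDerivAt x (hasFDerivAt_sqrt_quad ha hx)
  have h2 : HasFDerivAt (fun y : E3 => 1 - inner ℝ a y) (-innerSL ℝ a) x :=
    (innerSL ℝ a).hasFDerivAt.const_sub 1
  have h3 := (h2.mul h1).const_mul (4 * Real.pi)⁻¹
  have e : coulomb a = fun y => (4 * Real.pi)⁻¹ * (((fun y : E3 => 1 - inner ℝ a y) *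
      ((fun y => y⁻¹) ∘ fun y => √(quad a y))) y) := by
    ext y
    simp [coulomb]
    ring
  rw [e]
  refine h3.congr_fderiv (ContinuousLinearMap.ext fun v => ?_)
  have hs : √(quad a x) ^ 2 = (1 - inner ℝ a x) ^ 2 - (1 - ‖x‖ ^ 2) * (1 - ‖a‖ ^ 2) := by
    rw [Real.sq_sqrt (quad_pos ha hx).le, quad_eq]
  simp [inner_sub_right]
  generalize √(quad a x) = s at *
  field_simp
  rw [hs]
  ring

lemma pd_eq_of_hasFDerivAt {f : E3 → ℝ} {L : E3 →L[ℝ] ℝ} {x : E3} (h : HasFDerivAt f L x)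
    (i : Fin 3) : pd i f x = L (EuclideanSpace.single i 1) := by
  rw [pd, h.fderiv]

/-- Applying `1 - x xᵀ` to the differential collapses the combination of `a` and `x` to a multiple
of `x - a`: the field lines are the straight rays from the charge. -/
lemma gradDensity_coulomb {a x : E3} (ha : a ∈ hball) (hx : x ∈ hball) (hxa : x ≠ a) (i : Fin 3) :
    gradDensity hyp (coulomb a) i x = efield a x i := by
  have hq := Real.sqrt_pos.2 (quad_pos ha hxa)
  have hpi := Real.pi_pos
  have hb := one_sub_normSq_pos hx
  have h := hasFDerivAt_coulomb ha hxa
  rw [gradDensity_hyp hx, pd_eq_of_hasFDerivAt h, h.fderiv]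
  simp [efield, EuclideanSpace.inner_single_right]
  field_simp
  ring

/-- `x` is an eigenvector of `1 - x xᵀ` with eigenvalue `1 - |x|²`, which cancels the prefactor.
Fluxes through spheres about the centre thus involve only the ordinary radial derivative. -/
lemma sum_gradDensity_hyp_mul_self {x : E3} (hx : x ∈ hball) (f : E3 → ℝ) :
    ∑ i, gradDensity hyp f i x * x i = fderiv ℝ f x x := by
  have hb := one_sub_normSq_pos hx
  have h : ∑ i, gradDensity hyp f i x * x i =
      (1 - ‖x‖ ^ 2)⁻¹ * (fderiv ℝ f x x - ‖x‖ ^ 2 * fderiv ℝ f x x) := by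
    rw [normSq_eq_sum, fderiv_eq_sum_pd f x x]
    simp only [gradDensity_hyp hx, normSq_eq_sum, fderiv_eq_sum_pd f x x, Fin.sum_univ_three]
    ring
  rw [h]
  field_simp

lemma pd_mul {f g : E3 → ℝ} {x : E3} (hf : DifferentiableAt ℝ f x) (hg : DifferentiableAt ℝ g x)
    (i : Fin 3) : pd i (fun y => f y * g y) x = f x * pd i g x + g x * pd i f x := by
  rw [pd, fderiv_fun_mul hf hg]
  simp [pd]

lemma pd_add {f g : E3 → ℝ} {x : E3} (hf : DifferentiableAt ℝ f x) (hg : DifferentiableAt ℝ g x)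
    (i : Fin 3) : pd i (fun y => f y + g y) x = pd i f x + pd i g x := by
  rw [pd, fderiv_fun_add hf hg]
  simp [pd]

lemma pd_coord (i j : Fin 3) (a x : E3) :
    pd i (fun y : E3 => y j - a j) x = if i = j then 1 else 0 := by
  have h : HasFDerivAt (fun y : E3 => y j - a j) (EuclideanSpace.proj j : E3 →L[ℝ] ℝ) x :=
    (EuclideanSpace.proj (𝕜 := ℝ) j).hasFDerivAt.sub_const (a j)
  rw [pd_eq_of_hasFDerivAt h]
  simp [eq_comm]

lemma differentiable_coord (i : Fin 3) (a : E3) : Differentiable ℝ fun y : E3 => y i - a i :=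
  (EuclideanSpace.proj (𝕜 := ℝ) i).differentiable.sub_const (a i)

/-- The divergence of a field that is parallel to the position vector. -/
lemma sum_pd_mul_coord {g : E3 → ℝ} {x : E3} (hg : DifferentiableAt ℝ g x) (a : E3) :
    ∑ i, pd i (fun y => g y * (y i - a i)) x = 3 * g x + fderiv ℝ g x (x - a) := by
  simp only [pd_mul hg (differentiable_coord _ a x), pd_coord, fderiv_eq_sum_pd g x (x - a),
    if_true, Fin.sum_univ_three, PiLp.sub_apply]
  ring

/-- `√(quad a x)` is homogeneous of degree one in `x - a`, so the coefficient of `x - a` in the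
field has degree `-3`, and Euler's relation cancels the `3` from the divergence of the position
vector. -/
lemma sum_pd_efield {a x : E3} (ha : a ∈ hball) (hx : x ≠ a) :
    ∑ i, pd i (fun y => efield a y i) x = 0 := by
  have hq := Real.sqrt_pos.2 (quad_pos ha hx)
  have hpi := Real.pi_pos
  have hs : √(quad a x) ^ 2 = (1 - ‖a‖ ^ 2) * ‖x - a‖ ^ 2 + inner ℝ a (x - a) ^ 2 :=
    Real.sq_sqrt (quad_pos ha hx).le
  have h1 := (HasFDerivAt.pow (hasFDerivAt_sqrt_quad ha hx) 3).const_mul (4 * Real.pi)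
  have h2 := ((hasDerivAt_inv (x := 4 * Real.pi * √(quad a x) ^ 3)
    (by positivity)).comp_hasFDerivAt x h1).const_mul (-(1 - ‖a‖ ^ 2))
  have h3 := sum_pd_mul_coord h2.differentiableAt a
  have e : ∀ i, (fun y => efield a y i) = fun y => (fun y => -(1 - ‖a‖ ^ 2) *
      ((fun y => y⁻¹) ∘ fun y => 4 * Real.pi * √(quad a y) ^ 3) y) y * (y i - a i) := by
    intro i
    ext y
    simp [efield, div_eq_mul_inv]
  simp only [e, h3, h2.fderiv]
  simp only [smul_apply, add_apply, innerSL_apply_apply, smul_eq_mul, real_inner_self_eq_norm_sq,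
    Function.comp_apply, nsmul_eq_mul]
  generalize √(quad a x) = s at *
  push_cast
  field_simp
  rw [hs]
  ring

/-- The gradient density of `H` is a multiple of the Coulomb field of the centre. -/
lemma gradDensity_HH {M Q : ℝ} (h : |Q| < M) {x : E3} (hx : x ∈ ext) (i : Fin 3) :
    gradDensity hyp (HH M Q) i x = 4 * Real.pi * √(mu M Q) * efield 0 x i := by
  have hm := Real.sqrt_pos.2 (mu_pos h)
  have hm2 : mu M Q = √(mu M Q) ^ 2 := (Real.sq_sqrt (mu_pos h).le).symm
  have hc := (((hasFDerivAt_coulomb zero_mem_hball (mem_ext.1 hx).2).const_mul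
    (4 * Real.pi * mu M Q)).add_const M).mul_const (√(mu M Q))⁻¹
  have e : HH M Q = fun y => (4 * Real.pi * mu M Q * coulomb 0 y + M) * (√(mu M Q))⁻¹ := by
    ext y
    simp [HH, VO_eq_coulomb, div_eq_mul_inv]
  have hc' := hasFDerivAt_coulomb zero_mem_hball (mem_ext.1 hx).2
  rw [← gradDensity_coulomb zero_mem_hball (ext_subset hx) (mem_ext.1 hx).2,
    gradDensity_hyp (ext_subset hx), gradDensity_hyp (ext_subset hx), e, pd_eq_of_hasFDerivAt hc,
    hc.fderiv, pd_eq_of_hasFDerivAt hc', hc'.fderiv]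
  simp only [smul_apply, smul_eq_mul]
  rw [show 4 * Real.pi * mu M Q = 4 * Real.pi * √(mu M Q) * √(mu M Q) by rw [mul_assoc _ √_, ← sq, ← hm2]]
  field_simp

lemma sum_pd_gradDensity_HH {M Q : ℝ} (h : |Q| < M) {x : E3} (hx : x ∈ ext) :
    ∑ i, pd i (gradDensity hyp (HH M Q) i) x = 0 := by
  have hx0 := (mem_ext.1 hx).2
  have hd := (contDiffAt_efield zero_mem_hball hx0).differentiableAt (by simp)
  have : ∀ i, pd i (gradDensity hyp (HH M Q) i) x =
      4 * Real.pi * √(mu M Q) * pd i (fun y => efield 0 y i) x := fun i => by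
    have e : gradDensity hyp (HH M Q) i =ᶠ[𝓝 x]
        fun y => 4 * Real.pi * √(mu M Q) * efield 0 y i := by
      filter_upwards [isOpen_ext.mem_nhds hx] with y hy using gradDensity_HH h hy i
    rw [pd_congr e, pd, fderiv_const_mul]
    · rfl
    · exact (EuclideanSpace.proj (𝕜 := ℝ) i).differentiableAt.comp x hd
  simp only [this, ← Finset.mul_sum, sum_pd_efield zero_mem_hball hx0, mul_zero]

lemma laplacian_HH {M Q : ℝ} (h : |Q| < M) {x : E3} (hx : x ∈ ext) :
    laplacian hyp (HH M Q) x = 0 := by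
  rw [laplacian, sum_pd_gradDensity_HH h hx, mul_zero]

/-! ### Polar coordinates -/

instance : IsFiniteMeasure sphereMeasure := inferInstanceAs (IsFiniteMeasure (Measure.toSphere _))

lemma sphereMeasure_real_univ : sphereMeasure.real univ = 4 * Real.pi := by
  have hpi := Real.pi_pos
  rw [sphereMeasure, Measure.toSphere_real_apply_univ, Measure.real,
    EuclideanSpace.volume_ball_fin_three, ENNReal.toReal_mul]
  simp
  rw [ENNReal.toReal_ofReal (by positivity)]
  ring

lemma integral_volumeIoiPow_two (k : ℝ → ℝ) :
    ∫ r, k r ∂(Measure.volumeIoiPow 2) = ∫ r in Ioi (0 : ℝ), r ^ 2 * k r := by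
  simp only [Measure.volumeIoiPow, ENNReal.ofReal]
  rw [integral_withDensity_eq_integral_smul,
    integral_subtype_comap measurableSet_Ioi fun a : ℝ => Real.toNNReal (a ^ 2) • k a,
    setIntegral_congr_fun measurableSet_Ioi fun x hx => ?_]
  · rw [NNReal.smul_def, Real.coe_toNNReal _ (pow_nonneg hx.out.le _), smul_eq_mul]
  · exact (measurable_subtype_coe.pow_const _).real_toNNReal

lemma integral_eq_integral_sphere_prod {f : E3 → ℝ} :
    ∫ x, f x = ∫ p : Metric.sphere (0 : E3) 1 × Ioi (0 : ℝ), f (p.2.1 • p.1.1)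
      ∂(sphereMeasure.prod (Measure.volumeIoiPow 2)) := by
  have hmp := (volume : Measure E3).measurePreserving_homeomorphUnitSphereProd
  have h := hmp.integral_comp (Homeomorph.measurableEmbedding _)
    (fun p : Metric.sphere (0 : E3) 1 × Ioi (0 : ℝ) => f (p.2.1 • p.1.1))
  simp only [finrank_euclideanSpace, Fintype.card_fin] at h
  have h0 : ∫ x, f x = ∫ x : ({0}ᶜ : Set E3), f x ∂((volume : Measure E3).comap (↑)) := by
    rw [integral_subtype_comap (measurableSet_singleton _).compl f, restrict_compl_singleton]
  rw [sphereMeasure, ← h, h0]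
  apply integral_congr_ae
  refine ae_of_all _ fun x => ?_
  have := congrArg Subtype.val ((homeomorphUnitSphereProd E3).symm_apply_apply x)
  simp only [homeomorphUnitSphereProd_symm_apply_coe] at this
  simp only [this]

lemma integrable_sphere_prod {f : E3 → ℝ} (hf : Integrable f) :
    Integrable (fun p : Metric.sphere (0 : E3) 1 × Ioi (0 : ℝ) => f (p.2.1 • p.1.1))
      (sphereMeasure.prod (Measure.volumeIoiPow 2)) := by
  have hmp := (volume : Measure E3).measurePreserving_homeomorphUnitSphereProd
  have h := hmp.integrable_comp_emb (Homeomorph.measurableEmbedding _)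
    (g := fun p : Metric.sphere (0 : E3) 1 × Ioi (0 : ℝ) => f (p.2.1 • p.1.1))
  simp only [finrank_euclideanSpace, Fintype.card_fin] at h
  rw [sphereMeasure]
  refine h.1 ?_
  have h2 : Integrable (f ∘ Subtype.val)
      ((volume : Measure E3).comap (Subtype.val : ({0}ᶜ : Set E3) → E3)) := by
    rw [← integrableOn_iff_comap_subtypeVal (measurableSet_singleton _).compl]
    exact hf.integrableOn
  refine h2.congr (.of_forall fun x => ?_)
  have := congrArg Subtype.val ((homeomorphUnitSphereProd E3).symm_apply_apply x)
  simp only [homeomorphUnitSphereProd_symm_apply_coe] at this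
  simp only [Function.comp_apply, this]

lemma integral_polar {f : E3 → ℝ} (hf : Integrable f) :
    ∫ x, f x = ∫ n, (∫ r in Ioi (0 : ℝ), r ^ 2 * f (r • n.1)) ∂sphereMeasure := by
  rw [integral_eq_integral_sphere_prod, integral_prod _ (integrable_sphere_prod hf)]
  refine integral_congr_ae (.of_forall fun n => ?_)
  exact integral_volumeIoiPow_two fun r => f (r • n.1)

/-- The two orders of integration have different uses: rays first for the charge of the Coulomb
field, spheres first for its flux. -/
lemma integral_polar_symm {f : E3 → ℝ} (hf : Integrable f) :
    ∫ x, f x = ∫ r in Ioi (0 : ℝ), r ^ 2 * ∫ n, f (r • n.1) ∂sphereMeasure := by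
  rw [integral_eq_integral_sphere_prod, integral_prod_symm _ (integrable_sphere_prod hf)]
  exact integral_volumeIoiPow_two fun r => ∫ n, f (r • n.1) ∂sphereMeasure

/-! ### Local integrability of weak singularities -/

lemma integrableOn_inv_normSq (r : ℝ) :
    IntegrableOn (fun x : E3 => (‖x‖ ^ 2)⁻¹) (Metric.ball 0 r) := by
  rw [integrableOn_fun_norm_addHaar (volume : Measure E3) (f := fun t => (t ^ 2)⁻¹)]
  simp only [finrank_euclideanSpace, Fintype.card_fin, smul_eq_mul]
  refine (integrableOn_const (C := (1 : ℝ)) (by simp)).congr_fun (fun t ht => ?_) measurableSet_Ioo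
  have := ht.1
  simp only [Nat.add_one_sub_one]
  field_simp

/-- Together with a constant, this majorant dominates a simple pole and its first derivatives. -/
lemma locallyIntegrable_inv_normSq (a : E3) :
    LocallyIntegrable (fun x : E3 => (‖x - a‖ ^ 2)⁻¹) := by
  rw [locallyIntegrable_iff]
  intro K hK
  obtain ⟨r, hr⟩ := (Metric.isBounded_iff_subset_ball a).1 hK.isBounded
  refine IntegrableOn.mono_set ?_ hr
  have h := (measurePreserving_sub_right (volume : Measure E3) a).integrableOn_comp_preimage
    (MeasurableEquiv.subRight a).measurableEmbedding (f := fun x : E3 => (‖x‖ ^ 2)⁻¹)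
    (s := Metric.ball 0 r)
  have e : (fun x => x - a) ⁻¹' Metric.ball 0 r = Metric.ball a r := by
    ext x
    simp [dist_eq_norm]
  rw [e] at h
  exact h.2 (integrableOn_inv_normSq r)

/-! ### The flux of the Coulomb field -/

/-- The Euclidean Coulomb field has unit charge, up to the factor `-4π`. -/
lemma integral_fderiv_self_div_norm_cube {φ : E3 → ℝ} (hφ : ContDiff ℝ ∞ φ)
    (hs : HasCompactSupport φ) :
    ∫ x, fderiv ℝ φ x x / ‖x‖ ^ 3 = -(4 * Real.pi) * φ 0 := by
  have hc : Continuous (fderiv ℝ φ) := hφ.continuous_fderiv (by simp)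
  have hintg : Integrable fun x => fderiv ℝ φ x x / ‖x‖ ^ 3 := by
    have h2 := (locallyIntegrable_inv_normSq 0).integrable_smul_left_of_hasCompactSupport hc.norm
      (hs.fderiv ℝ).norm
    refine h2.mono' ?_ (.of_forall fun x => ?_)
    · exact ((hc.clm_apply continuous_id).measurable.div
        (measurable_norm.pow_const 3)).aestronglyMeasurable
    · rcases eq_or_ne x 0 with rfl | hx
      · simp
      · have hn : 0 < ‖x‖ := norm_pos_iff.2 hx
        rw [norm_div, norm_pow, norm_norm, sub_zero, smul_eq_mul, div_le_iff₀ (by positivity)]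
        calc ‖fderiv ℝ φ x x‖ ≤ ‖fderiv ℝ φ x‖ * ‖x‖ := (fderiv ℝ φ x).le_opNorm x
          _ = _ := by field_simp
  rw [integral_polar hintg]
  -- Along a ray the integrand is `d/dr φ(r n)`, whose integral over `(0, ∞)` is `-φ(0)`.
  have key : ∀ n : Metric.sphere (0 : E3) 1,
      ∫ r in Ioi (0 : ℝ), r ^ 2 * (fderiv ℝ φ (r • n.1) (r • n.1) / ‖r • n.1‖ ^ 3) = -φ 0 := by
    intro n
    have hn : ‖n.1‖ = 1 := by simp
    have hn0 : n.1 ≠ 0 := norm_ne_zero_iff.1 (by rw [hn]; exact one_ne_zero)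
    have h1 : ContDiff ℝ 1 fun r : ℝ => φ (r • n.1) :=
      (hφ.of_le (by exact_mod_cast le_top)).comp (contDiff_id.smul contDiff_const)
    have h2 : HasCompactSupport fun r : ℝ => φ (r • n.1) :=
      hs.comp_isClosedEmbedding (isClosedEmbedding_smul_left hn0)
    have h3 := h2.integral_Ioi_deriv_eq h1 0
    rw [zero_smul] at h3
    rw [← h3]
    refine setIntegral_congr_fun measurableSet_Ioi fun r hr => ?_
    have hr : 0 < r := hr
    have hd : HasDerivAt (fun r : ℝ => φ (r • n.1)) (fderiv ℝ φ (r • n.1) n.1) r := by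
      have h4 : HasDerivAt (fun t : ℝ => t • n.1) n.1 r := by
        simpa using (hasDerivAt_id r).smul_const n.1
      exact ((hφ.differentiable (by simp)) (r • n.1)).hasFDerivAt.comp_hasDerivAt r h4
    simp only [hd.deriv, map_smul, norm_smul, hn, smul_eq_mul, mul_one, Real.norm_eq_abs,
      abs_of_pos hr]
    field_simp
  simp only [key, integral_const, sphereMeasure_real_univ]
  simp

/-! ### Reduction to the Euclidean Coulomb field by a linear change of variables -/

/-- The linear map with `‖quadMap a z‖² = quad a (a + z)`. -/
def quadMap (a : E3) : E3 →ₗ[ℝ] E3 :=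
  Matrix.toLin (EuclideanSpace.basisFun (Fin 3) ℝ).toBasis (EuclideanSpace.basisFun (Fin 3) ℝ).toBasis
    (radMat √(1 - ‖a‖ ^ 2) (1 + √(1 - ‖a‖ ^ 2))⁻¹ a)

lemma quadMap_apply (a z : E3) : quadMap a z =
    √(1 - ‖a‖ ^ 2) • z + ((1 + √(1 - ‖a‖ ^ 2))⁻¹ * inner ℝ a z) • a := by
  ext i
  rw [quadMap, Matrix.toLin_apply]
  simp [Matrix.mulVec, dotProduct, sum_radMat, inner_eq_sum, Pi.single_apply]
  ring

lemma quadMap_aux {a : E3} (ha : a ∈ hball) :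
    0 < √(1 - ‖a‖ ^ 2) ∧ ‖a‖ ^ 2 = 1 - √(1 - ‖a‖ ^ 2) ^ 2 := by
  have h := one_sub_normSq_pos ha
  exact ⟨Real.sqrt_pos.2 h, by rw [Real.sq_sqrt h.le]; ring⟩

/-- With `s = √(1 - |a|²)` the eigenvalues are `s, s` orthogonally to `a` and `s + |a|²/(1 + s) = 1`
along `a`. -/
lemma det_quadMap {a : E3} (ha : a ∈ hball) : LinearMap.det (quadMap a) = 1 - ‖a‖ ^ 2 := by
  obtain ⟨h0, h2⟩ := quadMap_aux ha
  rw [quadMap, LinearMap.det_toLin, det_radMat]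
  set s := √(1 - ‖a‖ ^ 2)
  rw [h2]
  field_simp
  ring

lemma normSq_quadMap {a : E3} (ha : a ∈ hball) (z : E3) :
    ‖quadMap a z‖ ^ 2 = (1 - ‖a‖ ^ 2) * ‖z‖ ^ 2 + inner ℝ a z ^ 2 := by
  obtain ⟨h0, h2⟩ := quadMap_aux ha
  rw [quadMap_apply, ← real_inner_self_eq_norm_sq]
  simp only [inner_add_left, inner_add_right, real_inner_smul_left, real_inner_smul_right]
  simp only [real_inner_self_eq_norm_sq, real_inner_comm a z]
  set s := √(1 - ‖a‖ ^ 2)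
  rw [h2]
  field_simp
  ring

/-- The inverse of `quadMap a`. -/
def quadMapInv (a : E3) : E3 →L[ℝ] E3 :=
  (√(1 - ‖a‖ ^ 2))⁻¹ • (ContinuousLinearMap.id ℝ E3 -
    (1 + √(1 - ‖a‖ ^ 2))⁻¹ • (innerSL ℝ a).smulRight a)

lemma quadMapInv_quadMap {a : E3} (ha : a ∈ hball) (z : E3) :
    quadMapInv a (quadMap a z) = z := by
  obtain ⟨h0, h2⟩ := quadMap_aux ha
  rw [quadMap_apply, quadMapInv]
  set s := √(1 - ‖a‖ ^ 2)
  simp [inner_add_right, real_inner_smul_right, h2]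
  rw [add_sub_assoc, smul_smul (1 + s)⁻¹, ← sub_smul, smul_add, smul_smul, smul_smul, inv_mul_cancel₀ h0.ne', one_smul]
  convert add_zero z using 2
  convert zero_smul ℝ a using 2
  field_simp
  ring

lemma integral_comp_quadMap {a : E3} (ha : a ∈ hball) (G : E3 → ℝ) :
    ∫ z, G (quadMap a z) = (1 - ‖a‖ ^ 2)⁻¹ * ∫ w, G w := by
  have hp := one_sub_normSq_pos ha
  have hd : LinearMap.det (quadMap a) ≠ 0 := by rw [det_quadMap ha]; exact hp.ne'
  have hm := Measure.map_linearMap_addHaar_eq_smul_addHaar (volume : Measure E3) hd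
  have he : MeasurableEmbedding (quadMap a) :=
    ((LinearEquiv.ofIsUnitDet (f := quadMap a) (v := (EuclideanSpace.basisFun (Fin 3) ℝ).toBasis)
      (v' := (EuclideanSpace.basisFun (Fin 3) ℝ).toBasis)
      (by rw [LinearMap.det_toMatrix]; exact
        IsUnit.mk0 _ hd)).toContinuousLinearEquiv.toHomeomorph).measurableEmbedding
  rw [← he.integral_map, hm, integral_smul_measure, det_quadMap ha,
    ENNReal.toReal_ofReal (abs_nonneg _), abs_of_pos (by positivity), smul_eq_mul]

/-- The field `efield a` is that of a unit charge at `a`. -/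
lemma integral_fderiv_efield {a : E3} (ha : a ∈ hball) {φ : E3 → ℝ} (hφ : ContDiff ℝ ∞ φ)
    (hs : HasCompactSupport φ) : ∫ x, fderiv ℝ φ x (efield a x) = φ a := by
  have hp := one_sub_normSq_pos ha
  have hpi := Real.pi_pos
  -- The test function is transported by the inverse linear map. The factor `1 - |a|²` in `efield`
  -- cancels the Jacobian.
  have hψ : ContDiff ℝ ∞ fun w => φ (quadMapInv a w + a) :=
    hφ.comp ((quadMapInv a).contDiff.add contDiff_const)
  have hψs : HasCompactSupport fun w => φ (quadMapInv a w + a) := by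
    obtain ⟨R, hR⟩ := hs.isCompact.isBounded.exists_norm_le
    refine HasCompactSupport.of_support_subset_isCompact
      (isCompact_closedBall (0 : E3) (‖(LinearMap.toContinuousLinearMap (quadMap a))‖ * (R + ‖a‖)))
      fun w hw => ?_
    obtain ⟨z, rfl⟩ : ∃ z, quadMap a z = w := by
      have : Function.Surjective (quadMap a) := LinearMap.injective_iff_surjective.1
        (Function.LeftInverse.injective (g := quadMapInv a) (quadMapInv_quadMap ha))
      exact this w
    rw [Function.mem_support, quadMapInv_quadMap ha] at hw
    have h1 := hR _ (subset_tsupport _ hw)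
    have h2 : ‖z‖ ≤ R + ‖a‖ := by
      calc ‖z‖ = ‖z + a - a‖ := by simp
        _ ≤ ‖z + a‖ + ‖a‖ := norm_sub_le _ _
        _ ≤ _ := by linarith
    rw [mem_closedBall_zero_iff]
    exact ((LinearMap.toContinuousLinearMap (quadMap a)).le_opNorm z).trans (by gcongr)
  have key := integral_fderiv_self_div_norm_cube hψ hψs
  have hcomp := integral_comp_quadMap ha
    (fun w => fderiv ℝ (fun w => φ (quadMapInv a w + a)) w w / ‖w‖ ^ 3)
  rw [key] at hcomp
  simp only [map_zero, zero_add] at hcomp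
  have e : ∀ z : E3, fderiv ℝ φ (z + a) (efield a (z + a)) = -(1 - ‖a‖ ^ 2) / (4 * Real.pi) *
      (fderiv ℝ (fun w => φ (quadMapInv a w + a)) (quadMap a z) (quadMap a z) /
        ‖quadMap a z‖ ^ 3) := by
    intro z
    have h1 : HasFDerivAt (fun w => φ (quadMapInv a w + a))
        ((fderiv ℝ φ (z + a)).comp (quadMapInv a)) (quadMap a z) := by
      have h2 := ((hφ.differentiable (by simp)) (z + a)).hasFDerivAt
      have h3 := (quadMapInv a).hasFDerivAt (x := quadMap a z) |>.add_const a
      refine HasFDerivAt.comp _ ?_ h3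
      rwa [quadMapInv_quadMap ha]
    have h4 : √(quad a (z + a)) = ‖quadMap a z‖ := by
      rw [← Real.sqrt_sq (norm_nonneg (quadMap a z)), normSq_quadMap ha, quad, add_sub_cancel_right]
    rw [h1.fderiv, efield, h4]
    simp only [ContinuousLinearMap.comp_apply, quadMapInv_quadMap ha, map_smul, smul_eq_mul,
      add_sub_cancel_right]
    ring
  rw [← integral_add_right_eq_self _ a]
  simp only [e]
  rw [integral_const_mul, hcomp]
  field_simp

/-! ### Test functions -/

lemma contDiff_of_contDiffAt_tsupport {f : E3 → ℝ} (h : ∀ x ∈ tsupport f, ContDiffAt ℝ ∞ f x) :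
    ContDiff ℝ ∞ f := by
  rw [contDiff_iff_contDiffAt]
  intro x
  by_cases hx : x ∈ tsupport f
  · exact h x hx
  · exact contDiffAt_const.congr_of_eventuallyEq (notMem_tsupport_iff_eventuallyEq.1 hx)

/-- The coefficient need only be smooth near the support, which admits `H` and `H⁻¹` as multipliers
of test functions on the punctured ball. -/
lemma contDiff_mul_of_tsupport {U : Set E3} {u φ : E3 → ℝ} (hu : ∀ x ∈ U, ContDiffAt ℝ ∞ u x)
    (hφ : ContDiff ℝ ∞ φ) (hs : tsupport φ ⊆ U) : ContDiff ℝ ∞ fun x => u x * φ x :=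
  contDiff_of_contDiffAt_tsupport fun x hx =>
    (hu x (hs (tsupport_mul_subset_right hx))).mul hφ.contDiffAt

lemma contDiffAt_pd {f : E3 → ℝ} {x : E3} (h : ContDiffAt ℝ ∞ f x) (i : Fin 3) :
    ContDiffAt ℝ ∞ (pd i f) x :=
  (h.fderiv_right (m := ∞) (by simp)).clm_apply contDiffAt_const

lemma contDiff_pd {f : E3 → ℝ} (h : ContDiff ℝ ∞ f) (i : Fin 3) : ContDiff ℝ ∞ (pd i f) :=
  contDiff_iff_contDiffAt.2 fun _ => contDiffAt_pd h.contDiffAt i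

lemma pd_eq_zero_of_notMem {f : E3 → ℝ} {x : E3} (hx : x ∉ tsupport f) (i : Fin 3) :
    pd i f x = 0 := by
  rw [pd_congr (notMem_tsupport_iff_eventuallyEq.1 hx)]
  simp [pd]

lemma tsupport_subset_of_eq_zero {f g : E3 → ℝ} (h : ∀ x ∉ tsupport g, f x = 0) :
    tsupport f ⊆ tsupport g :=
  closure_minimal (fun _ hx => by_contra fun hx' => hx (h _ hx')) (isClosed_tsupport g)

lemma hasCompactSupport_of_eq_zero {f g : E3 → ℝ} (hg : HasCompactSupport g)
    (h : ∀ x ∉ tsupport g, f x = 0) : HasCompactSupport f :=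
  hg.of_isClosed_subset (isClosed_tsupport f) (tsupport_subset_of_eq_zero h)

lemma hasCompactSupport_pd {f : E3 → ℝ} (h : HasCompactSupport f) (i : Fin 3) :
    HasCompactSupport (pd i f) :=
  hasCompactSupport_of_eq_zero h fun _ hx => pd_eq_zero_of_notMem hx i

lemma fderiv_eq_zero_of_notMem {f : E3 → ℝ} {x : E3} (hx : x ∉ tsupport f) : fderiv ℝ f x = 0 := by
  rw [(notMem_tsupport_iff_eventuallyEq.1 hx).fderiv_eq]
  simp

lemma integral_mul_pd {U : Set E3} {v P : E3 → ℝ} (hv : ∀ x ∈ U, ContDiffAt ℝ ∞ v x)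
    (hP : ContDiff ℝ ∞ P) (hc : HasCompactSupport P) (hs : tsupport P ⊆ U) (i : Fin 3) :
    Integrable (fun x => v x * pd i P x) ∧ Integrable (fun x => pd i v x * P x) ∧
      ∫ x, v x * pd i P x = -∫ x, pd i v x * P x := by
  have h1 := (contDiff_mul_of_tsupport hv (contDiff_pd hP i)
    ((tsupport_subset_of_eq_zero fun x hx => pd_eq_zero_of_notMem hx i).trans hs)).continuous
  have h2 := (contDiff_mul_of_tsupport (fun x hx => contDiffAt_pd (hv x hx) i) hP hs).continuous
  have h3 := (contDiff_mul_of_tsupport hv hP hs).continuous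
  have i1 := h1.integrable_of_hasCompactSupport (μ := volume) (hasCompactSupport_pd hc i).mul_left
  have i2 := h2.integrable_of_hasCompactSupport (μ := volume) hc.mul_left
  have i3 := h3.integrable_of_hasCompactSupport (μ := volume) hc.mul_left
  exact ⟨i1, i2, integral_mul_fderiv_eq_neg_fderiv_mul_of_integrable i2 i1 i3
    (fun x hx => (hv x (hs hx)).differentiableAt (by simp))
    fun x _ => hP.differentiable (by simp) x⟩

/-! ### Integration by parts against a pole -/

/-- The partial derivative of `(quad a + ε)^(-1/2)`. -/
def poleDeriv (a : E3) (ε : ℝ) (i : Fin 3) (x : E3) : ℝ :=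
  -((1 - ‖a‖ ^ 2) * (x i - a i) + inner ℝ a (x - a) * a i) / √(quad a x + ε) ^ 3

lemma hasFDerivAt_pole {a x : E3} {ε : ℝ} (h : 0 < quad a x + ε) :
    HasFDerivAt (fun y => (√(quad a y + ε))⁻¹) (-(√(quad a x + ε) ^ 3)⁻¹ •
      ((1 - ‖a‖ ^ 2) • innerSL ℝ (x - a) + inner ℝ a (x - a) • innerSL ℝ a)) x := by
  have hq := Real.sqrt_pos.2 h
  have h1 := ((hasFDerivAt_quad a x).add_const ε).sqrt h.ne'
  have h2 := (hasDerivAt_inv hq.ne').comp_hasFDerivAt x h1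
  refine h2.congr_fderiv (ContinuousLinearMap.ext fun v => ?_)
  simp only [smul_apply, add_apply, innerSL_apply_apply, smul_eq_mul]
  field_simp

lemma pd_pole {a x : E3} {ε : ℝ} (h : 0 < quad a x + ε) (i : Fin 3) :
    pd i (fun y => (√(quad a y + ε))⁻¹) x = poleDeriv a ε i x := by
  rw [pd_eq_of_hasFDerivAt (hasFDerivAt_pole h), poleDeriv]
  simp [EuclideanSpace.inner_single_right]
  ring

lemma sqrt_quad_add_ge {a : E3} (ha : a ∈ hball) {ε : ℝ} (hε : 0 ≤ ε) (x : E3) :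
    √(1 - ‖a‖ ^ 2) * ‖x - a‖ ≤ √(quad a x + ε) := by
  have h1 := one_sub_normSq_pos ha
  rw [← Real.sqrt_sq (norm_nonneg (x - a)), ← Real.sqrt_mul h1.le]
  exact Real.sqrt_le_sqrt (by linarith [le_quad a x])

/-- Uniform in `ε`, as is the bound on the derivative below; both serve as majorants for dominated
convergence as `ε → 0`. -/
lemma abs_pole_le {a : E3} (ha : a ∈ hball) {ε : ℝ} (hε : 0 ≤ ε) {x : E3} (hx : x ≠ a) :
    |(√(quad a x + ε))⁻¹| ≤ (√(1 - ‖a‖ ^ 2))⁻¹ * (1 + (‖x - a‖ ^ 2)⁻¹) := by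
  have h0 := Real.sqrt_pos.2 (one_sub_normSq_pos ha)
  have hn : 0 < ‖x - a‖ := norm_pos_iff.2 (sub_ne_zero.2 hx)
  rw [abs_of_nonneg (by positivity)]
  calc (√(quad a x + ε))⁻¹ ≤ (√(1 - ‖a‖ ^ 2) * ‖x - a‖)⁻¹ :=
        inv_anti₀ (by positivity) (sqrt_quad_add_ge ha hε x)
    _ = (√(1 - ‖a‖ ^ 2))⁻¹ * ‖x - a‖⁻¹ := mul_inv _ _
    _ ≤ _ := by
      gcongr
      rw [← inv_pow]
      -- This is `t ≤ 1 + t²`, so that one majorant serves for both orders of singularity.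
      nlinarith [sq_nonneg (‖x - a‖⁻¹ - 1), sq_nonneg (‖x - a‖⁻¹)]

lemma abs_poleDeriv_le {a : E3} (ha : a ∈ hball) {ε : ℝ} (hε : 0 ≤ ε) {x : E3} (hx : x ≠ a)
    (i : Fin 3) :
    |poleDeriv a ε i x| ≤ (√(1 - ‖a‖ ^ 2) ^ 3)⁻¹ * (1 + (‖x - a‖ ^ 2)⁻¹) := by
  have h0 := Real.sqrt_pos.2 (one_sub_normSq_pos ha)
  have h1 := one_sub_normSq_pos ha
  have hn : 0 < ‖x - a‖ := norm_pos_iff.2 (sub_ne_zero.2 hx)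
  have hc : ∀ v : E3, |v i| ≤ ‖v‖ := fun v => PiLp.norm_apply_le v i
  have hnum : |(1 - ‖a‖ ^ 2) * (x i - a i) + inner ℝ a (x - a) * a i| ≤ ‖x - a‖ := by
    calc _ ≤ |(1 - ‖a‖ ^ 2) * (x i - a i)| + |inner ℝ a (x - a) * a i| := abs_add_le _ _
      _ = (1 - ‖a‖ ^ 2) * |(x - a) i| + |inner ℝ a (x - a)| * |a i| := by
        rw [abs_mul, abs_mul, abs_of_pos h1]
        simp
      _ ≤ (1 - ‖a‖ ^ 2) * ‖x - a‖ + (‖a‖ * ‖x - a‖) * ‖a‖ := by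
        gcongr
        · exact hc _
        · exact abs_real_inner_le_norm _ _
        · exact hc _
      _ = ‖x - a‖ := by ring
  rw [poleDeriv, abs_div, abs_neg, abs_of_nonneg (by positivity : 0 ≤ √(quad a x + ε) ^ 3)]
  calc _ ≤ ‖x - a‖ / (√(1 - ‖a‖ ^ 2) * ‖x - a‖) ^ 3 := by
        gcongr
        exact sqrt_quad_add_ge ha hε x
    _ = (√(1 - ‖a‖ ^ 2) ^ 3)⁻¹ * (‖x - a‖ ^ 2)⁻¹ := by field_simp
    _ ≤ _ := by
      gcongr
      linarith

lemma ae_ne (a : E3) : ∀ᵐ x : E3, x ≠ a := by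
  simp [ae_iff]

lemma integrable_of_ae_le {a : E3} {f g : E3 → ℝ} {C : ℝ} (hf : Measurable f)
    (hle : ∀ x, x ≠ a → |f x| ≤ C * (1 + (‖x - a‖ ^ 2)⁻¹))
    (hg : Continuous g) (hgs : HasCompactSupport g) :
    Integrable fun x => f x * g x := by
  have h1 : LocallyIntegrable fun x : E3 => C * (1 + (‖x - a‖ ^ 2)⁻¹) := by
    exact ((locallyIntegrable_const (μ := (volume : Measure E3)) (1 : ℝ)).add
      (locallyIntegrable_inv_normSq a)).smul C
  have h2 := h1.integrable_smul_left_of_hasCompactSupport hg.norm hgs.norm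
  refine h2.mono' (hf.aestronglyMeasurable.mul hg.aestronglyMeasurable) ?_
  filter_upwards [ae_ne a] with x hx
  rw [norm_mul, mul_comm, Real.norm_eq_abs (f x), smul_eq_mul]
  gcongr
  exact hle x hx

lemma measurable_pole (a : E3) (ε : ℝ) : Measurable fun x => (√(quad a x + ε))⁻¹ :=
  ((contDiff_quad a).continuous.measurable.add_const ε).sqrt.inv

lemma measurable_poleDeriv (a : E3) (ε : ℝ) (i : Fin 3) : Measurable (poleDeriv a ε i) := by
  have hi : Continuous fun x : E3 => x i := (EuclideanSpace.proj (𝕜 := ℝ) i).continuous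
  have h1 : Continuous fun x : E3 =>
      -((1 - ‖a‖ ^ 2) * (x i - a i) + inner ℝ a (x - a) * a i) := by fun_prop
  exact h1.measurable.div
    (((contDiff_quad a).continuous.measurable.add_const ε).sqrt.pow_const 3)

lemma integrable_pole_mul {a : E3} (ha : a ∈ hball) {g : E3 → ℝ} (hg : Continuous g)
    (hgs : HasCompactSupport g) : Integrable fun x => (√(quad a x))⁻¹ * g x := by
  have := integrable_of_ae_le (measurable_pole a 0) (fun x hx => abs_pole_le ha le_rfl hx) hg hgs
  simpa using this

lemma integrable_poleDeriv_mul {a : E3} (ha : a ∈ hball) {g : E3 → ℝ} (hg : Continuous g)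
    (hgs : HasCompactSupport g) (i : Fin 3) : Integrable fun x => poleDeriv a 0 i x * g x :=
  integrable_of_ae_le (measurable_poleDeriv a 0 i)
    (fun _ hx => abs_poleDeriv_le ha le_rfl hx i) hg hgs

/-- The pole contributes no boundary term. For `(quad a + ε)^(-1/2)` the integrand is smooth, and
the limit `ε → 0` is dominated because the derivative is only `O(|x - a|⁻²)`. -/
lemma integral_pole_mul_pd {a : E3} (ha : a ∈ hball) {P : E3 → ℝ} (hP : ContDiff ℝ ∞ P)
    (hc : HasCompactSupport P) (i : Fin 3) :
    ∫ x, (√(quad a x))⁻¹ * pd i P x = -∫ x, poleDeriv a 0 i x * P x := by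
  set e : ℕ → ℝ := fun n => 1 / ((n : ℝ) + 1)
  have he : ∀ n, 0 < e n := fun n => by positivity
  have hlim : Tendsto e atTop (𝓝 0) := tendsto_one_div_add_atTop_nhds_zero_nat
  have hdP : Continuous (pd i P) := (contDiff_pd hP i).continuous
  have hdc := hasCompactSupport_pd hc i
  have hpos : ∀ n x, 0 < quad a x + e n := fun n x => by linarith [quad_nonneg ha x, he n]
  have hreg : ∀ n, ∫ x, (√(quad a x + e n))⁻¹ * pd i P x = -∫ x, poleDeriv a (e n) i x * P x := by
    intro n
    have h := (integral_mul_pd (U := univ) (v := fun x => (√(quad a x + e n))⁻¹)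
      (fun x _ => (((contDiff_quad a).contDiffAt.add contDiffAt_const).sqrt (hpos n x).ne').inv
        (Real.sqrt_pos.2 (hpos n x)).ne') hP hc (subset_univ _) i).2.2
    simpa only [fun x => pd_pole (hpos n x) i] using h
  have hB : ∀ (C : ℝ) (g : E3 → ℝ), Continuous g → HasCompactSupport g →
      Integrable fun x => C * (1 + (‖x - a‖ ^ 2)⁻¹) * |g x| := fun C g hg hgs => by
    have h1 : LocallyIntegrable fun x : E3 => C * (1 + (‖x - a‖ ^ 2)⁻¹) := by
      exact ((locallyIntegrable_const (μ := (volume : Measure E3)) (1 : ℝ)).add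
        (locallyIntegrable_inv_normSq a)).smul C
    refine (h1.integrable_smul_left_of_hasCompactSupport hg.norm hgs.norm).congr
      (.of_forall fun x => ?_)
    simp [mul_comm]
  have hsq : ∀ x, Tendsto (fun n => √(quad a x + e n)) atTop (𝓝 √(quad a x)) :=
    fun x => by
      have := (Real.continuous_sqrt.tendsto (quad a x + 0)).comp (hlim.const_add (quad a x))
      simpa [Function.comp_def] using this
  have t1 : Tendsto (fun n => ∫ x, (√(quad a x + e n))⁻¹ * pd i P x) atTop
      (𝓝 (∫ x, (√(quad a x))⁻¹ * pd i P x)) := by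
    refine tendsto_integral_of_dominated_convergence _
      (fun n => ((measurable_pole a (e n)).mul hdP.measurable).aestronglyMeasurable)
      (hB (√(1 - ‖a‖ ^ 2))⁻¹ _ hdP hdc) (fun n => ?_) ?_
    · filter_upwards [ae_ne a] with x hx
      rw [Real.norm_eq_abs, abs_mul]
      gcongr
      exact abs_pole_le ha (he n).le hx
    · filter_upwards [ae_ne a] with x hx
      exact ((hsq x).inv₀ (Real.sqrt_pos.2 (quad_pos ha hx)).ne').mul_const _
  have t2 : Tendsto (fun n => ∫ x, poleDeriv a (e n) i x * P x) atTop
      (𝓝 (∫ x, poleDeriv a 0 i x * P x)) := by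
    refine tendsto_integral_of_dominated_convergence _
      (fun n => ((measurable_poleDeriv a (e n) i).mul hP.continuous.measurable).aestronglyMeasurable)
      (hB (√(1 - ‖a‖ ^ 2) ^ 3)⁻¹ _ hP.continuous hc) (fun n => ?_) ?_
    · filter_upwards [ae_ne a] with x hx
      rw [Real.norm_eq_abs, abs_mul]
      gcongr
      exact abs_poleDeriv_le ha (he n).le hx i
    · filter_upwards [ae_ne a] with x hx
      have hq := Real.sqrt_pos.2 (quad_pos ha hx)
      have := (tendsto_const_nhds (x := -((1 - ‖a‖ ^ 2) * (x i - a i) +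
        inner ℝ a (x - a) * a i))).div ((hsq x).pow 3) (by positivity)
      simpa [poleDeriv] using this.mul_const (P x)
  simp only [hreg] at t1
  exact tendsto_nhds_unique t1 t2.neg

/-- `f` is smooth on `U` up to a simple pole at `a`. -/
def HasPole (a : E3) (U : Set E3) (f : E3 → ℝ) : Prop :=
  ∃ u v : E3 → ℝ, (∀ x ∈ U, ContDiffAt ℝ ∞ u x) ∧ (∀ x ∈ U, ContDiffAt ℝ ∞ v x) ∧
    ∀ x ∈ U, x ≠ a → f x = u x * (√(quad a x))⁻¹ + v x

lemma hasPole_coulomb (a : E3) (U : Set E3) : HasPole a U (coulomb a) := by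
  refine ⟨fun x => (1 - inner ℝ a x) / (4 * Real.pi), fun _ => 0, fun x _ =>
    (contDiff_one_sub_inner a).contDiffAt.div_const _, fun x _ => contDiffAt_const,
    fun x _ _ => ?_⟩
  rw [coulomb, add_zero, div_mul_eq_div_div, div_eq_mul_inv _ √_]

lemma HasPole.contDiffAt {a : E3} (ha : a ∈ hball) {U : Set E3} (hU : IsOpen U) {f : E3 → ℝ}
    (h : HasPole a U f) {x : E3} (hx : x ∈ U) (hxa : x ≠ a) : ContDiffAt ℝ ∞ f x := by
  obtain ⟨u, v, hu, hv, hf⟩ := h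
  have hq := Real.sqrt_pos.2 (quad_pos ha hxa)
  refine (((hu x hx).mul ((contDiffAt_sqrt_quad ha hxa).inv hq.ne')).add
    (hv x hx)).congr_of_eventuallyEq ?_
  filter_upwards [hU.mem_nhds hx, isOpen_ne.mem_nhds hxa] with y hy hya using hf y hy hya

lemma locallyIntegrable_pole {a : E3} (ha : a ∈ hball) :
    LocallyIntegrable fun x => (√(quad a x))⁻¹ := by
  have h1 : LocallyIntegrable fun x : E3 => (√(1 - ‖a‖ ^ 2))⁻¹ * (1 + (‖x - a‖ ^ 2)⁻¹) := by
    exact ((locallyIntegrable_const (μ := (volume : Measure E3)) (1 : ℝ)).add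
      (locallyIntegrable_inv_normSq a)).smul (√(1 - ‖a‖ ^ 2))⁻¹
  refine h1.mono (by simpa using (measurable_pole a 0).aestronglyMeasurable) ?_
  filter_upwards [ae_ne a] with x hx
  have := abs_pole_le ha le_rfl hx
  rw [add_zero] at this
  exact this.trans (le_abs_self _)

lemma HasPole.locallyIntegrableOn {a : E3} (ha : a ∈ hball) {U : Set E3} (hU : IsOpen U)
    {f : E3 → ℝ} (h : HasPole a U f) : LocallyIntegrableOn f U := by
  obtain ⟨u, v, hu, hv, hf⟩ := h
  have h1 := (locallyIntegrable_pole ha).locallyIntegrableOn U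
  have hcu : ContinuousOn u U := fun x hx => (hu x hx).continuousAt.continuousWithinAt
  have hcv : ContinuousOn v U := fun x hx => (hv x hx).continuousAt.continuousWithinAt
  rw [locallyIntegrableOn_iff hU.isLocallyClosed]
  intro K hKU hK
  have h2 := (h1.integrableOn_compact_subset hKU hK).continuousOn_mul (hcu.mono hKU) hK
  have h3 := h2.add ((hcv.mono hKU).integrableOn_compact hK)
  refine h3.congr ?_
  filter_upwards [ae_restrict_mem hK.measurableSet, ae_restrict_of_ae (ae_ne a)] with x hx hxa
  exact (hf x (hKU hx) hxa).symm

/-- The smooth factor `u` of the pole is moved onto the test function, which reduces the claim to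
the pure pole and the smooth remainder `v`. -/
lemma HasPole.integral_mul_pd {a : E3} (ha : a ∈ hball) {U : Set E3} (hU : IsOpen U)
    {f : E3 → ℝ} (h : HasPole a U f) {P : E3 → ℝ} (hP : ContDiff ℝ ∞ P)
    (hc : HasCompactSupport P) (hs : tsupport P ⊆ U) (i : Fin 3) :
    Integrable (fun x => f x * pd i P x) ∧ Integrable (fun x => pd i f x * P x) ∧
      ∫ x, f x * pd i P x = -∫ x, pd i f x * P x := by
  obtain ⟨u, v, hu, hv, hf⟩ := h
  obtain ⟨v1, v2, v3⟩ := OpticalBH.integral_mul_pd hv hP hc hs i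
  have huP := contDiff_mul_of_tsupport hu hP hs
  have huPc : HasCompactSupport fun x => u x * P x := hc.mul_left
  have hdu := contDiff_mul_of_tsupport (fun x hx => contDiffAt_pd (hu x hx) i) hP hs
  have hduc : HasCompactSupport fun x => pd i u x * P x := hc.mul_left
  have j1 := integrable_pole_mul ha (contDiff_pd huP i).continuous (hasCompactSupport_pd huPc i)
  have j2 := integrable_poleDeriv_mul ha huP.continuous huPc i
  have j3 := integrable_pole_mul ha hdu.continuous hduc
  have e1 : (fun x => (√(quad a x))⁻¹ * pd i (fun y => u y * P y) x -
      (√(quad a x))⁻¹ * (pd i u x * P x) + v x * pd i P x) =ᵐ[volume] fun x => f x * pd i P x := by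
    filter_upwards [ae_ne a] with x hx
    by_cases hxs : x ∈ tsupport P
    · rw [pd_mul ((hu x (hs hxs)).differentiableAt (by simp)) (hP.differentiable (by simp) x),
        hf x (hs hxs) hx]
      ring
    · rw [pd_eq_zero_of_notMem hxs, pd_eq_zero_of_notMem
        (fun h => hxs (tsupport_mul_subset_right h)), image_eq_zero_of_notMem_tsupport hxs]
      ring
  have e2 : (fun x => poleDeriv a 0 i x * (u x * P x) +
      (√(quad a x))⁻¹ * (pd i u x * P x) + pd i v x * P x) =ᵐ[volume] fun x => pd i f x * P x := by
    filter_upwards [ae_ne a] with x hx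
    by_cases hxs : x ∈ tsupport P
    · have hxU := hs hxs
      have hq : 0 < quad a x + 0 := by rw [add_zero]; exact quad_pos ha hx
      have hp := pd_pole hq i
      have hpd := (hasFDerivAt_pole hq).differentiableAt
      simp only [add_zero] at hp hpd
      have hfe : f =ᶠ[𝓝 x] fun y => u y * (√(quad a y))⁻¹ + v y := by
        filter_upwards [hU.mem_nhds hxU, isOpen_ne.mem_nhds hx] with y hy hya using hf y hy hya
      have hud := (hu x hxU).differentiableAt (by simp : (∞ : WithTop ℕ∞) ≠ 0)
      rw [pd_congr hfe, pd_add (hud.fun_mul hpd) ((hv x hxU).differentiableAt (by simp)),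
        pd_mul hud hpd, hp]
      ring
    · rw [image_eq_zero_of_notMem_tsupport hxs]
      ring
  refine ⟨((j1.sub j3).add v1).congr e1, ((j2.add j3).add v2).congr e2, ?_⟩
  rw [← integral_congr_ae e1, ← integral_congr_ae e2]
  have s1 := integral_add (j1.sub j3) v1
  have s2 := integral_add (j2.add j3) v2
  simp only [Pi.sub_apply, Pi.add_apply] at s1 s2
  rw [s1, s2, integral_sub j1 j3, integral_add j2 j3, integral_pole_mul_pd ha huP huPc, v3]
  ring

/-! ### Green's functions -/

/-- The density `√(det g) Δ_g f`. -/
def lapDensity (g : E3 → Matrix (Fin 3) (Fin 3) ℝ) (f : E3 → ℝ) (x : E3) : ℝ :=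
  ∑ i, pd i (gradDensity g f i) x

lemma contDiffAt_normSq (x : E3) : ContDiffAt ℝ ∞ (fun y : E3 => ‖y‖ ^ 2) x :=
  (contDiff_norm_sq ℝ).contDiffAt

lemma contDiffAt_apply (i : Fin 3) (x : E3) : ContDiffAt ℝ ∞ (fun y : E3 => y i) x :=
  (EuclideanSpace.proj (𝕜 := ℝ) i).contDiff.contDiffAt

lemma contDiffAt_gradDensity_hyp {f : E3 → ℝ} {x : E3} (hx : x ∈ hball)
    (h : ContDiffAt ℝ ∞ f x) (i : Fin 3) : ContDiffAt ℝ ∞ (gradDensity hyp f i) x := by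
  have hb := one_sub_normSq_pos hx
  have h1 : ContDiffAt ℝ ∞ (fun y => fderiv ℝ f y y) x :=
    (h.fderiv_right (m := ∞) (by simp)).clm_apply contDiffAt_id
  refine (((contDiffAt_const.sub (contDiffAt_normSq x)).inv hb.ne').mul
    ((contDiffAt_pd h i).sub ((contDiffAt_apply i x).mul h1))).congr_of_eventuallyEq ?_
  filter_upwards [isOpen_hball.mem_nhds hx] with y hy using gradDensity_hyp hy f i

lemma contDiffAt_gradDensity_opt {M Q : ℝ} (h : |Q| < M) {f : E3 → ℝ} {x : E3} (hx : x ∈ ext)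
    (hf : ContDiffAt ℝ ∞ f x) (i : Fin 3) : ContDiffAt ℝ ∞ (gradDensity (opt M Q) f i) x := by
  refine (((contDiffAt_HH M Q (mem_ext.1 hx).2).pow 2).mul
    (contDiffAt_gradDensity_hyp (ext_subset hx) hf i)).congr_of_eventuallyEq ?_
  filter_upwards [isOpen_ext.mem_nhds hx] with y hy using gradDensity_opt h hy f i

lemma gradDensity_eq_zero_of_notMem {g : E3 → Matrix (Fin 3) (Fin 3) ℝ} {f : E3 → ℝ} {x : E3}
    (hx : x ∉ tsupport f) (i : Fin 3) : gradDensity g f i x = 0 := by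
  simp [gradDensity, pd_eq_zero_of_notMem hx]

lemma tsupport_gradDensity_subset (g : E3 → Matrix (Fin 3) (Fin 3) ℝ) (f : E3 → ℝ) (i : Fin 3) :
    tsupport (gradDensity g f i) ⊆ tsupport f :=
  tsupport_subset_of_eq_zero fun _ hx => gradDensity_eq_zero_of_notMem hx i

lemma lapDensity_eq_zero_of_notMem {g : E3 → Matrix (Fin 3) (Fin 3) ℝ} {f : E3 → ℝ} {x : E3}
    (hx : x ∉ tsupport f) : lapDensity g f x = 0 :=
  Finset.sum_eq_zero fun i _ =>
    pd_eq_zero_of_notMem (fun h => hx (tsupport_gradDensity_subset g f i h)) i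

lemma contDiff_gradDensity_hyp {φ : E3 → ℝ} (hφ : ContDiff ℝ ∞ φ) (hs : tsupport φ ⊆ hball)
    (i : Fin 3) : ContDiff ℝ ∞ (gradDensity hyp φ i) :=
  contDiff_of_contDiffAt_tsupport fun _ hx => contDiffAt_gradDensity_hyp
    (hs (tsupport_gradDensity_subset hyp φ i hx)) hφ.contDiffAt i

lemma contDiff_gradDensity_opt {M Q : ℝ} (h : |Q| < M) {φ : E3 → ℝ} (hφ : ContDiff ℝ ∞ φ)
    (hs : tsupport φ ⊆ ext) (i : Fin 3) : ContDiff ℝ ∞ (gradDensity (opt M Q) φ i) :=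
  contDiff_of_contDiffAt_tsupport fun _ hx => contDiffAt_gradDensity_opt h
    (hs (tsupport_gradDensity_subset _ φ i hx)) hφ.contDiffAt i

lemma continuous_lapDensity_hyp {φ : E3 → ℝ} (hφ : ContDiff ℝ ∞ φ) (hs : tsupport φ ⊆ hball) :
    Continuous (lapDensity hyp φ) :=
  continuous_finsetSum _ fun i _ =>
    (contDiff_pd (contDiff_gradDensity_hyp hφ hs i) i).continuous

/-- The distributional pairing with a Laplacian is an integral over the whole coordinate space. -/
lemma setIntegral_laplacian_eq {g : E3 → Matrix (Fin 3) (Fin 3) ℝ} {U : Set E3} (hU : IsOpen U)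
    (hg : ∀ x ∈ U, volDensity g x ≠ 0) (G : E3 → ℝ) {φ : E3 → ℝ} (hs : tsupport φ ⊆ U) :
    ∫ x in U, G x * laplacian g φ x * volDensity g x = ∫ x, G x * lapDensity g φ x := by
  rw [← setIntegral_eq_integral_of_forall_compl_eq_zero (s := U) (f := fun x =>
    G x * lapDensity g φ x) fun x hx => by
      rw [lapDensity_eq_zero_of_notMem fun h => hx (hs h), mul_zero]]
  refine setIntegral_congr_fun hU.measurableSet fun x hx => ?_
  simp only [mul_assoc, laplacian_mul_volDensity (hg x hx), lapDensity]

lemma setIntegral_laplacian_hyp {U : Set E3} (hU : IsOpen U) (hUb : U ⊆ hball) (G : E3 → ℝ)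
    {φ : E3 → ℝ} (hs : tsupport φ ⊆ U) :
    ∫ x in U, G x * laplacian hyp φ x * volDensity hyp x = ∫ x, G x * lapDensity hyp φ x :=
  setIntegral_laplacian_eq hU (fun _ hx => volDensity_hyp_ne_zero (hUb hx)) G hs

lemma setIntegral_laplacian_opt {M Q : ℝ} (h : |Q| < M) (G : E3 → ℝ)
    {φ : E3 → ℝ} (hs : tsupport φ ⊆ ext) :
    ∫ x in ext, G x * laplacian (opt M Q) φ x * volDensity (opt M Q) x =
      ∫ x, G x * lapDensity (opt M Q) φ x :=
  setIntegral_laplacian_eq isOpen_ext (fun _ hx => volDensity_opt_ne_zero h hx) G hs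

lemma sum_gradDensity_mul_pd_eq_fderiv_efield {a x : E3} (ha : a ∈ hball) (hx : x ∈ hball)
    (hxa : x ≠ a) (φ : E3 → ℝ) :
    ∑ i, pd i (coulomb a) x * gradDensity hyp φ i x = fderiv ℝ φ x (efield a x) := by
  rw [← sum_gradDensity_hyp_comm hx, fderiv_eq_sum_pd]
  simp only [gradDensity_coulomb ha hx hxa]

/-- One integration by parts and the symmetry of the energy density leave minus the pairing of `dφ`
with `efield a`, which has unit charge. -/
lemma integral_coulomb_mul_lapDensity {a : E3} (ha : a ∈ hball) {φ : E3 → ℝ}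
    (hφ : ContDiff ℝ ∞ φ) (hc : HasCompactSupport φ) (hs : tsupport φ ⊆ hball) :
    ∫ x, coulomb a x * lapDensity hyp φ x = -φ a := by
  have hP : ∀ i, ContDiff ℝ ∞ (gradDensity hyp φ i) := contDiff_gradDensity_hyp hφ hs
  have hPc : ∀ i, HasCompactSupport (gradDensity hyp φ i) := fun i =>
    hasCompactSupport_of_eq_zero hc fun x hx => gradDensity_eq_zero_of_notMem hx i
  have hi := fun i => (hasPole_coulomb a hball).integral_mul_pd ha isOpen_hball (hP i) (hPc i)
    ((tsupport_gradDensity_subset hyp φ i).trans hs) i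
  simp only [lapDensity, Finset.mul_sum]
  rw [integral_finsetSum _ fun i _ => (hi i).1]
  simp only [(hi _).2.2]
  rw [Finset.sum_neg_distrib, ← integral_finsetSum _ fun i _ => (hi i).2.1,
    ← integral_fderiv_efield ha hφ hc]
  congr 1
  refine integral_congr_ae ?_
  filter_upwards [ae_ne a] with x hx
  by_cases hxs : x ∈ tsupport φ
  · exact sum_gradDensity_mul_pd_eq_fderiv_efield ha (hs hxs) hx φ
  · simp [gradDensity_eq_zero_of_notMem hxs, fderiv_eq_zero_of_notMem hxs]

lemma isGreen_coulomb {a : E3} (ha : a ∈ hball) : IsGreen hyp hball a (coulomb a) where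
  smooth _ hx := (contDiffAt_coulomb ha hx.2).contDiffWithinAt
  locInt := (hasPole_coulomb a hball).locallyIntegrableOn ha isOpen_hball
  eqn φ hφ hc hs := by
    rw [setIntegral_laplacian_hyp isOpen_hball subset_rfl _ hs,
      integral_coulomb_mul_lapDensity ha hφ hc hs, neg_neg]

/-- Constants are weakly harmonic. This disposes of the additive constants, `A` for the hyperbolic
metric and `B` for the optical one. -/
lemma integral_lapDensity {g : E3 → Matrix (Fin 3) (Fin 3) ℝ} {φ : E3 → ℝ}
    (hP : ∀ i, ContDiff ℝ ∞ (gradDensity g φ i)) (hc : HasCompactSupport φ) (b : ℝ) :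
    Integrable (fun x => b * lapDensity g φ x) ∧ ∫ x, b * lapDensity g φ x = 0 := by
  have hPc : ∀ i, HasCompactSupport (gradDensity g φ i) := fun i =>
    hasCompactSupport_of_eq_zero hc fun x hx => gradDensity_eq_zero_of_notMem hx i
  have hi := fun i => integral_mul_pd (U := univ) (v := fun _ => b)
    (fun _ _ => contDiffAt_const) (hP i) (hPc i) (subset_univ _) i
  have h0 : ∀ i x, pd i (fun _ : E3 => b) x = 0 := by simp [pd]
  simp only [lapDensity, Finset.mul_sum]
  refine ⟨integrable_finsetSum _ fun i _ => (hi i).1, ?_⟩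
  rw [integral_finsetSum _ fun i _ => (hi i).1]
  simp [(hi _).2.2, h0]

lemma gradDensity_mul {f₁ f₂ : E3 → ℝ} {x : E3} (g : E3 → Matrix (Fin 3) (Fin 3) ℝ)
    (h₁ : DifferentiableAt ℝ f₁ x) (h₂ : DifferentiableAt ℝ f₂ x) (i : Fin 3) :
    gradDensity g (fun y => f₁ y * f₂ y) i x =
      f₁ x * gradDensity g f₂ i x + f₂ x * gradDensity g f₁ i x := by
  simp only [gradDensity, pd_mul h₁ h₂, Finset.mul_sum, ← Finset.sum_add_distrib]
  exact Finset.sum_congr rfl fun j _ => by ring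

/-- Conformal covariance: `H` being harmonic, `Δ_{H⁴h} φ = H⁻⁵ Δ_h (H φ)`. -/
lemma lapDensity_opt {M Q : ℝ} (h : |Q| < M) {φ : E3 → ℝ} {x : E3} (hx : x ∈ ext)
    (hφ : ContDiffAt ℝ ∞ φ x) :
    lapDensity (opt M Q) φ x = HH M Q x * lapDensity hyp (fun y => HH M Q y * φ y) x := by
  have hx0 := (mem_ext.1 hx).2
  have hb := ext_subset hx
  have hH := contDiffAt_HH M Q hx0
  have hHφ : ContDiffAt ℝ ∞ (fun y => HH M Q y * φ y) x := hH.mul hφ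
  have hne : (∞ : WithTop ℕ∞) ≠ 0 := by simp
  -- In terms of gradients, `H² ∇φ = H ∇(Hφ) - (Hφ) ∇H`. On taking the divergence the cross terms
  -- cancel by symmetry (`hsym`) and the term `Hφ Δ_h H` vanishes (`hL`).
  have e : ∀ i, gradDensity (opt M Q) φ i =ᶠ[𝓝 x] fun y =>
      HH M Q y * gradDensity hyp (fun y => HH M Q y * φ y) i y +
        (-1 * (HH M Q y * φ y)) * gradDensity hyp (HH M Q) i y := by
    intro i
    filter_upwards [isOpen_ext.mem_nhds hx, (hφ.of_le (m := 1)
      (by exact_mod_cast le_top)).eventually (by simp)] with y hy hφy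
    rw [gradDensity_opt h hy, gradDensity_mul hyp
      ((contDiffAt_HH M Q (mem_ext.1 hy).2).differentiableAt hne) (hφy.differentiableAt (by simp))]
    ring
  have d1 := hH.differentiableAt hne
  have d2 := hHφ.differentiableAt hne
  have d2' := d2.const_mul (-1)
  have d3 := fun i => (contDiffAt_gradDensity_hyp hb hHφ i).differentiableAt hne
  have d4 := fun i => (contDiffAt_gradDensity_hyp hb hH i).differentiableAt hne
  have hneg : ∀ i, pd i (fun y => -1 * (HH M Q y * φ y)) x =
      -pd i (fun y => HH M Q y * φ y) x := fun i => by
    rw [pd, fderiv_const_mul d2]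
    simp [pd]
  have hsym := sum_gradDensity_hyp_comm hb (fun y => HH M Q y * φ y) (HH M Q)
  have hL := sum_pd_gradDensity_HH h hx
  simp only [lapDensity, fun i => pd_congr (e i) i, fun i => pd_add (d1.fun_mul (d3 i))
    (d2'.fun_mul (d4 i)) i, fun i => pd_mul d1 (d3 i) i, fun i => pd_mul d2' (d4 i) i, hneg]
  simp only [Fin.sum_univ_three] at hsym hL ⊢
  linear_combination hsym - (HH M Q x * φ x) * hL

lemma contDiff_HH_mul {M Q : ℝ} {φ : E3 → ℝ} (hφ : ContDiff ℝ ∞ φ) (hs : tsupport φ ⊆ ext) :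
    ContDiff ℝ ∞ fun x => HH M Q x * φ x :=
  contDiff_mul_of_tsupport (fun _ hx => contDiffAt_HH M Q (mem_ext.1 hx).2) hφ hs

lemma lapDensity_opt_test {M Q : ℝ} (h : |Q| < M) {φ : E3 → ℝ} (hφ : ContDiff ℝ ∞ φ)
    (hs : tsupport φ ⊆ ext) (x : E3) :
    lapDensity (opt M Q) φ x = HH M Q x * lapDensity hyp (fun y => HH M Q y * φ y) x := by
  by_cases hx : x ∈ tsupport φ
  · exact lapDensity_opt h (hs hx) hφ.contDiffAt
  · rw [lapDensity_eq_zero_of_notMem hx, lapDensity_eq_zero_of_notMem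
      fun h => hx (tsupport_mul_subset_right h), mul_zero]

/-- `greenFamily` with `V_O ∘ T` in closed form. -/
def coulombFamily (M Q : ℝ) (a : E3) (A B : ℝ) (x : E3) : ℝ :=
  (coulomb a x + A) / (HH M Q x * HH M Q a) + B

lemma greenFamily_eq (M Q : ℝ) {T : E3 → E3} (hT : IsHypIsometry T) {a : E3} (ha : a ∈ ext)
    (h0 : T a = 0) (A B : ℝ) {x : E3} (hx : x ∈ hball) :
    greenFamily M Q T a A B x = coulombFamily M Q a A B x := by
  rw [greenFamily, hT.VO_comp ha h0 hx, coulombFamily]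

lemma hasPole_coulombFamily {M Q : ℝ} (h : |Q| < M) (a : E3) (A B : ℝ) :
    HasPole a ext (coulombFamily M Q a A B) := by
  have hd : ∀ x ∈ ext, ContDiffAt ℝ ∞ (fun y => HH M Q y * HH M Q a) x := fun x hx =>
    (contDiffAt_HH M Q (mem_ext.1 hx).2).mul contDiffAt_const
  have hn : ∀ x, HH M Q x * HH M Q a ≠ 0 := fun x => (mul_pos (HH_pos h x) (HH_pos h a)).ne'
  refine ⟨fun x => (1 - inner ℝ a x) / (4 * Real.pi) / (HH M Q x * HH M Q a),
    fun x => A / (HH M Q x * HH M Q a) + B,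
    fun x hx => ((contDiff_one_sub_inner a).contDiffAt.div_const _).div (hd x hx) (hn x),
    fun x hx => (contDiffAt_const.div (hd x hx) (hn x)).add contDiffAt_const, fun x hx hxa => ?_⟩
  rw [coulombFamily, coulomb, div_mul_eq_div_div _ _ √_]
  ring

/-- Testing with `φ` becomes testing `coulomb a + A` with `Hφ` for the hyperbolic metric. The pole
yields `H(a) φ(a)`, which the normalisation `1/H(a)` corrects, and both constants drop out. -/
lemma isGreen_coulombFamily {M Q : ℝ} (h : |Q| < M) {a : E3} (ha : a ∈ ext) (A B : ℝ) :
    IsGreen (opt M Q) ext a (coulombFamily M Q a A B) where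
  smooth x hx := ((hasPole_coulombFamily h a A B).contDiffAt (ext_subset ha) isOpen_ext hx.1
    hx.2).contDiffWithinAt
  locInt := (hasPole_coulombFamily h a A B).locallyIntegrableOn (ext_subset ha) isOpen_ext
  eqn φ hφ hc hs := by
    have hHa := HH_pos h a
    rw [setIntegral_laplacian_opt h _ hs]
    set ψ : E3 → ℝ := fun x => HH M Q x * φ x with hψdef
    have hψ : ContDiff ℝ ∞ ψ := contDiff_HH_mul hφ hs
    have hψc : HasCompactSupport ψ := hc.mul_left
    have hψs : tsupport ψ ⊆ hball := (tsupport_mul_subset_right.trans hs).trans ext_subset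
    have e : ∀ x, coulombFamily M Q a A B x * lapDensity (opt M Q) φ x =
        (HH M Q a)⁻¹ * (coulomb a x * lapDensity hyp ψ x) +
          ((HH M Q a)⁻¹ * A) * lapDensity hyp ψ x + B * lapDensity (opt M Q) φ x := fun x => by
      have := HH_pos h x
      rw [coulombFamily, lapDensity_opt_test h hφ hs x, ← hψdef]
      field_simp
    have i1 : Integrable fun x => (HH M Q a)⁻¹ * (coulomb a x * lapDensity hyp ψ x) := by
      have hP : ∀ i, ContDiff ℝ ∞ (gradDensity hyp ψ i) := contDiff_gradDensity_hyp hψ hψs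
      have hi := fun i => (hasPole_coulomb a hball).integral_mul_pd (ext_subset ha) isOpen_hball
        (hP i) (hasCompactSupport_of_eq_zero hψc fun x hx => gradDensity_eq_zero_of_notMem hx i)
        ((tsupport_gradDensity_subset hyp ψ i).trans hψs) i
      simp only [lapDensity, Finset.mul_sum]
      exact integrable_finsetSum _ fun i _ => ((hi i).1).const_mul _
    obtain ⟨i2, v2⟩ := integral_lapDensity (contDiff_gradDensity_hyp hψ hψs) hψc ((HH M Q a)⁻¹ * A)
    obtain ⟨i3, v3⟩ := integral_lapDensity (contDiff_gradDensity_opt h hφ hs) hc B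
    simp only [e]
    rw [integral_add (by exact i1.add i2) i3, integral_add i1 i2, v2, v3, integral_const_mul,
      integral_coulomb_mul_lapDensity (ext_subset ha) hψ hψc hψs, hψdef]
    field_simp
    ring

/-! ### Maxwell's equations -/

lemma sum_gradDensity_opt_comm {M Q : ℝ} (h : |Q| < M) {x : E3} (hx : x ∈ ext) (f₁ f₂ : E3 → ℝ) :
    ∑ i, gradDensity (opt M Q) f₁ i x * pd i f₂ x =
      ∑ i, pd i f₁ x * gradDensity (opt M Q) f₂ i x := by
  have := sum_gradDensity_hyp_comm (ext_subset hx) f₁ f₂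
  simp only [gradDensity_opt h hx, Fin.sum_univ_three] at *
  linear_combination HH M Q x ^ 2 * this

/-- The weak form of the equation for a Green's function with a simple pole. -/
lemma integral_sum_gradDensity_mul_pd {M Q : ℝ} (h : |Q| < M) {a : E3} (ha : a ∈ ext) {G : E3 → ℝ}
    (hG : IsGreen (opt M Q) ext a G) (hp : HasPole a ext G) {φ : E3 → ℝ} (hφ : ContDiff ℝ ∞ φ)
    (hc : HasCompactSupport φ) (hs : tsupport φ ⊆ ext) :
    ∫ x, ∑ i, gradDensity (opt M Q) G i x * pd i φ x = φ a := by
  have hP := contDiff_gradDensity_opt h hφ hs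
  have hPc : ∀ i, HasCompactSupport (gradDensity (opt M Q) φ i) := fun i =>
    hasCompactSupport_of_eq_zero hc fun x hx => gradDensity_eq_zero_of_notMem hx i
  have hi := fun i => hp.integral_mul_pd (ext_subset ha) isOpen_ext (hP i) (hPc i)
    ((tsupport_gradDensity_subset _ φ i).trans hs) i
  -- The derivative is shifted to the test function's side, so that integration by parts meets `G`
  -- only through its pole and one derivative.
  have e : ∀ x, ∑ i, gradDensity (opt M Q) G i x * pd i φ x =
      ∑ i, pd i G x * gradDensity (opt M Q) φ i x := fun x => by
    by_cases hx : x ∈ tsupport φ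
    · exact sum_gradDensity_opt_comm h (hs hx) G φ
    · simp [pd_eq_zero_of_notMem hx, gradDensity_eq_zero_of_notMem hx]
  simp only [e]
  rw [← hG.eqn φ hφ hc hs, setIntegral_laplacian_opt h _ hs, integral_finsetSum _
    fun i _ => (hi i).2.1]
  simp only [lapDensity, Finset.mul_sum]
  rw [integral_finsetSum _ fun i _ => (hi i).1]
  simp only [(hi _).2.2, Finset.sum_neg_distrib, neg_neg]

lemma HasPole.locallyIntegrableOn_pd {a : E3} (ha : a ∈ hball) {U : Set E3} (hU : IsOpen U)
    {f : E3 → ℝ} (h : HasPole a U f) (i : Fin 3) : LocallyIntegrableOn (pd i f) U := by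
  obtain ⟨u, v, hu, hv, hf⟩ := h
  have h1 : LocallyIntegrable (poleDeriv a 0 i) := by
    have h2 : LocallyIntegrable fun x : E3 =>
        (√(1 - ‖a‖ ^ 2) ^ 3)⁻¹ * (1 + (‖x - a‖ ^ 2)⁻¹) := by
      exact ((locallyIntegrable_const (μ := (volume : Measure E3)) (1 : ℝ)).add
        (locallyIntegrable_inv_normSq a)).smul (√(1 - ‖a‖ ^ 2) ^ 3)⁻¹
    refine h2.mono (measurable_poleDeriv a 0 i).aestronglyMeasurable ?_
    filter_upwards [ae_ne a] with x hx
    exact (abs_poleDeriv_le ha le_rfl hx i).trans (le_abs_self _)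
  have hcu : ContinuousOn u U := fun x hx => (hu x hx).continuousAt.continuousWithinAt
  have hcdu : ContinuousOn (pd i u) U := fun x hx =>
    (contDiffAt_pd (hu x hx) i).continuousAt.continuousWithinAt
  have hcdv : ContinuousOn (pd i v) U := fun x hx =>
    (contDiffAt_pd (hv x hx) i).continuousAt.continuousWithinAt
  rw [locallyIntegrableOn_iff hU.isLocallyClosed]
  intro K hKU hK
  have j1 := (h1.integrableOn_isCompact hK).continuousOn_mul (hcu.mono hKU) hK
  have j2 := ((locallyIntegrable_pole ha).integrableOn_isCompact hK).continuousOn_mul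
    (hcdu.mono hKU) hK
  refine ((j1.add j2).add ((hcdv.mono hKU).integrableOn_compact hK)).congr ?_
  filter_upwards [ae_restrict_mem hK.measurableSet, ae_restrict_of_ae (ae_ne a)] with x hxK hx
  have hxU := hKU hxK
  have hq : 0 < quad a x + 0 := by rw [add_zero]; exact quad_pos ha hx
  have hp := pd_pole hq i
  have hpd := (hasFDerivAt_pole hq).differentiableAt
  simp only [add_zero] at hp hpd
  have hfe : f =ᶠ[𝓝 x] fun y => u y * (√(quad a y))⁻¹ + v y := by
    filter_upwards [hU.mem_nhds hxU, isOpen_ne.mem_nhds hx] with y hy hya using hf y hy hya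
  have hud := (hu x hxU).differentiableAt (by simp : (∞ : WithTop ℕ∞) ≠ 0)
  rw [pd_congr hfe, pd_add (hud.fun_mul hpd) ((hv x hxU).differentiableAt (by simp)),
    pd_mul hud hpd, hp]
  simp only [Pi.add_apply]
  ring

lemma locallyIntegrableOn_gradDensity_opt {M Q : ℝ} (h : |Q| < M) {a : E3} (ha : a ∈ ext)
    {G : E3 → ℝ} (hp : HasPole a ext G) (i : Fin 3) :
    LocallyIntegrableOn (gradDensity (opt M Q) G i) ext := by
  have hcH : ContinuousOn (HH M Q) ext := fun x hx =>
    (contDiffAt_HH M Q (mem_ext.1 hx).2).continuousAt.continuousWithinAt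
  have hcx : ∀ j, Continuous fun x : E3 => x j := fun j =>
    (EuclideanSpace.proj (𝕜 := ℝ) j).continuous
  have hb : ContinuousOn (fun x : E3 => HH M Q x ^ 2 * (1 - ‖x‖ ^ 2)⁻¹) ext :=
    (hcH.pow 2).mul (ContinuousOn.inv₀ (by fun_prop)
      fun x hx => (one_sub_normSq_pos (ext_subset hx)).ne')
  rw [locallyIntegrableOn_iff isOpen_ext.isLocallyClosed]
  intro K hKU hK
  have hpd := fun j => (hp.locallyIntegrableOn_pd (ext_subset ha) isOpen_ext
    j).integrableOn_compact_subset hKU hK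
  have h1 : IntegrableOn (fun x => ∑ j, x j * pd j G x) K :=
    integrable_finsetSum _ fun j _ => (hpd j).continuousOn_mul (hcx j).continuousOn hK
  have h2 := ((hpd i).sub (h1.continuousOn_mul (hcx i).continuousOn hK)).continuousOn_mul
    (hb.mono hKU) hK
  refine h2.congr_fun (fun x hx => ?_) hK.measurableSet
  simp only [gradDensity_opt h (hKU hx), gradDensity_hyp (ext_subset (hKU hx)),
    fderiv_eq_sum_pd G x x, Pi.sub_apply, mul_assoc]

/-- A static field is not integrable over all times; restricting to the two projections of the
compact support leaves a bounded function times a product of integrable ones. -/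
lemma integrable_snd_mul {U : Set E3} {F : E3 → ℝ} (hF : LocallyIntegrableOn F U)
    {k : ℝ × E3 → ℝ} (hk : Continuous k) (hc : HasCompactSupport k)
    (hs : tsupport k ⊆ univ ×ˢ U) : Integrable fun p => F p.2 * k p := by
  have hK : IsCompact (Prod.snd '' tsupport k) := hc.isCompact.image continuous_snd
  have hI : IsCompact (Prod.fst '' tsupport k) := hc.isCompact.image continuous_fst
  have hKU : Prod.snd '' tsupport k ⊆ U := by
    rintro _ ⟨p, hp, rfl⟩
    exact (hs hp).2
  have h1 : Integrable ((Prod.snd '' tsupport k).indicator F) :=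
    (integrable_indicator_iff hK.measurableSet).2 (hF.integrableOn_compact_subset hKU hK)
  have h2 : Integrable ((Prod.fst '' tsupport k).indicator fun _ => (1 : ℝ)) :=
    (integrable_indicator_iff hI.measurableSet).2 (integrableOn_const hI.measure_lt_top.ne)
  obtain ⟨C, hC⟩ := hk.bounded_above_of_compact_support hc
  refine ((h2.mul_prod h1).mul_bdd hk.aestronglyMeasurable (.of_forall hC)).congr
    (.of_forall fun p => ?_)
  by_cases hp : p ∈ tsupport k
  · simp [indicator_of_mem (mem_image_of_mem Prod.snd hp),
      indicator_of_mem (mem_image_of_mem Prod.fst hp)]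
  · simp [image_eq_zero_of_notMem_tsupport hp]

lemma inv_fromBlocks_diag {A : Matrix Unit Unit ℝ} {D : Matrix (Fin 3) (Fin 3) ℝ}
    (hA : IsUnit A.det) (hD : IsUnit D.det) :
    (Matrix.fromBlocks A 0 0 D)⁻¹ = Matrix.fromBlocks A⁻¹ 0 0 D⁻¹ := by
  apply Matrix.inv_eq_right_inv
  rw [Matrix.fromBlocks_multiply]
  rw [Matrix.mul_nonsing_inv _ hA, Matrix.mul_nonsing_inv _ hD]
  simp

/-- The Maxwell density of a static potential is given by its gradient density for the optical
metric. -/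
lemma maxwellDensity_staticForm {M Q : ℝ} (h : |Q| < M) {Φ : E3 → ℝ} (α : ℝ × E3 → Idx → ℝ)
    {p : ℝ × E3} (hp : p.2 ∈ ext) (hΦ : DifferentiableAt ℝ Φ p.2) :
    maxwellDensity (rnSpacetime M Q) (staticForm Φ) α p =
      ∑ j, gradDensity (opt M Q) Φ j p.2 * extDer α p (Sum.inl ()) (Sum.inr j) := by
  set f := lapseSq M Q (radius M Q p.2) with hf
  have hfp : 0 < f := lapseSq_radius_pos h hp
  have hu : (opt M Q p.2).det ≠ 0 := fun h0 =>
    volDensity_opt_ne_zero h hp (by rw [volDensity, h0, Real.sqrt_zero])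
  have hS : pullback (toRN M Q) (rnSpatial M Q) p.2 = f • opt M Q p.2 := by
    rw [opt_eq_smul_pullback h hp, smul_smul, mul_inv_cancel₀ hfp.ne', one_smul]
  have hdet : (opt M Q p.2).det = HH M Q p.2 ^ 12 * (hyp p.2).det := by
    rw [opt_eq h hp, Matrix.det_smul, Fintype.card_fin]
    ring
  have hdpos : 0 < (opt M Q p.2).det := by
    have := HH_pos h p.2
    have := one_sub_normSq_pos (ext_subset hp)
    rw [hdet, det_hyp (ext_subset hp)]
    positivity
  have hA : (Matrix.of fun _ _ => -f : Matrix Unit Unit ℝ)⁻¹ = Matrix.of fun _ _ => -f⁻¹ := by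
    apply Matrix.inv_eq_right_inv
    ext i j
    simp [Matrix.mul_apply, hfp.ne']
  have hSi : (f • opt M Q p.2)⁻¹ = f⁻¹ • (opt M Q p.2)⁻¹ := by
    apply Matrix.inv_eq_right_inv
    rw [smul_mul_smul_comm, Matrix.mul_nonsing_inv _ (IsUnit.mk0 _ hu), mul_inv_cancel₀ hfp.ne',
      one_smul]
  have hg : rnSpacetime M Q p = Matrix.fromBlocks (Matrix.of fun _ _ => -f) 0 0
      (f • opt M Q p.2) := by rw [rnSpacetime, hS]
  have hgi : (rnSpacetime M Q p)⁻¹ = Matrix.fromBlocks (Matrix.of fun _ _ => -f⁻¹) 0 0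
      (f⁻¹ • (opt M Q p.2)⁻¹) := by
    rw [hg, inv_fromBlocks_diag, hA, hSi]
    · simp [hfp.ne']
    · rw [Matrix.det_smul]
      exact IsUnit.mk0 _ (mul_ne_zero (pow_ne_zero _ hfp.ne') hu)
  -- The factor `f²` cancels the `f⁻²` in `g^{tt} g^{ij}`; this is why a static electric field sees
  -- only the optical metric.
  have hgd : √|(rnSpacetime M Q p).det| = f ^ 2 * volDensity (opt M Q) p.2 := by
    rw [hg, Matrix.det_fromBlocks_zero₂₁, Matrix.det_smul, volDensity]
    simp only [Matrix.det_unique, Matrix.of_apply, Fintype.card_fin]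
    rw [show |-f * (f ^ 3 * (opt M Q p.2).det)| = (f ^ 2) ^ 2 * (opt M Q p.2).det by
      rw [neg_mul, abs_neg, abs_of_pos (by positivity)]
      ring, Real.sqrt_mul (by positivity), Real.sqrt_sq (by positivity)]
  have hd : HasFDerivAt (fun q : ℝ × E3 => Φ q.2)
      ((fderiv ℝ Φ p.2).comp (ContinuousLinearMap.snd ℝ ℝ E3)) p :=
    hΦ.hasFDerivAt.comp p hasFDerivAt_snd
  have x1 : extDer (staticForm Φ) p (Sum.inl ()) (Sum.inl ()) = 0 := by simp [extDer]
  have x2 : ∀ i, extDer (staticForm Φ) p (Sum.inl ()) (Sum.inr i) = -pd i Φ p.2 := fun i => by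
    simp [extDer, staticForm, dir, hd.fderiv, pd]
  have x3 : ∀ i, extDer (staticForm Φ) p (Sum.inr i) (Sum.inl ()) = pd i Φ p.2 := fun i => by
    simp [extDer, staticForm, dir, hd.fderiv, pd]
  have x4 : ∀ i j, extDer (staticForm Φ) p (Sum.inr i) (Sum.inr j) = 0 := fun i j => by
    simp [extDer, staticForm]
  have x5 : ∀ i, extDer α p (Sum.inr i) (Sum.inl ()) = -extDer α p (Sum.inl ()) (Sum.inr i) :=
    fun i => by simp [extDer]
  rw [maxwellDensity, hgd, hgi]
  simp only [Fintype.sum_sum_type, Finset.univ_unique, PUnit.default_eq_unit,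
    Finset.sum_singleton, Matrix.fromBlocks_apply₁₁, Matrix.fromBlocks_apply₁₂,
    Matrix.fromBlocks_apply₂₁, Matrix.fromBlocks_apply₂₂, Matrix.zero_apply, Matrix.of_apply,
    Matrix.smul_apply, smul_eq_mul, x1, x2, x3, x4, x5, mul_zero, zero_mul, add_zero, zero_add,
    Finset.sum_const_zero, gradDensity]
  simp only [Fin.sum_univ_three]
  field_simp
  ring

lemma contDiff_apply_idx {α : ℝ × E3 → Idx → ℝ} (hα : ContDiff ℝ ∞ α) (b : Idx) :
    ContDiff ℝ ∞ fun q => α q b := contDiff_pi.1 hα b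

lemma tsupport_fderiv_apply_idx {α : ℝ × E3 → Idx → ℝ} {p : ℝ × E3} (hp : p ∉ tsupport α)
    (b : Idx) : fderiv ℝ (fun q => α q b) p = 0 := by
  have : (fun q => α q b) =ᶠ[𝓝 p] fun _ => 0 := by
    filter_upwards [notMem_tsupport_iff_eventuallyEq.1 hp] with q hq
    simp [hq]
  rw [this.fderiv_eq]
  simp

/-- The pairing involves `∂_t α_i - ∂_i α_t`. The first term integrates to zero in time since the
field is static; at each fixed time the second is the weak Green equation tested with `α_t(t, ·)`.
-/
lemma solvesMaxwell_of_isGreen {M Q : ℝ} (h : |Q| < M) {a : E3} (ha : a ∈ ext) {Φ G : E3 → ℝ}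
    (hG : IsGreen (opt M Q) ext a G) (hp : HasPole a ext G) (hΦ : ∀ x ∈ ext, Φ x = G x) :
    SolvesMaxwellStaticCharge (rnSpacetime M Q) ext a (staticForm Φ) := by
  intro α hα hc hs
  set k : Idx → Idx → ℝ × E3 → ℝ := fun b c p => fderiv ℝ (fun q => α q b) p (dir c) with hk
  have hkc : ∀ b c, Continuous (k b c) := fun b c =>
    ((contDiff_apply_idx hα b).continuous_fderiv (by simp)).clm_apply continuous_const
  have hk0 : ∀ b c p, p ∉ tsupport α → k b c p = 0 := fun b c p hp => by
    simp [hk, tsupport_fderiv_apply_idx hp b]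
  have hks : ∀ b c, tsupport (k b c) ⊆ tsupport α := fun b c =>
    closure_minimal (fun p hp => by_contra fun hp' => hp (hk0 b c p hp')) (isClosed_tsupport α)
  have hkcs : ∀ b c, HasCompactSupport (k b c) := fun b c =>
    hc.of_isClosed_subset (isClosed_tsupport _) (hks b c)
  set F : Fin 3 → E3 → ℝ := gradDensity (opt M Q) G with hFdef
  have hF : ∀ i, LocallyIntegrableOn (F i) ext := locallyIntegrableOn_gradDensity_opt h ha hp
  have hi1 : ∀ i, Integrable fun p : ℝ × E3 => F i p.2 * k (Sum.inr i) (Sum.inl ()) p := fun i =>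
    integrable_snd_mul (hF i) (hkc _ _) (hkcs _ _) ((hks _ _).trans hs)
  have hi2 : ∀ i, Integrable fun p : ℝ × E3 => F i p.2 * k (Sum.inl ()) (Sum.inr i) p := fun i =>
    integrable_snd_mul (hF i) (hkc _ _) (hkcs _ _) ((hks _ _).trans hs)
  have hae : ∀ᵐ p : ℝ × E3, p.2 ≠ a :=
    Measure.quasiMeasurePreserving_snd.ae (ae_ne a)
  have e : (fun p : ℝ × E3 => ∑ i, (F i p.2 * k (Sum.inr i) (Sum.inl ()) p -
      F i p.2 * k (Sum.inl ()) (Sum.inr i) p)) =ᵐ[volume]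
      maxwellDensity (rnSpacetime M Q) (staticForm Φ) α := by
    filter_upwards [hae] with p hpa
    by_cases hps : p ∈ tsupport α
    · have hpe : p.2 ∈ ext := (hs hps).2
      have hev : Φ =ᶠ[𝓝 p.2] G := by
        filter_upwards [isOpen_ext.mem_nhds hpe] with y hy using hΦ y hy
      have hd : DifferentiableAt ℝ Φ p.2 := ((hp.contDiffAt (ext_subset ha) isOpen_ext hpe
        hpa).congr_of_eventuallyEq hev).differentiableAt (by simp)
      rw [maxwellDensity_staticForm h α hpe hd]
      refine Finset.sum_congr rfl fun i _ => ?_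
      rw [gradDensity_congr hev, extDer, mul_sub]
    · have : ∀ b c, extDer α p b c = 0 := fun b c => by
        simp [extDer, tsupport_fderiv_apply_idx hps]
      simp [hk0 _ _ _ hps, maxwellDensity, this]
  have hI : Integrable fun p : ℝ × E3 => ∑ i, (F i p.2 * k (Sum.inr i) (Sum.inl ()) p -
      F i p.2 * k (Sum.inl ()) (Sum.inr i) p) :=
    integrable_finsetSum _ fun i _ => (hi1 i).sub (hi2 i)
  refine ⟨hI.congr e, ?_⟩
  rw [← integral_congr_ae e]
  simp only [Finset.sum_sub_distrib]
  rw [integral_sub (integrable_finsetSum _ fun i _ => hi1 i)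
    (integrable_finsetSum _ fun i _ => hi2 i), integral_finsetSum _ fun i _ => hi1 i]
  -- For fixed `x` the field is a constant factor and the rest is a total time derivative of compact
  -- support.
  have z1 : ∀ i, ∫ p : ℝ × E3, F i p.2 * k (Sum.inr i) (Sum.inl ()) p = 0 := fun i => by
    rw [Measure.volume_eq_prod, integral_prod_symm _ (hi1 i)]
    refine integral_eq_zero_of_ae (.of_forall fun x => ?_)
    have hd : ∀ t, HasDerivAt (fun t => α (t, x) (Sum.inr i)) (k (Sum.inr i) (Sum.inl ()) (t, x)) t :=
      fun t => by
        have h1 := ((contDiff_apply_idx hα (Sum.inr i)).differentiable (by simp)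
          (t, x)).hasFDerivAt
        exact h1.comp_hasDerivAt t ((hasDerivAt_id t).prodMk (hasDerivAt_const t x))
    have hemb : Topology.IsClosedEmbedding fun t : ℝ => (t, x) :=
      .of_continuous_injective_isClosedMap (by fun_prop) (fun _ _ h => congrArg Prod.fst h)
        (isClosedMap_prodMk_right x)
    have hs1 : HasCompactSupport fun t => k (Sum.inr i) (Sum.inl ()) (t, x) :=
      (hkcs _ _).comp_isClosedEmbedding hemb
    have hs2 : HasCompactSupport fun t => α (t, x) (Sum.inr i) :=
      (hc.comp_isClosedEmbedding hemb).comp_left (g := fun v : Idx → ℝ => v (Sum.inr i)) rfl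
    have hcont : Continuous fun t => α (t, x) (Sum.inr i) :=
      continuous_iff_continuousAt.2 fun t => (hd t).continuousAt
    simp only [Pi.zero_apply]
    rw [integral_const_mul, integral_eq_zero_of_hasDerivAt_of_integrable hd
      (((hkc _ _).comp hemb.continuous).integrable_of_hasCompactSupport hs1)
      (hcont.integrable_of_hasCompactSupport hs2), mul_zero]
  simp only [z1, Finset.sum_const_zero, zero_sub, neg_neg]
  have hsum : Integrable fun p : ℝ × E3 => ∑ i, F i p.2 * k (Sum.inl ()) (Sum.inr i) p :=
    integrable_finsetSum _ fun i _ => hi2 i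
  rw [Measure.volume_eq_prod] at hsum ⊢
  rw [integral_prod _ hsum]
  refine integral_congr_ae (.of_forall fun t => ?_)
  have hemb : Topology.IsClosedEmbedding fun x : E3 => (t, x) := 
    .of_continuous_injective_isClosedMap (by fun_prop) (fun _ _ h => congrArg Prod.snd h)
      (isClosedMap_prodMk_left t)
  have hφ : ContDiff ℝ ∞ fun x => α (t, x) (Sum.inl ()) :=
    (contDiff_apply_idx hα (Sum.inl ())).comp (contDiff_const.prodMk contDiff_id)
  have hφc : HasCompactSupport fun x => α (t, x) (Sum.inl ()) :=
    (hc.comp_isClosedEmbedding hemb).comp_left (g := fun v : Idx → ℝ => v (Sum.inl ())) rfl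
  have hφs : tsupport (fun x => α (t, x) (Sum.inl ())) ⊆ ext := by
    refine (closure_minimal (t := (fun x : E3 => (t, x)) ⁻¹' tsupport α) (fun x hx => ?_)
      ((isClosed_tsupport α).preimage hemb.continuous)).trans fun x hx => (hs hx).2
    refine subset_tsupport α fun h0 => hx ?_
    simp [h0]
  have key := integral_sum_gradDensity_mul_pd h ha hG hp hφ hφc hφs
  refine Eq.trans ?_ key
  refine integral_congr_ae (.of_forall fun x => Finset.sum_congr rfl fun i _ => ?_)
  have hd : HasFDerivAt (fun x => α (t, x) (Sum.inl ()))
      ((fderiv ℝ (fun q => α q (Sum.inl ())) (t, x)).comp (ContinuousLinearMap.inr ℝ ℝ E3)) x := by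
    have h1 := ((contDiff_apply_idx hα (Sum.inl ())).differentiable (by simp) (t, x)).hasFDerivAt
    exact h1.comp x (hasFDerivAt_prodMk_right t x)
  rw [pd_eq_of_hasFDerivAt hd]
  rfl

/-! ### Flux through spheres about the centre -/

lemma contDiff_primitive {ψ : ℝ → ℝ} (hψ : ContDiff ℝ ∞ ψ) (c : ℝ) :
    ContDiff ℝ ∞ fun t => ∫ s in c..t, ψ s := by
  have hd : ∀ t, HasDerivAt (fun t => ∫ s in c..t, ψ s) (ψ t) t := fun t =>
    intervalIntegral.integral_hasDerivAt_right (hψ.continuous.intervalIntegrable _ _)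
      (hψ.continuous.stronglyMeasurableAtFilter _ _) hψ.continuous.continuousAt
  rw [contDiff_infty_iff_deriv]
  refine ⟨fun t => (hd t).differentiableAt, ?_⟩
  rwa [show deriv (fun t => ∫ s in c..t, ψ s) = ψ from funext fun t => (hd t).deriv]

lemma hasDerivAt_primitive {ψ : ℝ → ℝ} (hψ : Continuous ψ) (c t : ℝ) :
    HasDerivAt (fun t => ∫ s in c..t, ψ s) (ψ t) t :=
  intervalIntegral.integral_hasDerivAt_right (hψ.intervalIntegrable _ _)
    (hψ.stronglyMeasurableAtFilter _ _) hψ.continuousAt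

lemma norm_efield_le {a : E3} (ha : a ∈ hball) {x : E3} (hx : x ≠ a) :
    ‖efield a x‖ ≤ (√(1 - ‖a‖ ^ 2) ^ 3)⁻¹ * (1 + (‖x - a‖ ^ 2)⁻¹) := by
  have h1 := one_sub_normSq_pos ha
  have h0 := Real.sqrt_pos.2 h1
  have hn : 0 < ‖x - a‖ := norm_pos_iff.2 (sub_ne_zero.2 hx)
  have hpi := Real.pi_gt_three
  have hq := Real.sqrt_pos.2 (quad_pos ha hx)
  have hge : √(1 - ‖a‖ ^ 2) * ‖x - a‖ ≤ √(quad a x) := by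
    simpa using sqrt_quad_add_ge ha le_rfl x
  rw [efield, norm_smul, Real.norm_eq_abs, abs_div, abs_neg, abs_of_pos h1,
    abs_of_pos (by positivity)]
  calc (1 - ‖a‖ ^ 2) / (4 * Real.pi * √(quad a x) ^ 3) * ‖x - a‖
      ≤ 1 / (1 * (√(1 - ‖a‖ ^ 2) * ‖x - a‖) ^ 3) * ‖x - a‖ := by
        gcongr
        · nlinarith [sq_nonneg ‖a‖]
        · linarith
    _ = (√(1 - ‖a‖ ^ 2) ^ 3)⁻¹ * (‖x - a‖ ^ 2)⁻¹ := by field_simp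
    _ ≤ _ := by
      gcongr
      linarith

lemma measurable_efield (a : E3) (i : Fin 3) : Measurable fun x => efield a x i := by
  have hi : Continuous fun x : E3 => x i - a i := (differentiable_coord i a).continuous
  have : (fun x => efield a x i) =
      fun x => -(1 - ‖a‖ ^ 2) / (4 * Real.pi * √(quad a x) ^ 3) * (x i - a i) := by
    ext x
    simp [efield]
  rw [this]
  exact (measurable_const.div
    (((contDiff_quad a).continuous.measurable.sqrt.pow_const 3).const_mul _)).mul hi.measurable

lemma integrable_fderiv_efield {a : E3} (ha : a ∈ hball) {φ : E3 → ℝ} (hφ : ContDiff ℝ ∞ φ)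
    (hs : HasCompactSupport φ) : Integrable fun x => fderiv ℝ φ x (efield a x) := by
  simp only [fderiv_eq_sum_pd]
  refine integrable_finsetSum _ fun i _ => integrable_of_ae_le (a := a)
    (C := (√(1 - ‖a‖ ^ 2) ^ 3)⁻¹) (measurable_efield a i) (fun x hx => ?_) (contDiff_pd hφ i).continuous (hasCompactSupport_pd hs i)
  exact (PiLp.norm_apply_le (efield a x) i).trans (norm_efield_le ha hx)

lemma norm_sphere (n : Metric.sphere (0 : E3) 1) : ‖n.1‖ = 1 := by simp

lemma norm_smul_sphere {r : ℝ} (hr : 0 ≤ r) (n : Metric.sphere (0 : E3) 1) : ‖r • n.1‖ = r := by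
  rw [norm_smul, norm_sphere, mul_one, Real.norm_eq_abs, abs_of_nonneg hr]

lemma smul_sphere_ne {a : E3} {r : ℝ} (hr : ‖a‖ < r) (n : Metric.sphere (0 : E3) 1) :
    r • n.1 ≠ a := fun h => by
  have := norm_smul_sphere ((norm_nonneg a).trans hr.le) n
  rw [h] at this
  exact hr.ne this

/-- The flux tested against a weight `ψ` of the radius. The test function is `χ(|x|)` with `χ' = ψ`
and `χ(1) = 0`; its value at `a` is `-∫ ψ`. The support condition on `ψ` makes `χ(|x|)` constant
near the centre, hence smooth there. -/
lemma integral_smul_efield_flux {a : E3} (ha : a ∈ hball) {ψ : ℝ → ℝ} (hψ : ContDiff ℝ ∞ ψ)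
    (hs : tsupport ψ ⊆ Ioo ‖a‖ 1) :
    ∫ r in Ioi (0 : ℝ), ψ r * (r ^ 2 * ∫ n, inner ℝ n.1 (efield a (r • n.1)) ∂sphereMeasure) =
      -∫ r, ψ r := by
  set χ : ℝ → ℝ := fun t => ∫ s in (1 : ℝ)..t, ψ s with hχ
  have hψ0 : ∀ t, t ∉ Ioo ‖a‖ 1 → ψ t = 0 := fun t ht =>
    image_eq_zero_of_notMem_tsupport fun h => ht (hs h)
  have hχd := hasDerivAt_primitive hψ.continuous 1
  have hχa : χ ‖a‖ = -∫ r, ψ r := by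
    simp only [hχ]
    rw [intervalIntegral.integral_symm, intervalIntegral.integral_eq_integral_of_support_subset]
    exact (subset_tsupport ψ).trans (hs.trans Ioo_subset_Ioc_self)
  have hχ1 : ∀ t, 1 ≤ t → χ t = 0 := fun t ht => by
    simp only [hχ]
    rw [intervalIntegral.integral_congr (g := fun _ => 0)]
    · simp
    · intro s hs'
      rw [uIcc_of_le ht] at hs'
      exact hψ0 s fun h => (h.2.trans_le hs'.1).false
  have hφ : ContDiff ℝ ∞ fun x : E3 => χ ‖x‖ := by
    rw [contDiff_iff_contDiffAt]
    intro x
    rcases eq_or_ne x 0 with rfl | hx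
    · have h0 : (0 : ℝ) ∉ tsupport ψ := fun h => (hs h).1.not_ge (norm_nonneg a)
      obtain ⟨ε, hε, hεψ⟩ := Metric.eventually_nhds_iff.1 (notMem_tsupport_iff_eventuallyEq.1 h0)
      refine (contDiffAt_const (c := χ 0)).congr_of_eventuallyEq ?_
      filter_upwards [Metric.ball_mem_nhds (0 : E3) hε] with y hy
      have hy' : ‖y‖ < ε := by simpa using hy
      have e1 : ∫ s in (0 : ℝ)..‖y‖, ψ s = 0 := by
        rw [intervalIntegral.integral_congr (g := fun _ => 0)]
        · simp
        · intro s hs'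
          rw [uIcc_of_le (norm_nonneg y)] at hs'
          refine hεψ ?_
          rw [Real.dist_eq, sub_zero, abs_of_nonneg hs'.1]
          exact hs'.2.trans_lt hy'
      have e2 := intervalIntegral.integral_add_adjacent_intervals
        (hψ.continuous.intervalIntegrable (μ := volume) 1 0)
        (hψ.continuous.intervalIntegrable 0 ‖y‖)
      rw [e1, add_zero] at e2
      exact e2.symm
    · exact (contDiff_primitive hψ 1).contDiffAt.comp x (contDiffAt_norm ℝ hx)
  have hφc : HasCompactSupport fun x : E3 => χ ‖x‖ :=
    HasCompactSupport.intro (isCompact_closedBall (0 : E3) 1) fun x hx => hχ1 _ (by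
      simp only [mem_closedBall_zero_iff, not_le] at hx
      exact hx.le)
  have key := integral_fderiv_efield ha hφ hφc
  rw [hχa, integral_polar_symm (integrable_fderiv_efield ha hφ hφc)] at key
  rw [← key]
  refine setIntegral_congr_fun measurableSet_Ioi fun r hr => ?_
  have hr : 0 < r := hr
  rw [mul_left_comm, ← integral_const_mul]
  congr 1
  refine integral_congr_ae (.of_forall fun n => ?_)
  have hne : r • n.1 ≠ 0 := smul_sphere_ne (by simpa using hr) n
  have hd := (hχd ‖r • n.1‖).comp_hasFDerivAt (r • n.1) (hasFDerivAt_norm hne)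
  have hd' : HasFDerivAt (fun x : E3 => χ ‖x‖) _ (r • n.1) := hd
  simp only
  rw [hd'.fderiv]
  simp only [smul_apply, innerSL_apply_apply, smul_eq_mul, norm_smul_sphere hr.le,
    real_inner_smul_left]
  field_simp

/-- A function that is continuous off `a` has a continuous integral over the spheres about the
centre that enclose `a`. -/
lemma continuousOn_sphere_integral {a : E3} {k : E3 → E3 → ℝ}
    (hk : ∀ x n, x ≠ a → ContinuousAt (Function.uncurry k) (x, n)) :
    ContinuousOn (fun r : ℝ => ∫ n, k (r • n.1) n.1 ∂sphereMeasure) (Ioi ‖a‖) := by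
  rw [continuousOn_iff_continuous_domRestrict]
  have : LocallyCompactSpace (Ioi ‖a‖) := isOpen_Ioi.locallyCompactSpace
  have hc : Continuous (Function.uncurry fun (r : Ioi ‖a‖) (n : Metric.sphere (0 : E3) 1) =>
      k (r.1 • n.1) n.1) := by
    rw [continuous_iff_continuousAt]
    rintro ⟨r, n⟩
    have h1 : Continuous fun p : Ioi ‖a‖ × Metric.sphere (0 : E3) 1 =>
      (p.1.1 • p.2.1, p.2.1) := by fun_prop
    exact (hk _ n.1 (smul_sphere_ne r.2 n)).comp_of_eq (h1.continuousAt (x := (r, n))) rfl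
  have := continuous_parametric_integral_of_continuous (μ := sphereMeasure) hc isCompact_univ
  simpa using! this

lemma continuousAt_inner_efield {a : E3} (ha : a ∈ hball) (x n : E3) (hx : x ≠ a) :
    ContinuousAt (Function.uncurry fun x n => inner ℝ n (efield a x)) (x, n) :=
  continuousAt_snd.inner (((contDiffAt_efield ha hx).continuousAt).comp_of_eq continuousAt_fst rfl)

/-- The weak identity against all weights determines the flux almost everywhere, and continuity in
the radius upgrades this to every radius. -/
lemma integral_inner_efield {a : E3} (ha : a ∈ hball) {R : ℝ} (hR : ‖a‖ < R) (hR1 : R < 1) :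
    ∫ n, inner ℝ n.1 (efield a (R • n.1)) ∂sphereMeasure = -(R ^ 2)⁻¹ := by
  set I : ℝ → ℝ := fun r => ∫ n, inner ℝ n.1 (efield a (r • n.1)) ∂sphereMeasure with hI
  have hcont : ContinuousOn (fun r => r ^ 2 * I r) (Ioo ‖a‖ 1) :=
    (continuousOn_pow 2).mul ((continuousOn_sphere_integral (continuousAt_inner_efield ha)).mono
      Ioo_subset_Ioi_self)
  have hcont1 : ContinuousOn (fun r => r ^ 2 * I r + 1) (Ioo ‖a‖ 1) :=
    hcont.add continuousOn_const
  have hae := isOpen_Ioo.ae_eq_zero_of_integral_contDiff_smul_eq_zero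
    (hcont1.locallyIntegrableOn (μ := volume) measurableSet_Ioo) fun ψ hψ hψc hψs => by
      have key := integral_smul_efield_flux ha hψ hψs
      have hz : ∀ r, r ∉ Ioi (0 : ℝ) → ψ r * (r ^ 2 * I r) = 0 := fun r hr => by
        rw [image_eq_zero_of_notMem_tsupport fun h => hr ((norm_nonneg a).trans_lt (hψs h).1),
          zero_mul]
      rw [setIntegral_eq_integral_of_forall_compl_eq_zero hz] at key
      have hintg : Integrable fun r => ψ r * (r ^ 2 * I r) := by
        have hc : Continuous fun r => (r ^ 2 * I r) * ψ r := by
          rw [continuous_iff_continuousAt]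
          intro r
          by_cases hr : r ∈ tsupport ψ
          · exact (hcont.continuousAt (isOpen_Ioo.mem_nhds (hψs hr))).mul
              hψ.continuous.continuousAt
          · refine (continuousAt_const (y := (0 : ℝ))).congr ?_
            filter_upwards [notMem_tsupport_iff_eventuallyEq.1 hr] with s hs
            rw [hs]
            simp
        refine (hc.integrable_of_hasCompactSupport hψc.mul_left).congr
          (.of_forall fun r => mul_comm _ _)
      simp only [smul_eq_mul, mul_add, mul_one]
      rw [integral_add hintg (hψ.continuous.integrable_of_hasCompactSupport hψc), key]
      ring
  have hae' : (fun r => r ^ 2 * I r + 1) =ᵐ[volume.restrict (Ioo ‖a‖ 1)] fun _ => 0 := by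
    rw [Filter.EventuallyEq, ae_restrict_iff' measurableSet_Ioo]
    exact hae
  have := Measure.eqOn_open_of_ae_eq hae' isOpen_Ioo hcont1 continuousOn_const ⟨hR, hR1⟩
  have hR0 : 0 < R := (norm_nonneg a).trans_lt hR
  simp only [hI] at this
  field_simp
  linarith

/-! ### Radial derivative, spherical mean and flux of the potentials -/

lemma fderiv_coulomb_self {a : E3} (ha : a ∈ hball) {x : E3} (hx : x ∈ hball) (hxa : x ≠ a) :
    fderiv ℝ (coulomb a) x x = inner ℝ x (efield a x) := by
  rw [← sum_gradDensity_hyp_mul_self hx, inner_eq_sum]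
  exact Finset.sum_congr rfl fun i _ => by rw [gradDensity_coulomb ha hx hxa, mul_comm]

/-- The flux of the Coulomb field through a sphere that encloses the charge. -/
lemma integral_fderiv_coulomb {a : E3} (ha : a ∈ hball) {R : ℝ} (hR : ‖a‖ < R) (hR1 : R < 1) :
    ∫ n, fderiv ℝ (coulomb a) (R • n.1) n.1 ∂sphereMeasure = -(R ^ 2)⁻¹ := by
  rw [← integral_inner_efield ha hR hR1]
  have hR0 : 0 < R := (norm_nonneg a).trans_lt hR
  refine integral_congr_ae (.of_forall fun n => ?_)
  have h := fderiv_coulomb_self ha (x := R • n.1)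
    (by rw [mem_hball, norm_smul_sphere hR0.le]; exact hR1) (smul_sphere_ne hR n)
  rw [map_smul, real_inner_smul_left, smul_eq_mul] at h
  exact mul_left_cancel₀ hR0.ne' h

lemma coulomb_of_norm_eq_one {a x : E3} (ha : a ∈ hball) (hx : ‖x‖ = 1) :
    coulomb a x = 1 / (4 * Real.pi) := by
  have hy := one_sub_inner_pos ha hx.le
  rw [coulomb, quad_eq, hx, show (1 - inner ℝ a x) ^ 2 - (1 - 1 ^ 2) * (1 - ‖a‖ ^ 2) =
    (1 - inner ℝ a x) ^ 2 by ring, Real.sqrt_sq hy.le]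
  field_simp

/-- The mean of the Coulomb potential over a sphere that encloses the charge. -/
lemma integral_coulomb_sphere {a : E3} (ha : a ∈ hball) {R : ℝ} (hR : ‖a‖ < R) (hR1 : R < 1) :
    ∫ n, coulomb a (R • n.1) ∂sphereMeasure = R⁻¹ := by
  have hR0 : 0 < R := (norm_nonneg a).trans_lt hR
  have hIcc : ∀ r ∈ Icc R 1, ‖a‖ < r := fun r hr => hR.trans_le hr.1
  have hkc : ∀ x n : E3, x ≠ a →
      ContinuousAt (Function.uncurry fun x n : E3 => fderiv ℝ (coulomb a) x n) (x, n) :=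
    fun x n hx => by
      have h1 : ContinuousAt (fderiv ℝ (coulomb a)) x :=
        ((contDiffAt_coulomb ha hx).fderiv_right (m := 0) (by simp)).continuousAt
      exact (h1.comp_of_eq continuousAt_fst rfl).clm_apply continuousAt_snd
  -- The flux is integrated from `R` out to the unit sphere, where the potential is the constant
  -- `1/(4π)`. Exchanging the integrals turns the known flux `-r⁻²` into the mean.
  have hpt : ∀ n : Metric.sphere (0 : E3) 1,
      ∫ r in R..1, fderiv ℝ (coulomb a) (r • n.1) n.1 =
        1 / (4 * Real.pi) - coulomb a (R • n.1) := fun n => by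
    rw [intervalIntegral.integral_eq_sub_of_hasDerivAt (f := fun r => coulomb a (r • n.1))]
    · simp only [one_smul]
      rw [coulomb_of_norm_eq_one ha (norm_sphere n)]
    · intro r hr
      rw [uIcc_of_le hR1.le] at hr
      have h1 := ((contDiffAt_coulomb ha (smul_sphere_ne (hIcc r hr) n)).differentiableAt
        (by simp)).hasFDerivAt
      have h2 : HasDerivAt (fun t : ℝ => t • n.1) n.1 r := by
        simpa using (hasDerivAt_id r).smul_const n.1
      exact h1.comp_hasDerivAt r h2
    · refine ContinuousOn.intervalIntegrable fun r hr => ?_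
      rw [uIcc_of_le hR1.le] at hr
      have h2 : ContinuousAt (fun r : ℝ => (r • n.1, n.1)) r := by fun_prop
      exact ((hkc _ n.1 (smul_sphere_ne (hIcc r hr) n)).comp_of_eq h2 rfl).continuousWithinAt
  have hintg : Integrable (Function.uncurry fun (r : ℝ) (n : Metric.sphere (0 : E3) 1) =>
      fderiv ℝ (coulomb a) (r • n.1) n.1) ((volume.restrict (uIoc R 1)).prod sphereMeasure) := by
    rw [uIoc_of_le hR1.le, ← Measure.restrict_univ (μ := sphereMeasure), Measure.prod_restrict]
    refine IntegrableOn.mono_set (t := Icc R 1 ×ˢ univ) ?_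
      (prod_mono Ioc_subset_Icc_self subset_rfl)
    refine ContinuousOn.integrableOn_compact (isCompact_Icc.prod isCompact_univ) fun p hp => ?_
    have h2 : ContinuousAt (fun p : ℝ × Metric.sphere (0 : E3) 1 => (p.1 • p.2.1, p.2.1)) p := by
      fun_prop
    exact ((hkc _ p.2.1 (smul_sphere_ne (hIcc p.1 hp.1) p.2)).comp_of_eq h2 rfl).continuousWithinAt
  have hsw := intervalIntegral_integral_swap hintg
  simp only [hpt] at hsw
  have hcoul : Integrable (fun n : Metric.sphere (0 : E3) 1 => coulomb a (R • n.1))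
      sphereMeasure := by
    refine Continuous.integrable_of_hasCompactSupport ?_ (HasCompactSupport.of_compactSpace _)
    rw [continuous_iff_continuousAt]
    intro n
    have h2 : ContinuousAt (fun n : Metric.sphere (0 : E3) 1 => R • n.1) n := by fun_prop
    exact (contDiffAt_coulomb ha (smul_sphere_ne hR n)).continuousAt.comp_of_eq h2 rfl
  rw [integral_sub (integrable_const _) hcoul] at hsw
  have hl : ∫ r in R..1, ∫ n, fderiv ℝ (coulomb a) (r • n.1) n.1 ∂sphereMeasure =
      1 - R⁻¹ := by
    have e1 : ∫ r in R..1, ∫ n, fderiv ℝ (coulomb a) (r • n.1) n.1 ∂sphereMeasure =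
        ∫ r in R..1, -(r ^ 2)⁻¹ := by
      -- The flux formula requires `R < r < 1`, so both endpoints are discarded.
      rw [intervalIntegral.integral_of_le hR1.le, intervalIntegral.integral_of_le hR1.le,
        integral_Ioc_eq_integral_Ioo, integral_Ioc_eq_integral_Ioo]
      exact setIntegral_congr_fun measurableSet_Ioo fun r hr =>
        integral_fderiv_coulomb ha (hR.trans hr.1) hr.2
    rw [e1, intervalIntegral.integral_eq_sub_of_hasDerivAt (f := fun r => r⁻¹)]
    · simp
    · intro r hr
      rw [uIcc_of_le hR1.le] at hr
      exact hasDerivAt_inv (hR0.trans_le hr.1).ne'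
    · refine ContinuousOn.intervalIntegrable fun r hr => ?_
      rw [uIcc_of_le hR1.le] at hr
      exact (((continuousAt_id.pow 2).inv₀ (pow_pos (hR0.trans_le hr.1) 2).ne').neg).continuousWithinAt
  rw [hl] at hsw
  simp only [integral_const, sphereMeasure_real_univ, smul_eq_mul] at hsw
  have hpi := Real.pi_pos
  rw [mul_one_div_cancel (by positivity)] at hsw
  linarith

lemma hasFDerivAt_HH (M Q : ℝ) {x : E3} (hx : x ≠ 0) :
    HasFDerivAt (HH M Q) (-(mu M Q / ‖x‖ ^ 3 / √(mu M Q)) • innerSL ℝ x) x := by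
  rw [show HH M Q = fun y => radius M Q y * (√(mu M Q))⁻¹ from
    funext fun y => by rw [HH_eq, div_eq_mul_inv]]
  refine ((hasFDerivAt_radius M Q hx).mul_const _).congr_fderiv
    (ContinuousLinearMap.ext fun v => ?_)
  simp
  ring

/-- The flux of a member of the family through a sphere that encloses the charge. -/
lemma flux_coulombFamily {M Q : ℝ} (h : |Q| < M) {a : E3} (ha : a ∈ ext) (A B : ℝ) {R : ℝ}
    (hR : ‖a‖ < R) (hR1 : R < 1) :
    flux (opt M Q) (coulombFamily M Q a A B) R =
      (4 * Real.pi * mu M Q * A - M) / (HH M Q a * √(mu M Q)) := by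
  have hb := ext_subset ha
  have hm := mu_pos h
  have hsm := Real.sqrt_pos.2 hm
  have hHa := HH_pos h a
  have hR0 : 0 < R := (norm_nonneg a).trans_lt hR
  have hpi := Real.pi_pos
  have hsq : √(mu M Q) ^ 2 = mu M Q := Real.sq_sqrt hm.le
  -- Here `H² d((W + A)/(H H(a))) = (H dW - (W + A) dH)/H(a)` with `W = coulomb a`, and the radial
  -- derivative of `H` at radius `R` is `-√μ/R²`.
  have key : ∀ n : Metric.sphere (0 : E3) 1,
      (∑ i, gradDensity (opt M Q) (coulombFamily M Q a A B) i (R • n.1) * n.1 i) * R ^ 2 =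
      ((M + mu M Q / R) / √(mu M Q) / HH M Q a * R ^ 2) * fderiv ℝ (coulomb a) (R • n.1) n.1 +
        (√(mu M Q) / HH M Q a) * coulomb a (R • n.1) + √(mu M Q) / HH M Q a * A := by
    intro n
    have hnx := norm_smul_sphere hR0.le n
    have hx0 : R • n.1 ≠ 0 := smul_sphere_ne (by simpa using hR0) n
    have hxb : R • n.1 ∈ hball := by rw [mem_hball, hnx]; exact hR1
    have hxe : R • n.1 ∈ ext := ⟨hxb, hx0⟩
    have hxa := smul_sphere_ne hR n
    have hd1 := hasFDerivAt_coulomb hb hxa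
    have hd2 := hasFDerivAt_HH M Q hx0
    have hHx := HH_pos h (R • n.1)
    have hd3 := (hasDerivAt_inv hHx.ne').comp_hasFDerivAt _ hd2
    have hd4 := ((((hd1.add_const A).mul hd3).mul_const (HH M Q a)⁻¹).add_const B)
    have e : coulombFamily M Q a A B = fun y => ((fun y => coulomb a y + A) *
        ((fun y => y⁻¹) ∘ HH M Q)) y * (HH M Q a)⁻¹ + B := by
      ext y
      simp [coulombFamily]
      ring
    rw [← e] at hd4
    have hself := sum_gradDensity_hyp_mul_self hxb (coulombFamily M Q a A B)
    rw [map_smul] at hself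
    have hsum : ∑ i, gradDensity hyp (coulombFamily M Q a A B) i (R • n.1) * n.1 i =
        fderiv ℝ (coulombFamily M Q a A B) (R • n.1) n.1 := by
      apply mul_left_cancel₀ hR0.ne'
      rw [← smul_eq_mul R (fderiv ℝ _ _ _), ← hself, Finset.mul_sum]
      exact Finset.sum_congr rfl fun i _ => by
        rw [PiLp.smul_apply, smul_eq_mul]
        ring
    have hHv : HH M Q (R • n.1) = (M + mu M Q / R) / √(mu M Q) := by
      rw [HH_eq, radius, hnx]
    simp only [gradDensity_opt h hxe, mul_assoc, ← Finset.mul_sum, hsum]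
    rw [hd4.fderiv, hd1.fderiv]
    simp only [smul_apply, add_apply, smul_eq_mul, hnx, sub_apply, innerSL_apply_apply,
      real_inner_smul_left, real_inner_self_eq_norm_sq, norm_sphere, Function.comp_apply]
    rw [← hHv]
    generalize hgH : HH M Q (R • n.1) = Hx at *
    nth_rw 1 [← hsq]
    field_simp
    ring
  -- A non-integrable function would have integral `0`, contradicting the value `R⁻¹`.
  have i1 : Integrable (fun n : Metric.sphere (0 : E3) 1 => coulomb a (R • n.1))
      sphereMeasure := by
    by_contra hni
    have := integral_coulomb_sphere hb hR hR1
    rw [integral_undef hni] at this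
    exact (inv_pos.2 hR0).ne this
  have i2 : Integrable (fun n : Metric.sphere (0 : E3) 1 =>
      fderiv ℝ (coulomb a) (R • n.1) n.1) sphereMeasure := by
    by_contra hni
    have := integral_fderiv_coulomb hb hR hR1
    rw [integral_undef hni] at this
    have h2 : 0 < (R ^ 2)⁻¹ := by positivity
    linarith
  -- The radius cancels in the sum, because `-H + √μ/R = -M/√μ` on the sphere of radius `R`.
  rw [flux]
  simp only [key]
  rw [integral_add (by exact (i2.const_mul _).add (i1.const_mul _)) (integrable_const _),
    integral_add (i2.const_mul _) (i1.const_mul _), integral_const_mul, integral_const_mul,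
    integral_fderiv_coulomb hb hR hR1, integral_coulomb_sphere hb hR hR1, integral_const,
    sphereMeasure_real_univ, smul_eq_mul]
  field_simp
  rw [hsq]
  ring

/-! ### Functions of the Coulomb potential as test functions -/

/-- The inequality says `quad a x < (1 - a·x)²`, that is `(1 - |x|²)(1 - |a|²) > 0`. It confines
functions supported on superlevel sets of the potential to the ball. -/
lemma one_div_four_pi_lt {a x : E3} (ha : a ∈ hball) (hx : 1 / (4 * Real.pi) < coulomb a x) :
    x ∈ hball ∧ x ≠ a := by
  have hpi := Real.pi_pos
  have hxa : x ≠ a := by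
    rintro rfl
    -- At the pole the formula divides by zero and takes the value `0`, so the pole is excluded by
    -- the hypothesis.
    have : coulomb x x = 0 := by simp [coulomb, quad]
    rw [this] at hx
    exact absurd hx (not_lt.2 (by positivity))
  refine ⟨?_, hxa⟩
  have hq := quad_pos ha hxa
  have hs := Real.sqrt_pos.2 hq
  have h1 := one_sub_normSq_pos ha
  rw [coulomb, div_lt_div_iff₀ (by positivity) (by positivity)] at hx
  have h2 : √(quad a x) < 1 - inner ℝ a x := by nlinarith
  have h3 : quad a x < (1 - inner ℝ a x) ^ 2 := by
    nlinarith [Real.sq_sqrt hq.le]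
  rw [quad_eq] at h3
  rw [mem_hball]
  have h4 : 0 < 1 - ‖x‖ ^ 2 := by
    by_contra hcon
    push Not at hcon
    nlinarith
  nlinarith [norm_nonneg x]

lemma coulomb_gt_of_near {a : E3} (ha : a ∈ hball) (K : ℝ) :
    ∀ᶠ x in 𝓝[≠] a, K < coulomb a x := by
  have hpi := Real.pi_pos
  have h1 : Tendsto (fun x => √(quad a x)) (𝓝[≠] a) (𝓝[>] 0) := by
    rw [tendsto_nhdsWithin_iff]
    constructor
    · have : ContinuousAt (fun x => √(quad a x)) a :=
        (contDiff_quad a).continuous.sqrt.continuousAt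
      have h := this.tendsto
      rw [show √(quad a a) = 0 by simp [quad]] at h
      exact h.mono_left nhdsWithin_le_nhds
    · filter_upwards [self_mem_nhdsWithin] with x hx
      exact Real.sqrt_pos.2 (quad_pos ha hx)
  have h2 : Tendsto (fun x => (1 - inner ℝ a x) / (4 * Real.pi)) (𝓝[≠] a)
      (𝓝 ((1 - inner ℝ a a) / (4 * Real.pi))) :=
    (((contDiff_one_sub_inner a).continuous.div_const _).tendsto a).mono_left nhdsWithin_le_nhds
  have h3 : 0 < (1 - inner ℝ a a) / (4 * Real.pi) := by
    rw [real_inner_self_eq_norm_sq]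
    exact div_pos (one_sub_normSq_pos ha) (by positivity)
  have h4 := (h2.pos_mul_atTop h3 h1.inv_tendsto_nhdsGT_zero).eventually_gt_atTop K
  filter_upwards [h4] with x hx
  rw [coulomb, div_mul_eq_div_div, div_eq_mul_inv _ √_]
  exact hx

/-- The function `∫_c^W g` of the Coulomb potential `W`, with the value at the pole filled in. -/
def coulombPrimitive (a : E3) (g : ℝ → ℝ) (c K : ℝ) : E3 → ℝ :=
  Function.update (fun x => ∫ s in c..coulomb a x, g s) a (∫ s in c..K, g s)

section Primitive

variable {a : E3} {g : ℝ → ℝ} {c K : ℝ}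

lemma coulombPrimitive_of_ne {x : E3} (hx : x ≠ a) :
    coulombPrimitive a g c K x = ∫ s in c..coulomb a x, g s := by
  rw [coulombPrimitive, Function.update_of_ne hx]

lemma coulombPrimitive_self : coulombPrimitive a g c K a = ∫ s in c..K, g s := by
  rw [coulombPrimitive, Function.update_self]

/-- The potential exceeds `K` near its pole, and beyond `K` the primitive no longer changes. Hence
the function is smooth across the pole. -/
lemma coulombPrimitive_eventuallyEq (ha : a ∈ hball) (hg : Continuous g)
    (hgK : ∀ t, K ≤ t → g t = 0) :
    coulombPrimitive a g c K =ᶠ[𝓝 a] fun _ => ∫ s in c..K, g s := by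
  have h := eventually_nhdsWithin_iff.1 (coulomb_gt_of_near ha K)
  filter_upwards [h] with x hx
  by_cases hxa : x = a
  · rw [hxa, coulombPrimitive_self]
  · rw [coulombPrimitive_of_ne hxa, ← intervalIntegral.integral_add_adjacent_intervals
      (hg.intervalIntegrable c K) (hg.intervalIntegrable K _),
      intervalIntegral.integral_congr (g := fun _ => 0) (a := K)]
    · simp
    · intro s hs
      rw [uIcc_of_le (hx hxa).le] at hs
      exact hgK s hs.1

lemma hasFDerivAt_coulombPrimitive (ha : a ∈ hball) (hg : Continuous g) {x : E3} (hx : x ≠ a) :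
    HasFDerivAt (coulombPrimitive a g c K) (g (coulomb a x) • fderiv ℝ (coulomb a) x) x := by
  have h1 := ((contDiffAt_coulomb ha hx).differentiableAt (by simp)).hasFDerivAt
  have h2 := (hasDerivAt_primitive hg c (coulomb a x)).comp_hasFDerivAt x h1
  refine h2.congr_of_eventuallyEq ?_
  filter_upwards [isOpen_ne.mem_nhds hx] with y hy using coulombPrimitive_of_ne hy

lemma contDiff_coulombPrimitive (ha : a ∈ hball) (hg : ContDiff ℝ ∞ g)
    (hgK : ∀ t, K ≤ t → g t = 0) : ContDiff ℝ ∞ (coulombPrimitive a g c K) := by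
  rw [contDiff_iff_contDiffAt]
  intro x
  by_cases hx : x = a
  · rw [hx]
    exact contDiffAt_const.congr_of_eventuallyEq
      (coulombPrimitive_eventuallyEq ha hg.continuous hgK)
  · refine ((contDiff_primitive hg c).contDiffAt.comp x
      (contDiffAt_coulomb ha hx)).congr_of_eventuallyEq ?_
    filter_upwards [isOpen_ne.mem_nhds hx] with y hy using coulombPrimitive_of_ne hy

lemma tsupport_coulombPrimitive (ha : a ∈ hball) (hc : 1 / (4 * Real.pi) < c)
    (hgc : ∀ t, t ≤ c → g t = 0) : tsupport (coulombPrimitive a g c K) ⊆ hball := by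
  intro x hx
  by_contra hxb
  have hxa : x ≠ a := fun h => hxb (h ▸ ha)
  have hle : coulomb a x < c :=
    (not_lt.1 fun h => hxb (one_div_four_pi_lt ha h).1).trans_lt hc
  refine notMem_tsupport_iff_eventuallyEq.2 ?_ hx
  filter_upwards [isOpen_ne.mem_nhds hxa,
    (contDiffAt_coulomb ha hxa).continuousAt.eventually_lt_const hle] with y hy hyc
  rw [coulombPrimitive_of_ne hy, intervalIntegral.integral_congr (g := fun _ => 0)]
  · simp
  · intro s hs
    rw [uIcc_of_ge hyc.le] at hs
    exact hgc s hs.2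

lemma hasCompactSupport_of_tsupport_subset_hball {f : E3 → ℝ} (h : tsupport f ⊆ hball) :
    HasCompactSupport f :=
  (isCompact_closedBall (0 : E3) 1).of_isClosed_subset (isClosed_tsupport f)
    (h.trans Metric.ball_subset_closedBall)

lemma gradDensity_of_pd_eq {m : E3 → Matrix (Fin 3) (Fin 3) ℝ} {f₁ f₂ : E3 → ℝ} {x : E3} {k : ℝ}
    (h : ∀ j, pd j f₁ x = k * pd j f₂ x) (i : Fin 3) :
    gradDensity m f₁ i x = k * gradDensity m f₂ i x := by
  simp only [gradDensity, h, Finset.mul_sum]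
  exact Finset.sum_congr rfl fun j _ => by ring

lemma gradDensity_coulombPrimitive (ha : a ∈ hball) (hg : Continuous g) {x : E3} (hx : x ∈ hball)
    (hxa : x ≠ a) (i : Fin 3) :
    gradDensity hyp (coulombPrimitive a g c K) i x = g (coulomb a x) * efield a x i := by
  rw [← gradDensity_coulomb ha hx hxa]
  refine gradDensity_of_pd_eq (fun j => ?_) i
  rw [pd, (hasFDerivAt_coulombPrimitive ha hg hxa).fderiv]
  rfl

/-- The gradient density is `g(W)` times the field with `W = coulomb a`, and the field is
divergence-free, so only the derivative of `g(W)` along the field survives. -/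
lemma lapDensity_coulombPrimitive (ha : a ∈ hball) {g' : ℝ → ℝ} (hg : ∀ t, HasDerivAt g (g' t) t)
    {x : E3} (hx : x ∈ hball) (hxa : x ≠ a) :
    lapDensity hyp (coulombPrimitive a g c K) x =
      g' (coulomb a x) * fderiv ℝ (coulomb a) x (efield a x) := by
  have hgc : Continuous g := continuous_iff_continuousAt.2 fun t => (hg t).continuousAt
  have h1 := ((contDiffAt_coulomb ha hxa).differentiableAt (by simp)).hasFDerivAt
  have h2 : HasFDerivAt (fun y => g (coulomb a y)) (g' (coulomb a x) • fderiv ℝ (coulomb a) x) x :=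
    (hg _).comp_hasFDerivAt x h1
  have hE : ∀ i, DifferentiableAt ℝ (fun y => efield a y i) x := fun i =>
    (((EuclideanSpace.proj (𝕜 := ℝ) i).contDiff.contDiffAt).comp x
      (contDiffAt_efield ha hxa)).differentiableAt (by simp)
  have e : ∀ i, pd i (gradDensity hyp (coulombPrimitive a g c K) i) x =
      g (coulomb a x) * pd i (fun y => efield a y i) x +
        efield a x i * pd i (fun y => g (coulomb a y)) x := fun i => by
    rw [← pd_mul h2.differentiableAt (hE i)]
    refine pd_congr ?_ i
    filter_upwards [isOpen_ne.mem_nhds hxa, isOpen_hball.mem_nhds hx] with y hy hyb using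
      gradDensity_coulombPrimitive ha hgc hyb hy i
  simp only [lapDensity, e]
  rw [Finset.sum_add_distrib, ← Finset.mul_sum, sum_pd_efield ha hxa, mul_zero, zero_add,
    ← fderiv_eq_sum_pd, h2.fderiv]
  rfl

end Primitive

/-- This is the energy density of the potential; positivity is Cauchy–Schwarz for `x` and the
gradient, with `|x| < 1`. -/
lemma fderiv_coulomb_efield_nonneg {a x : E3} (ha : a ∈ hball) (hx : x ∈ hball) (hxa : x ≠ a) :
    0 ≤ fderiv ℝ (coulomb a) x (efield a x) := by
  have h1 := one_sub_normSq_pos hx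
  have e : fderiv ℝ (coulomb a) x (efield a x) =
      (1 - ‖x‖ ^ 2)⁻¹ * (∑ i, pd i (coulomb a) x ^ 2 - (∑ i, x i * pd i (coulomb a) x) ^ 2) := by
    rw [fderiv_eq_sum_pd]
    simp only [← gradDensity_coulomb ha hx hxa, gradDensity_hyp hx]
    rw [fderiv_eq_sum_pd]
    simp only [Fin.sum_univ_three]
    ring
  rw [e]
  refine mul_nonneg (inv_nonneg.2 h1.le) (sub_nonneg.2 ?_)
  refine (Finset.sum_mul_sq_le_sq_mul_sq _ _ _).trans ?_
  simp only [pow_two (x _)]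
  rw [← normSq_eq_sum]
  exact mul_le_of_le_one_left (Finset.sum_nonneg fun i _ => sq_nonneg _) (by linarith)

/-! ### Uniqueness of weakly harmonic functions -/

lemma LocallyIntegrableOn.integrable_mul_of_tsupport {U : Set E3} {u m : E3 → ℝ}
    (hu : LocallyIntegrableOn u U) (hm : Continuous m) (hmc : HasCompactSupport m)
    (hms : tsupport m ⊆ U) : Integrable fun x => u x * m x := by
  have h1 := (hu.integrableOn_compact_subset hms hmc).mul_continuousOn hm.continuousOn hmc
  refine (integrableOn_iff_integrable_of_support_subset fun x hx => subset_tsupport m ?_).1 h1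
  exact right_ne_zero_of_mul hx

/-- The radial averaging kernel `g(W) ⟨dW, dW⟩` is continuous with compact support. -/
lemma exists_coulomb_kernel {a : E3} (ha : a ∈ hball) {g : ℝ → ℝ} {c K : ℝ}
    (hc : 1 / (4 * Real.pi) < c) (hg : ContDiff ℝ ∞ g) (hgc : ∀ t, t ≤ c → g t = 0)
    (hgK : ∀ t, K ≤ t → g t = 0) (hpos : ∀ t, 0 ≤ g t) (hintg : ∫ s in c..K, g s = 1) :
    ∃ m : E3 → ℝ, Continuous m ∧ HasCompactSupport m ∧ tsupport m ⊆ hball ∧ (∀ x, 0 ≤ m x) ∧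
      ∫ x, m x = 1 ∧ (∀ x, m x ≠ 0 → x ∈ hball ∧ c < coulomb a x ∧ coulomb a x < K) ∧
      ∀ x, x ≠ a → m x = g (coulomb a x) * fderiv ℝ (coulomb a) x (efield a x) := by
  set φ := coulombPrimitive a g c K with hφdef
  have hφ : ContDiff ℝ ∞ φ := contDiff_coulombPrimitive ha hg hgK
  have hφs : tsupport φ ⊆ hball := tsupport_coulombPrimitive ha hc hgc
  have hφc := hasCompactSupport_of_tsupport_subset_hball hφs
  have hm : ∀ x, x ≠ a → fderiv ℝ φ x (efield a x) =
      g (coulomb a x) * fderiv ℝ (coulomb a) x (efield a x) := fun x hx => by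
    rw [(hasFDerivAt_coulombPrimitive ha hg.continuous hx).fderiv]
    rfl
  -- The kernel vanishes near the pole, which makes it continuous there although the field is
  -- singular.
  have ha0 : ∀ᶠ x in 𝓝 a, fderiv ℝ φ x = 0 := by
    filter_upwards [(coulombPrimitive_eventuallyEq (c := c) ha hg.continuous
      hgK).eventuallyEq_nhds] with x hx
    rw [hx.fderiv_eq]
    simp
  have hzero : ∀ x, x ∉ tsupport φ → fderiv ℝ φ x (efield a x) = 0 := fun x hx => by
    rw [fderiv_eq_zero_of_notMem hx]
    rfl
  have hne : ∀ x, fderiv ℝ φ x (efield a x) ≠ 0 → x ≠ a ∧ g (coulomb a x) ≠ 0 := by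
    intro x hx
    have hxa : x ≠ a := by
      rintro rfl
      rw [ha0.self_of_nhds] at hx
      exact hx rfl
    rw [hm x hxa] at hx
    exact ⟨hxa, left_ne_zero_of_mul hx⟩
  have hsupp : ∀ x, fderiv ℝ φ x (efield a x) ≠ 0 →
      x ∈ hball ∧ c < coulomb a x ∧ coulomb a x < K := by
    intro x hx
    have h1 : c < coulomb a x := not_le.1 fun h => (hne x hx).2 (hgc _ h)
    exact ⟨(one_div_four_pi_lt ha (hc.trans h1)).1, h1, not_le.1 fun h => (hne x hx).2 (hgK _ h)⟩
  refine ⟨fun x => fderiv ℝ φ x (efield a x), ?_, hasCompactSupport_of_eq_zero hφc hzero,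
    (tsupport_subset_of_eq_zero hzero).trans hφs, fun x => ?_, ?_, hsupp, hm⟩
  · rw [continuous_iff_continuousAt]
    intro x
    by_cases hx : x = a
    · rw [hx]
      refine (continuousAt_const (y := (0 : ℝ))).congr ?_
      filter_upwards [ha0] with y hy
      rw [hy]
      rfl
    · exact (hφ.continuous_fderiv (by simp)).continuousAt.clm_apply
        (contDiffAt_efield ha hx).continuousAt
  · by_cases hx : fderiv ℝ φ x (efield a x) = 0
    · exact hx.ge
    · simp only [hm x (hne x hx).1]
      exact mul_nonneg (hpos _) (fderiv_coulomb_efield_nonneg ha (hsupp x hx).1 (hne x hx).1)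
  -- The total mass is the value of the primitive at the charge, namely the integral of `g`.
  · rw [integral_fderiv_efield ha hφ hφc, hφdef, coulombPrimitive_self, hintg]

/-! ### Location of the level sets of the potential and the mean value argument -/

lemma exists_bump_Ioo {c K : ℝ} (h : c < K) : ∃ g : ℝ → ℝ, ContDiff ℝ ∞ g ∧
    (∀ t, t ≤ c → g t = 0) ∧ (∀ t, K ≤ t → g t = 0) ∧ (∀ t, 0 ≤ g t) ∧ ∫ s, g s = 1 := by
  let b : ContDiffBump ((c + K) / 2) := ⟨(K - c) / 4, (K - c) / 2, by linarith, by linarith⟩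
  have hz : ∀ t, t ∉ Metric.ball ((c + K) / 2) ((K - c) / 2) → b.normed volume t = 0 := by
    intro t ht
    by_contra hne
    have : t ∈ Function.support (b.normed volume) := hne
    rw [b.support_normed_eq] at this
    exact ht this
  refine ⟨b.normed volume, b.contDiff_normed, fun t ht => hz t fun hb => ?_,
    fun t ht => hz t fun hb => ?_, fun t => b.nonneg_normed t, b.integral_normed⟩ <;>
  · rw [Metric.mem_ball, Real.dist_eq, abs_lt] at hb
    linarith [hb.1, hb.2]

lemma intervalIntegral_eq_integral {g : ℝ → ℝ} {c K : ℝ} (hgc : ∀ t, t ≤ c → g t = 0) (hgK : ∀ t, K ≤ t → g t = 0) :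
    ∫ s in c..K, g s = ∫ s, g s :=
  intervalIntegral.integral_eq_integral_of_support_subset fun t ht =>
    ⟨not_le.1 fun h => ht (hgc t h), (not_le.1 fun h => ht (hgK t h)).le⟩

/-- If the potential is below `√k/(4π)`, then `(1 - a·x)² < k q` with `q = quad a x`, so `(1 -
|x|²)(1 - |a|²) < (k - 1) q ≤ 4 (k - 1)`. The choice of `k` makes the right side `δ (1 - |a|²)`. -/
lemma coulomb_lt_imp_near_boundary {a : E3} (ha : a ∈ hball) {δ : ℝ} (hδ : 0 < δ) :
    ∃ c, 1 / (4 * Real.pi) < c ∧ ∀ x ∈ hball, 1 / (4 * Real.pi) < coulomb a x →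
      coulomb a x < c → 1 - ‖x‖ ^ 2 < δ := by
  have hpi := Real.pi_pos
  have hσ := one_sub_normSq_pos ha
  set k := 1 + δ * (1 - ‖a‖ ^ 2) / 4 with hk
  have hk1 : 1 < k := by
    rw [hk]
    have : 0 < δ * (1 - ‖a‖ ^ 2) / 4 := by positivity
    linarith
  refine ⟨√k / (4 * Real.pi), ?_, fun x hx hx1 hx2 => ?_⟩
  · gcongr
    exact Real.lt_sqrt_of_sq_lt (by simpa using hk1)
  · have hxa := (one_div_four_pi_lt ha hx1).2
    have hq := quad_pos ha hxa
    have hs := Real.sqrt_pos.2 hq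
    have hy := one_sub_inner_pos ha (mem_hball.1 hx).le
    rw [coulomb, div_mul_eq_div_div, div_right_comm, div_lt_div_iff_of_pos_right (by positivity),
      div_lt_iff₀ hs, ← Real.sqrt_mul (by linarith)] at hx2
    have h3 : (1 - inner ℝ a x) ^ 2 < k * quad a x := (Real.lt_sqrt hy.le).1 hx2
    have h4 : |inner ℝ a x| ≤ ‖a‖ * ‖x‖ := abs_real_inner_le_norm a x
    have h5 : ‖a‖ * ‖x‖ ≤ 1 := by
      have := mem_hball.1 ha
      have := mem_hball.1 hx
      nlinarith [norm_nonneg a, norm_nonneg x]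
    have h6 : (1 - inner ℝ a x) ^ 2 ≤ 4 := by
      have := abs_le.1 (h4.trans h5)
      nlinarith
    have h7 := one_sub_normSq_pos hx
    have h8 : quad a x ≤ 4 := by
      rw [quad_eq]
      nlinarith [mul_pos h7 hσ]
    have h9 : quad a x = (1 - inner ℝ a x) ^ 2 - (1 - ‖x‖ ^ 2) * (1 - ‖a‖ ^ 2) := quad_eq a x
    have h10 : (1 - ‖x‖ ^ 2) * (1 - ‖a‖ ^ 2) < (δ * (1 - ‖a‖ ^ 2) / 4) * quad a x := by
      rw [hk] at h3
      nlinarith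
    have h11 : (δ * (1 - ‖a‖ ^ 2) / 4) * quad a x ≤ δ * (1 - ‖a‖ ^ 2) := by
      nlinarith [mul_pos hδ hσ]
    exact lt_of_mul_lt_mul_right (h10.trans_le h11) hσ.le

lemma coulomb_gt_imp_near {a : E3} (ha : a ∈ hball) {δ : ℝ} (hδ : 0 < δ) :
    ∃ c, 1 / (4 * Real.pi) < c ∧ ∀ x, c < coulomb a x → ‖x - a‖ < δ := by
  have hpi := Real.pi_pos
  have hσ := Real.sqrt_pos.2 (one_sub_normSq_pos ha)
  refine ⟨1 / (4 * Real.pi) + 2 / (4 * Real.pi * (√(1 - ‖a‖ ^ 2) * δ)), ?_, fun x hx => ?_⟩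
  · have : 0 < 2 / (4 * Real.pi * (√(1 - ‖a‖ ^ 2) * δ)) := by positivity
    linarith
  · have h0 : 0 < 2 / (4 * Real.pi * (√(1 - ‖a‖ ^ 2) * δ)) := by positivity
    have h1 : 0 < 1 / (4 * Real.pi) := by positivity
    obtain ⟨hxb, hxa⟩ := one_div_four_pi_lt ha (x := x) (by linarith)
    have hs := Real.sqrt_pos.2 (quad_pos ha hxa)
    have hx' : 2 / (4 * Real.pi * (√(1 - ‖a‖ ^ 2) * δ)) < coulomb a x := by linarith
    have h4 : |inner ℝ a x| ≤ ‖a‖ * ‖x‖ := abs_real_inner_le_norm a x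
    have h5 : ‖a‖ * ‖x‖ ≤ 1 := by
      have := mem_hball.1 ha
      have := mem_hball.1 hxb
      nlinarith [norm_nonneg a, norm_nonneg x]
    have h6 : 1 - inner ℝ a x ≤ 2 := by
      have := abs_le.1 (h4.trans h5)
      linarith
    have hge : √(1 - ‖a‖ ^ 2) * ‖x - a‖ ≤ √(quad a x) := by
      simpa using sqrt_quad_add_ge ha le_rfl x
    rw [coulomb, div_lt_div_iff₀ (by positivity) (by positivity)] at hx'
    by_contra hcon
    push Not at hcon
    have h7 : √(1 - ‖a‖ ^ 2) * δ ≤ √(quad a x) := (by gcongr : _ ≤ _).trans hge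
    have h8 : (1 - inner ℝ a x) * (4 * Real.pi * (√(1 - ‖a‖ ^ 2) * δ)) ≤
        2 * (4 * Real.pi * √(quad a x)) := by gcongr
    linarith

/-- A weakly harmonic function on the hyperbolic ball that tends to zero at infinity vanishes
wherever it is continuous. -/
theorem eq_zero_of_weakly_harmonic {u : E3 → ℝ} (hu : LocallyIntegrableOn u hball)
    (hL : ∀ φ : E3 → ℝ, ContDiff ℝ ∞ φ → HasCompactSupport φ → tsupport φ ⊆ hball →
      ∫ x, u x * lapDensity hyp φ x = 0)
    (hb : ∀ ε > 0, ∃ δ > 0, ∀ x ∈ hball, 1 - ‖x‖ ^ 2 < δ → |u x| ≤ ε)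
    {a : E3} (ha : a ∈ hball) (hc : ContinuousAt u a) : u a = 0 := by
  by_contra hne
  set ε := |u a| / 3 with hεdef
  have hε : 0 < ε := by
    have := abs_pos.2 hne
    positivity
  obtain ⟨δ₁, hδ₁, h₁⟩ := Metric.continuousAt_iff.1 hc ε hε
  obtain ⟨δ₂, hδ₂, h₂⟩ := hb ε hε
  obtain ⟨c₁, hc₁, hn₁⟩ := coulomb_gt_imp_near ha hδ₁
  obtain ⟨K₂, hK₂, hn₂⟩ := coulomb_lt_imp_near_boundary ha hδ₂
  -- The outer shell is cut out by values of the potential between `c₂` and `K₂`, both strictly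
  -- above the boundary value.
  set c₂ := (1 / (4 * Real.pi) + K₂) / 2 with hc₂def
  have hc₂ : 1 / (4 * Real.pi) < c₂ := by rw [hc₂def]; linarith
  have hcK : c₂ < K₂ := by rw [hc₂def]; linarith
  obtain ⟨g₁, hg₁, hg₁c, hg₁K, hg₁p, hg₁i⟩ := exists_bump_Ioo (lt_add_one c₁)
  obtain ⟨g₂, hg₂, hg₂c, hg₂K, hg₂p, hg₂i⟩ := exists_bump_Ioo hcK
  obtain ⟨m₁, hm₁, hm₁c, hm₁s, hm₁p, hm₁i, hm₁n, hm₁e⟩ := exists_coulomb_kernel ha hc₁ hg₁ hg₁c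
    hg₁K hg₁p (by rw [intervalIntegral_eq_integral hg₁c hg₁K, hg₁i])
  obtain ⟨m₂, hm₂, hm₂c, hm₂s, hm₂p, hm₂i, hm₂n, hm₂e⟩ := exists_coulomb_kernel ha hc₂ hg₂ hg₂c
    hg₂K hg₂p (by rw [intervalIntegral_eq_integral hg₂c hg₂K, hg₂i])
  set c := min c₁ c₂ with hcdef
  set K := max (c₁ + 1) K₂ with hKdef
  have hcle : c ≤ K := (min_le_right _ _).trans (hcK.le.trans (le_max_right _ _))
  have hgd : ContDiff ℝ ∞ fun t => g₁ t - g₂ t := hg₁.sub hg₂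
  -- The weights `g₁` and `g₂` have equal mass, so `ζ` vanishes outside `[c, K]` and its primitive
  -- is an admissible function of the potential. Its Laplacian is `m₁ - m₂`, whence the two averages
  -- of `u` agree.
  set ζ : ℝ → ℝ := fun t => ∫ s in c..t, (g₁ s - g₂ s) with hζdef
  have hζd : ∀ t, HasDerivAt ζ (g₁ t - g₂ t) t := hasDerivAt_primitive hgd.continuous c
  have hζ : ContDiff ℝ ∞ ζ := contDiff_primitive hgd c
  have z₁ : ∀ t, t ≤ c → g₁ t - g₂ t = 0 := fun t ht => by
    rw [hg₁c t (ht.trans (min_le_left _ _)), hg₂c t (ht.trans (min_le_right _ _)), sub_zero]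
  have z₂ : ∀ t, K ≤ t → g₁ t - g₂ t = 0 := fun t ht => by
    rw [hg₁K t ((le_max_left _ _).trans ht), hg₂K t ((le_max_right _ _).trans ht), sub_zero]
  have hζc : ∀ t, t ≤ c → ζ t = 0 := fun t ht => by
    simp only [hζdef]
    rw [intervalIntegral.integral_congr (g := fun _ => 0)]
    · simp
    · intro s hs
      rw [uIcc_of_ge ht] at hs
      exact z₁ s hs.2
  have hζK : ∀ t, K ≤ t → ζ t = 0 := fun t ht => by
    simp only [hζdef]
    rw [intervalIntegral_eq_integral z₁ fun s hs => z₂ s (ht.trans hs),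
      integral_sub, hg₁i, hg₂i, sub_self]
    · by_contra hni
      rw [integral_undef hni] at hg₁i
      exact zero_ne_one hg₁i
    · by_contra hni
      rw [integral_undef hni] at hg₂i
      exact zero_ne_one hg₂i
  have hcpos : 1 / (4 * Real.pi) < c := lt_min hc₁ hc₂
  have hφs := tsupport_coulombPrimitive (K := K) ha hcpos hζc
  have key := hL (coulombPrimitive a ζ c K) (contDiff_coulombPrimitive ha hζ hζK)
    (hasCompactSupport_of_tsupport_subset_hball hφs) hφs
  have e : (fun x => u x * lapDensity hyp (coulombPrimitive a ζ c K) x) =ᵐ[volume]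
      fun x => u x * m₁ x - u x * m₂ x := by
    filter_upwards [ae_ne a] with x hxa
    rw [← mul_sub]
    congr 1
    by_cases hx : x ∈ hball
    · rw [lapDensity_coulombPrimitive ha hζd hx hxa, hm₁e x hxa, hm₂e x hxa, sub_mul]
    · rw [lapDensity_eq_zero_of_notMem fun h => hx (hφs h)]
      by_contra hcon
      rcases not_and_or.1 fun h : m₁ x = 0 ∧ m₂ x = 0 => hcon (by rw [h.1, h.2, sub_zero])
        with h | h
      · exact hx (hm₁n x h).1
      · exact hx (hm₂n x h).1
  have i₁ := LocallyIntegrableOn.integrable_mul_of_tsupport hu hm₁ hm₁c hm₁s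
  have i₂ := LocallyIntegrableOn.integrable_mul_of_tsupport hu hm₂ hm₂c hm₂s
  have j₁ := hm₁.integrable_of_hasCompactSupport (μ := volume) hm₁c
  have j₂ := hm₂.integrable_of_hasCompactSupport (μ := volume) hm₂c
  rw [integral_congr_ae e, integral_sub i₁ i₂] at key
  -- Since both averages are equal, `u(a)` is the average of `u(a) - u` near `a` plus the average of
  -- `u` near the boundary. Each is at most `ε = |u(a)|/3` in modulus.
  have hua : u a = ∫ x, (u a * m₁ x - (u x * m₁ x - u x * m₂ x)) := by
    rw [integral_sub (j₁.const_mul _) (by exact i₁.sub i₂), integral_sub i₁ i₂, key,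
      integral_const_mul, hm₁i]
    ring
  have hbound : |u a| ≤ ∫ x, (ε * m₁ x + ε * m₂ x) := by
    rw [hua, ← Real.norm_eq_abs]
    refine norm_integral_le_of_norm_le (by exact (j₁.const_mul _).add (j₂.const_mul _))
      (.of_forall fun x => ?_)
    have b₁ : |(u a - u x) * m₁ x| ≤ ε * m₁ x := by
      rw [abs_mul, abs_of_nonneg (hm₁p x)]
      by_cases hx : m₁ x = 0
      · simp [hx]
      · refine mul_le_mul_of_nonneg_right ?_ (hm₁p x)
        rw [abs_sub_comm]
        have := h₁ (x := x) (by rw [dist_eq_norm]; exact hn₁ x (hm₁n x hx).2.1)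
        rw [Real.dist_eq] at this
        exact this.le
    have b₂ : |u x * m₂ x| ≤ ε * m₂ x := by
      rw [abs_mul, abs_of_nonneg (hm₂p x)]
      by_cases hx : m₂ x = 0
      · simp [hx]
      · obtain ⟨k1, k2, k3⟩ := hm₂n x hx
        exact mul_le_mul_of_nonneg_right (h₂ x k1 (hn₂ x k1 (hc₂.trans k2) k3)) (hm₂p x)
    rw [Real.norm_eq_abs, show u a * m₁ x - (u x * m₁ x - u x * m₂ x) =
      (u a - u x) * m₁ x + u x * m₂ x by ring]
    exact (abs_add_le _ _).trans (add_le_add b₁ b₂)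
  rw [integral_add (j₁.const_mul _) (j₂.const_mul _), integral_const_mul, integral_const_mul, hm₁i,
    hm₂i] at hbound
  linarith [abs_pos.2 hne]

/-! ### Removable singularities at the centre -/

lemma hasFDerivAt_comp_normSq {k : ℝ → ℝ} {k' : ℝ} {η : ℝ} {x : E3}
    (h : HasDerivAt k k' (η * ‖x‖ ^ 2)) :
    HasFDerivAt (fun y : E3 => k (η * ‖y‖ ^ 2)) ((2 * η * k') • innerSL ℝ x) x := by
  have h1 : HasFDerivAt (fun y : E3 => η * ‖y‖ ^ 2) ((2 * η) • innerSL ℝ x) x := by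
    refine ((hasStrictFDerivAt_norm_sq x).hasFDerivAt.const_mul η).congr_fderiv
      (ContinuousLinearMap.ext fun v => ?_)
    simp
    ring
  refine (h.comp_hasFDerivAt x h1).congr_fderiv (ContinuousLinearMap.ext fun v => ?_)
  simp
  ring

lemma innerSL_single (x : E3) (i : Fin 3) : innerSL ℝ x (EuclideanSpace.single i 1) = x i := by
  rw [innerSL_apply_apply, EuclideanSpace.inner_single_right]
  simp

/-- The gradient density of a radial function coincides with its Euclidean gradient, since `x` is an
eigenvector of the coefficient matrix. The two cross terms of the product rule are equal, hence the
factor `4`. -/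
lemma lapDensity_radial_mul {j j₁ j₂ : ℝ → ℝ} (h₁ : ∀ t, HasDerivAt j (j₁ t) t)
    (h₂ : ∀ t, HasDerivAt j₁ (j₂ t) t) (η : ℝ) {φ : E3 → ℝ} (hφ : ContDiff ℝ ∞ φ) {x : E3}
    (hx : x ∈ hball) :
    lapDensity hyp (fun y => j (η * ‖y‖ ^ 2) * φ y) x =
      j (η * ‖x‖ ^ 2) * lapDensity hyp φ x + 4 * η * j₁ (η * ‖x‖ ^ 2) * fderiv ℝ φ x x +
        φ x * (2 * η * (3 * j₁ (η * ‖x‖ ^ 2) + 2 * (η * ‖x‖ ^ 2 * j₂ (η * ‖x‖ ^ 2)))) := by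
  have hφd : Differentiable ℝ φ := hφ.differentiable (by simp)
  have hκ := fun y : E3 => hasFDerivAt_comp_normSq (η := η) (h₁ (η * ‖y‖ ^ 2))
  have hc : HasFDerivAt (fun y : E3 => 2 * η * j₁ (η * ‖y‖ ^ 2))
      ((2 * η) • ((2 * η * j₂ (η * ‖x‖ ^ 2)) • innerSL ℝ x)) x :=
    (hasFDerivAt_comp_normSq (η := η) (h₂ (η * ‖x‖ ^ 2))).const_mul (2 * η)
  have hκpd : ∀ i (y : E3), pd i (fun y => j (η * ‖y‖ ^ 2)) y =
      2 * η * j₁ (η * ‖y‖ ^ 2) * y i := fun i y => by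
    rw [pd, (hκ y).fderiv, smul_apply, innerSL_single, smul_eq_mul]
  have hgκ : ∀ y ∈ hball, ∀ i, gradDensity hyp (fun y => j (η * ‖y‖ ^ 2)) i y =
      2 * η * j₁ (η * ‖y‖ ^ 2) * (y i - (0 : E3) i) := fun y hy i => by
    have := one_sub_normSq_pos hy
    rw [gradDensity_hyp hy, hκpd, (hκ y).fderiv, smul_apply, innerSL_apply_apply,
      real_inner_self_eq_norm_sq, smul_eq_mul]
    simp only [PiLp.zero_apply, sub_zero]
    field_simp
  have e : ∀ i, gradDensity hyp (fun y => j (η * ‖y‖ ^ 2) * φ y) i =ᶠ[𝓝 x] fun y =>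
      j (η * ‖y‖ ^ 2) * gradDensity hyp φ i y +
        φ y * (2 * η * j₁ (η * ‖y‖ ^ 2) * (y i - (0 : E3) i)) := fun i => by
    filter_upwards [isOpen_hball.mem_nhds hx] with y hy
    rw [gradDensity_mul hyp (hκ y).differentiableAt (hφd y), hgκ y hy]
  have hd1 : ∀ i, DifferentiableAt ℝ (gradDensity hyp φ i) x := fun i =>
    (contDiffAt_gradDensity_hyp hx hφ.contDiffAt i).differentiableAt (by simp)
  have hd2 : ∀ i, DifferentiableAt ℝ
      (fun y : E3 => 2 * η * j₁ (η * ‖y‖ ^ 2) * (y i - (0 : E3) i)) x := fun i =>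
    hc.differentiableAt.mul (differentiable_coord i 0 x)
  have hsum := sum_pd_mul_coord hc.differentiableAt (0 : E3)
  rw [sub_zero, hc.fderiv, smul_apply, smul_apply, innerSL_apply_apply,
    real_inner_self_eq_norm_sq, smul_eq_mul, smul_eq_mul] at hsum
  have hself := sum_gradDensity_hyp_mul_self hx φ
  have hself2 := fderiv_eq_sum_pd φ x x
  have e2 : ∀ i, pd i (gradDensity hyp (fun y => j (η * ‖y‖ ^ 2) * φ y) i) x =
      j (η * ‖x‖ ^ 2) * pd i (gradDensity hyp φ i) x +
      2 * η * j₁ (η * ‖x‖ ^ 2) * (gradDensity hyp φ i x * x i) +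
      φ x * pd i (fun y : E3 => 2 * η * j₁ (η * ‖y‖ ^ 2) * (y i - (0 : E3) i)) x +
      2 * η * j₁ (η * ‖x‖ ^ 2) * (x i * pd i φ x) := fun i => by
    rw [pd_congr (e i), pd_add ((hκ x).differentiableAt.fun_mul (hd1 i)) ((hφd x).fun_mul (hd2 i)),
      pd_mul (hκ x).differentiableAt (hd1 i), pd_mul (hφd x) (hd2 i), hκpd]
    simp only [PiLp.zero_apply, sub_zero]
    ring
  simp only [lapDensity, e2, Finset.sum_add_distrib, ← Finset.mul_sum, hself, ← hself2, hsum]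
  ring

/-- The second derivative is bounded with the weight `t`, the form in which it enters the Laplacian
of `k(η|x|²)`. -/
lemma exists_cutoff : ∃ k k₁ k₂ : ℝ → ℝ, ContDiff ℝ ∞ k ∧ (∀ t, HasDerivAt k (k₁ t) t) ∧
    (∀ t, HasDerivAt k₁ (k₂ t) t) ∧ (∀ t, |t| ≤ 1 → k t = 1) ∧
    (∀ t, 2 < |t| → k t = 0 ∧ k₁ t = 0 ∧ k₂ t = 0) ∧
    ∃ C, 0 ≤ C ∧ ∀ t, |k t| ≤ C ∧ |k₁ t| ≤ C ∧ |t * k₂ t| ≤ C := by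
  let b : ContDiffBump (0 : ℝ) := ⟨1, 2, one_pos, one_lt_two⟩
  have hb : ContDiff ℝ ∞ b := b.contDiff
  have hd1 : ContDiff ℝ ∞ (deriv b) := (contDiff_infty_iff_deriv.1 hb).2
  have hd2 : ContDiff ℝ ∞ (deriv (deriv b)) := (contDiff_infty_iff_deriv.1 hd1).2
  have hc : HasCompactSupport b := b.hasCompactSupport
  have hc1 := hc.deriv
  have hc2 := hc1.deriv
  have hts : tsupport b = Metric.closedBall (0 : ℝ) 2 := b.tsupport_eq
  obtain ⟨C₀, h₀⟩ := hc.exists_bound_of_continuous hb.continuous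
  obtain ⟨C₁, h₁⟩ := hc1.exists_bound_of_continuous hd1.continuous
  obtain ⟨C₂, h₂⟩ := (hc2.mul_left (f := fun t => t)).exists_bound_of_continuous
    (continuous_id.mul hd2.continuous)
  refine ⟨b, deriv b, deriv (deriv b), hb,
    fun t => ((hb.differentiable (by simp)) t).hasDerivAt,
    fun t => ((hd1.differentiable (by simp)) t).hasDerivAt, fun t ht => ?_, fun t ht => ?_,
    max C₀ (max C₁ C₂), ?_, fun t => ⟨?_, ?_, ?_⟩⟩
  · exact b.one_of_mem_closedBall (by simpa using ht)
  · have h : t ∉ tsupport b := by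
      rw [hts]
      simpa using ht
    exact ⟨image_eq_zero_of_notMem_tsupport h,
      image_eq_zero_of_notMem_tsupport fun h' => h (tsupport_deriv_subset h'),
      image_eq_zero_of_notMem_tsupport fun h' =>
        h (tsupport_deriv_subset (tsupport_deriv_subset h'))⟩
  · exact (norm_nonneg _).trans ((h₀ 0).trans (le_max_left _ _))
  · exact (h₀ t).trans (le_max_left _ _)
  · exact (h₁ t).trans ((le_max_left _ _).trans (le_max_right _ _))
  · exact (h₂ t).trans ((le_max_right _ _).trans (le_max_right _ _))

lemma locallyIntegrable_inv_norm : LocallyIntegrable fun x : E3 => ‖x‖⁻¹ := by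
  simpa [quad_zero] using locallyIntegrable_pole zero_mem_hball

/-- By scaling. The gain `r²` compensates exactly for the second derivatives of a cutoff at scale
`r`. -/
lemma setIntegral_inv_norm {r : ℝ} (hr : 0 < r) :
    ∫ x in Metric.closedBall (0 : E3) r, ‖x‖⁻¹ =
      r ^ 2 * ∫ x in Metric.closedBall (0 : E3) 1, ‖x‖⁻¹ := by
  have h := Measure.setIntegral_comp_smul_of_pos (volume : Measure E3) (fun x : E3 => ‖x‖⁻¹)
    (Metric.closedBall (0 : E3) 1) hr
  simp only [finrank_euclideanSpace_fin, smul_closedBall _ _ zero_le_one, smul_zero, mul_one,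
    norm_smul, Real.norm_eq_abs, abs_of_pos hr, mul_inv, integral_const_mul, smul_eq_mul] at h
  field_simp at h ⊢
  linarith

lemma locallyIntegrableOn_hball_of_ext {u : E3 → ℝ} (hu : LocallyIntegrableOn u ext) {d δ : ℝ}
    (hδ : 0 < δ) (h : ∀ x, x ≠ 0 → ‖x‖ < δ → |u x| * ‖x‖ ≤ d) : LocallyIntegrableOn u hball := by
  intro x hx
  by_cases hx0 : x = 0
  · rw [hx0]
    refine ⟨Metric.ball 0 (min δ 1), mem_nhdsWithin_of_mem_nhds
      (Metric.ball_mem_nhds _ (lt_min hδ one_pos)), ?_⟩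
    have hm : AEStronglyMeasurable u (volume.restrict (Metric.ball 0 (min δ 1))) := by
      have h1 := hu.aestronglyMeasurable
      have h2 : volume.restrict (Metric.ball (0 : E3) (min δ 1)) =
          volume.restrict (Metric.ball (0 : E3) (min δ 1) \ {0}) := by
        refine Measure.restrict_congr_set ?_
        exact (sdiff_null_ae_eq_self (by simp)).symm
      rw [h2]
      have hsub : Metric.ball (0 : E3) (min δ 1) \ {0} ⊆ ext := fun y hy =>
        ⟨Metric.ball_subset_ball (min_le_right _ _) hy.1, hy.2⟩
      exact h1.mono_set hsub
    have hi : IntegrableOn (fun x : E3 => d * ‖x‖⁻¹) (Metric.ball 0 (min δ 1)) :=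
      ((locallyIntegrable_inv_norm.integrableOn_isCompact (isCompact_closedBall 0 (min δ 1))).mono_set
        Metric.ball_subset_closedBall).const_mul d
    refine hi.mono' hm ?_
    filter_upwards [ae_restrict_mem Metric.isOpen_ball.measurableSet,
      ae_restrict_of_ae (ae_ne 0)] with y hy hy0
    have hy1 : ‖y‖ < δ := (by simpa using hy : ‖y‖ < δ ∧ ‖y‖ < 1).1
    rw [Real.norm_eq_abs, ← div_eq_mul_inv, le_div_iff₀ (norm_pos_iff.2 hy0)]
    exact h y hy0 hy1
  · have := hu x (mem_ext.2 ⟨mem_hball.1 hx, hx0⟩)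
    rwa [IntegrableAtFilter, isOpen_ext.nhdsWithin_eq (mem_ext.2 ⟨mem_hball.1 hx, hx0⟩),
      ← isOpen_hball.nhdsWithin_eq hx] at this

/-- The centre is a removable singularity for a weakly harmonic function that is `o(1/|x|)`. -/
theorem weakly_harmonic_of_removable {u : E3 → ℝ} (hu : LocallyIntegrableOn u hball)
    (h0 : ∀ d > 0, ∃ δ > 0, ∀ x : E3, x ≠ 0 → ‖x‖ < δ → |u x| * ‖x‖ ≤ d)
    (hL : ∀ φ : E3 → ℝ, ContDiff ℝ ∞ φ → HasCompactSupport φ → tsupport φ ⊆ ext →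
      ∫ x, u x * lapDensity hyp φ x = 0)
    {φ : E3 → ℝ} (hφ : ContDiff ℝ ∞ φ) (hc : HasCompactSupport φ) (hs : tsupport φ ⊆ hball) :
    ∫ x, u x * lapDensity hyp φ x = 0 := by
  obtain ⟨k, k₁, k₂, hk, hk₁, hk₂, hk1, hk0, C, hC, hkC⟩ := exists_cutoff
  have hLc := continuous_lapDensity_hyp hφ hs
  have hLs : ∀ x, x ∉ tsupport φ → lapDensity hyp φ x = 0 := fun x hx =>
    lapDensity_eq_zero_of_notMem hx
  obtain ⟨B₀, hB₀⟩ := (hasCompactSupport_of_eq_zero hc hLs).exists_bound_of_continuous hLc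
  obtain ⟨B₁, hB₁⟩ := (hasCompactSupport_of_eq_zero hc (f := fun x => fderiv ℝ φ x x) fun x hx => by
    rw [fderiv_eq_zero_of_notMem hx]; rfl).exists_bound_of_continuous
      ((hφ.continuous_fderiv (by simp)).clm_apply continuous_id)
  obtain ⟨B₂, hB₂⟩ := hc.exists_bound_of_continuous hφ.continuous
  have p₀ : 0 ≤ B₀ := (norm_nonneg _).trans (hB₀ 0)
  have p₁ : 0 ≤ B₁ := (norm_nonneg _).trans (hB₁ 0)
  have p₂ : 0 ≤ B₂ := (norm_nonneg _).trans (hB₂ 0)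
  set D := C * B₀ + 4 * C * B₁ + B₂ * (2 * (3 * C + 2 * C)) with hD
  have hDp : 0 ≤ D := by positivity
  set N := ∫ x in Metric.closedBall (0 : E3) 1, ‖x‖⁻¹ with hN
  have hNp : 0 ≤ N := integral_nonneg fun x => by positivity
  have hmain : ∀ d > 0, |∫ x, u x * lapDensity hyp φ x| ≤ d * (D * (4 * N)) := by
    intro d hd
    obtain ⟨δ, hδ, hδu⟩ := h0 d hd
    set ε := min (1 / 2) (δ / 3) with hε
    have hεp : 0 < ε := by positivity
    have hε1 : ε ≤ 1 / 2 := min_le_left _ _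
    have hεδ : 2 * ε < δ := by
      have := min_le_right (1 / 2) (δ / 3)
      linarith
    set η := (ε ^ 2)⁻¹ with hη
    have hηp : 0 < η := by positivity
    have hη1 : 1 ≤ η := by
      rw [hη]
      exact (one_le_inv₀ (by positivity)).2 (by nlinarith)
    -- The cutoff removes a neighbourhood of the centre: `k(η|x|²)` is `1` for `|x| ≤ ε` and
    -- vanishes for `|x| > √2 ε`, in particular outside the ball of radius `2ε`.
    set ψ : E3 → ℝ := fun x => (1 - k (η * ‖x‖ ^ 2)) * φ x with hψdef
    have hψ : ContDiff ℝ ∞ ψ :=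
      (contDiff_const.sub (hk.comp (contDiff_const.mul (contDiff_norm_sq ℝ)))).mul hφ
    have hψc : HasCompactSupport ψ := hc.mul_left
    have hψs' : tsupport ψ ⊆ tsupport φ := tsupport_mul_subset_right
    have hψs : tsupport ψ ⊆ ext := by
      intro x hx
      refine ⟨hs (hψs' hx), ?_⟩
      rintro rfl
      refine notMem_tsupport_iff_eventuallyEq.2 ?_ hx
      filter_upwards [Metric.ball_mem_nhds (0 : E3) hεp] with y hy
      have hy' : ‖y‖ < ε := by simpa using hy
      simp only [hψdef]
      rw [hk1, sub_self, zero_mul]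
      · rfl
      · rw [abs_of_nonneg (by positivity), hη, inv_mul_le_iff₀ (by positivity), mul_one]
        gcongr
    have hz := hL ψ hψ hψc hψs
    have hiφ := LocallyIntegrableOn.integrable_mul_of_tsupport hu hLc
      (hasCompactSupport_of_eq_zero hc hLs) ((tsupport_subset_of_eq_zero hLs).trans hs)
    have hLψ := continuous_lapDensity_hyp hψ (hψs'.trans hs)
    have hLψs : ∀ x, x ∉ tsupport ψ → lapDensity hyp ψ x = 0 := fun x hx =>
      lapDensity_eq_zero_of_notMem hx
    have hiψ := LocallyIntegrableOn.integrable_mul_of_tsupport hu hLψ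
      (hasCompactSupport_of_eq_zero hψc hLψs)
      ((tsupport_subset_of_eq_zero hLψs).trans (hψs'.trans hs))
    have e1 : ∫ x, u x * lapDensity hyp φ x =
        ∫ x, (u x * lapDensity hyp φ x - u x * lapDensity hyp ψ x) := by
      rw [integral_sub hiφ hiψ, hz, sub_zero]
    have hr : 0 < 2 * ε := by positivity
    -- The error lives on `|x| ≤ 2ε`, where `|u| ≤ d/|x|` and the Laplacians differ by at most `D η`
    -- with `η = ε⁻²`. Its integral is therefore at most `4 d D N`, whatever `ε` is.
    have hbnd : ∀ᵐ x : E3, ‖u x * lapDensity hyp φ x - u x * lapDensity hyp ψ x‖ ≤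
        (Metric.closedBall (0 : E3) (2 * ε)).indicator (fun x => d * (D * η) * ‖x‖⁻¹) x := by
      filter_upwards [ae_ne 0] with x hx0
      have hxp := norm_pos_iff.2 hx0
      rw [← mul_sub, norm_mul, Real.norm_eq_abs, Real.norm_eq_abs]
      by_cases hxs : x ∈ hball
      · have hform := lapDensity_radial_mul (j := fun t => 1 - k t) (j₁ := fun t => -k₁ t)
          (j₂ := fun t => -k₂ t) (fun t => (hk₁ t).const_sub 1) (fun t => (hk₂ t).neg) η hφ hxs
        have hdiff : lapDensity hyp φ x - lapDensity hyp ψ x =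
            k (η * ‖x‖ ^ 2) * lapDensity hyp φ x + 4 * η * k₁ (η * ‖x‖ ^ 2) * fderiv ℝ φ x x +
            φ x * (2 * η * (3 * k₁ (η * ‖x‖ ^ 2) + 2 * (η * ‖x‖ ^ 2 * k₂ (η * ‖x‖ ^ 2)))) := by
          rw [hform]
          ring
        by_cases hx : x ∈ Metric.closedBall (0 : E3) (2 * ε)
        · rw [indicator_of_mem hx]
          have hxn : ‖x‖ ≤ 2 * ε := by simpa using hx
          have hux := hδu x hx0 (hxn.trans_lt hεδ)
          have hux' : |u x| ≤ d * ‖x‖⁻¹ := by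
            rwa [← div_eq_mul_inv, le_div_iff₀ hxp]
          obtain ⟨q₀, q₁, q₂⟩ := hkC (η * ‖x‖ ^ 2)
          have hle : |lapDensity hyp φ x - lapDensity hyp ψ x| ≤ D * η := by
            rw [hdiff]
            have t₀ : |k (η * ‖x‖ ^ 2) * lapDensity hyp φ x| ≤ C * B₀ := by
              rw [abs_mul]
              exact mul_le_mul q₀ (hB₀ x) (abs_nonneg _) hC
            have t₁ : |4 * η * k₁ (η * ‖x‖ ^ 2) * fderiv ℝ φ x x| ≤ 4 * η * C * B₁ := by
              rw [abs_mul, abs_mul, abs_of_pos (by positivity : 0 < 4 * η)]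
              exact mul_le_mul (by gcongr) (hB₁ x) (abs_nonneg _) (by positivity)
            have t₂ : |φ x * (2 * η * (3 * k₁ (η * ‖x‖ ^ 2) +
                2 * (η * ‖x‖ ^ 2 * k₂ (η * ‖x‖ ^ 2))))| ≤ B₂ * (2 * η * (3 * C + 2 * C)) := by
              rw [abs_mul, abs_mul (2 * η), abs_of_pos (by positivity : 0 < 2 * η)]
              refine mul_le_mul (hB₂ x) ?_ (by positivity) p₂
              gcongr
              refine (abs_add_le _ _).trans ?_
              rw [abs_mul, abs_mul 2, abs_of_pos (by norm_num : (0 : ℝ) < 3),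
                abs_of_pos (by norm_num : (0 : ℝ) < 2)]
              gcongr
            calc _ ≤ C * B₀ + 4 * η * C * B₁ + B₂ * (2 * η * (3 * C + 2 * C)) :=
                  (abs_add_three _ _ _).trans (by gcongr)
              _ ≤ C * B₀ * η + 4 * η * C * B₁ + B₂ * (2 * η * (3 * C + 2 * C)) := by
                  have := le_mul_of_one_le_right (by positivity : 0 ≤ C * B₀) hη1
                  linarith
              _ = D * η := by rw [hD]; ring
          calc |u x| * |lapDensity hyp φ x - lapDensity hyp ψ x|
              ≤ (d * ‖x‖⁻¹) * (D * η) := mul_le_mul hux' hle (abs_nonneg _) (by positivity)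
            _ = _ := by ring
        · rw [indicator_of_notMem hx, hdiff]
          have hxn : 2 * ε < ‖x‖ := by simpa using hx
          have h2 : 2 < |η * ‖x‖ ^ 2| := by
            rw [abs_of_pos (by positivity), hη, lt_inv_mul_iff₀ (by positivity)]
            nlinarith
          obtain ⟨q₀, q₁, q₂⟩ := hk0 _ h2
          rw [q₀, q₁, q₂]
          simp
      · rw [hLs x fun h => hxs (hs h), hLψs x fun h => hxs (hs (hψs' h))]
        simp only [sub_self, abs_zero, mul_zero]
        exact indicator_nonneg (fun y _ => by positivity) x
    have hintg : Integrable ((Metric.closedBall (0 : E3) (2 * ε)).indicator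
        fun x : E3 => d * (D * η) * ‖x‖⁻¹) :=
      (integrable_indicator_iff Metric.isClosed_closedBall.measurableSet).2
        ((locallyIntegrable_inv_norm.integrableOn_isCompact (isCompact_closedBall 0 _)).const_mul _)
    rw [e1, ← Real.norm_eq_abs]
    refine (norm_integral_le_of_norm_le hintg hbnd).trans_eq ?_
    rw [integral_indicator Metric.isClosed_closedBall.measurableSet, integral_const_mul,
      setIntegral_inv_norm hr, ← hN, hη]
    field_simp
    ring
  by_contra hne
  have hp := abs_pos.2 hne
  have hDN : 0 ≤ D * (4 * N) := by positivity
  -- This choice of `d` would bound the integral by at most half of itself.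
  have := hmain (|∫ x, u x * lapDensity hyp φ x| / (2 * (D * (4 * N) + 1))) (by positivity)
  rw [div_mul_eq_mul_div, le_div_iff₀ (by positivity)] at this
  nlinarith

/-! ### The Green's function of hyperbolic space -/

/-- The value at the pole is immaterial: it is excluded from the smoothness condition and the point
has measure zero. -/
lemma IsGreen.congr {g : E3 → Matrix (Fin 3) (Fin 3) ℝ} {U : Set E3} {x₀ : E3} {G G' : E3 → ℝ}
    (hG : IsGreen g U x₀ G) (hU : IsOpen U) (h : ∀ x ∈ U \ {x₀}, G' x = G x) :
    IsGreen g U x₀ G' := by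
  have hae : G' =ᵐ[volume.restrict U] G := by
    filter_upwards [ae_restrict_mem hU.measurableSet, ae_restrict_of_ae (ae_ne x₀)] with x hx hx0
      using h x ⟨hx, hx0⟩
  refine ⟨hG.smooth.congr h, fun x hx => ?_, fun φ hφ hc hs => ?_⟩
  · obtain ⟨s, hs, hi⟩ := hG.locInt x hx
    refine ⟨s ∩ U, inter_mem hs self_mem_nhdsWithin, ?_⟩
    refine (hi.mono_set inter_subset_left).congr ?_
    exact EventuallyEq.symm (ae_mono (Measure.restrict_mono inter_subset_right le_rfl) hae)
  · rw [← hG.eqn φ hφ hc hs]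
    congr 1
    refine integral_congr_ae ?_
    filter_upwards [hae] with x hx
    rw [hx]

/-! ### Hyperbolic distance to the centre and limits at infinity -/

lemma one_le_inv_sqrt {x : E3} (hx : x ∈ hball) : 1 ≤ 1 / √(1 - ‖x‖ ^ 2) := by
  have h := one_sub_normSq_pos hx
  rw [le_div_iff₀ (Real.sqrt_pos.2 h), one_mul]
  exact Real.sqrt_le_one.2 (by nlinarith [sq_nonneg ‖x‖])

lemma hdist_zero (x : E3) : hdist x 0 = Real.arcosh (1 / √(1 - ‖x‖ ^ 2)) := by
  simp [hdist]

lemma hdist_zero_nonneg {x : E3} (hx : x ∈ hball) : 0 ≤ hdist x 0 := by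
  rw [hdist_zero]
  exact Real.arcosh_nonneg (one_le_inv_sqrt hx)

/-- Translates between distance from the centre and closeness to the unit sphere, both for limits at
infinity and for the exponential decay. -/
lemma one_sub_normSq_eq {x : E3} (hx : x ∈ hball) :
    1 - ‖x‖ ^ 2 = (Real.cosh (hdist x 0) ^ 2)⁻¹ := by
  rw [hdist_zero, Real.cosh_arcosh (one_le_inv_sqrt hx), div_pow, one_pow,
    Real.sq_sqrt (one_sub_normSq_pos hx).le, one_div, inv_inv]

lemma exp_div_two_le_cosh (t : ℝ) : Real.exp t / 2 ≤ Real.cosh t := by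
  rw [Real.cosh_eq]
  linarith [Real.exp_pos (-t)]

/-- The filter of approach to infinity in hyperbolic space. -/
def atInf : Filter E3 := comap (fun x => hdist x 0) atTop ⊓ 𝓟 hball

lemma tendsto_one_sub_normSq : Tendsto (fun x : E3 => 1 - ‖x‖ ^ 2) atInf (𝓝 0) := by
  have h1 : Tendsto Real.cosh atTop atTop :=
    tendsto_atTop_mono exp_div_two_le_cosh (Real.tendsto_exp_atTop.atTop_div_const two_pos)
  have h2 : Tendsto (fun t => (Real.cosh t ^ 2)⁻¹) atTop (𝓝 0) :=
    ((tendsto_pow_atTop two_ne_zero).comp h1).inv_tendsto_atTop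
  have h3 : Tendsto (fun x => hdist x 0) atInf atTop := tendsto_comap.mono_left inf_le_left
  refine (h2.comp h3).congr' ?_
  have hb : ∀ᶠ x in atInf, x ∈ hball := mem_inf_of_right (mem_principal_self _)
  filter_upwards [hb] with x hx using (one_sub_normSq_eq hx).symm

lemma exists_of_eventually_atInf {p : E3 → Prop} (h : ∀ᶠ x in atInf, p x) :
    ∃ δ > 0, ∀ x ∈ hball, 1 - ‖x‖ ^ 2 < δ → p x := by
  rw [atInf, eventually_inf_principal, eventually_comap] at h
  obtain ⟨N, hN⟩ := eventually_atTop.1 h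
  refine ⟨(Real.cosh (max N 0) ^ 2)⁻¹, by positivity, fun x hx hlt => ?_⟩
  refine hN (hdist x 0) ?_ x rfl hx
  rw [one_sub_normSq_eq hx, inv_lt_inv₀ (by positivity) (by positivity)] at hlt
  have h1 := lt_of_pow_lt_pow_left₀ 2 (Real.cosh_pos _).le hlt
  rw [Real.cosh_lt_cosh, abs_of_nonneg (le_max_right N 0),
    abs_of_nonneg (hdist_zero_nonneg hx)] at h1
  exact (le_max_left N 0).trans h1.le

lemma tendsto_VO : Tendsto VO atInf (𝓝 (1 / (4 * Real.pi))) := by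
  have h1 : Tendsto (fun x : E3 => 1 / (4 * Real.pi * √(1 - (1 - ‖x‖ ^ 2)))) atInf
      (𝓝 (1 / (4 * Real.pi * √(1 - 0)))) := by
    refine Tendsto.div tendsto_const_nhds (((tendsto_one_sub_normSq.const_sub 1).sqrt).const_mul _)
      ?_
    have := Real.pi_pos
    simp
  rw [sub_zero, Real.sqrt_one, mul_one] at h1
  refine h1.congr fun x => ?_
  rw [sub_sub_cancel, Real.sqrt_sq (norm_nonneg x), VO]

lemma integrable_mul_lapDensity_hyp {G : E3 → ℝ} {U : Set E3}
    (hG : LocallyIntegrableOn G U) (hUb : U ⊆ hball)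
    {φ : E3 → ℝ} (hφ : ContDiff ℝ ∞ φ) (hc : HasCompactSupport φ) (hs : tsupport φ ⊆ U) :
    Integrable fun x => G x * lapDensity hyp φ x := by
  have hz : ∀ x, x ∉ tsupport φ → lapDensity hyp φ x = 0 := fun x hx =>
    lapDensity_eq_zero_of_notMem hx
  exact LocallyIntegrableOn.integrable_mul_of_tsupport hG
    (continuous_lapDensity_hyp hφ (hs.trans hUb)) (hasCompactSupport_of_eq_zero hc hz)
    ((tsupport_subset_of_eq_zero hz).trans hs)

/-- `V_O` is the only Green's function of hyperbolic space with its pole at the centre that tends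
to `1/(4π)` at infinity. -/
theorem isGreen_and_tendsto_iff (V : E3 → ℝ) :
    (IsGreen hyp hball 0 V ∧ Tendsto V atInf (𝓝 (1 / (4 * Real.pi)))) ↔
      ∀ x ∈ ext, V x = VO x := by
  have hVO : IsGreen hyp hball 0 VO := by
    rw [show VO = coulomb 0 from funext VO_eq_coulomb]
    exact isGreen_coulomb zero_mem_hball
  constructor
  · rintro ⟨hV, hlim⟩ a ha
    have hext : ext ∈ 𝓝 a := isOpen_ext.mem_nhds ha
    -- The two delta functions at the centre cancel, so the difference is weakly harmonic on the
    -- whole ball; continuity is required only at the point `a`, away from the pole.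
    refine sub_eq_zero.1 (eq_zero_of_weakly_harmonic (u := fun x => V x - VO x)
      (hV.locInt.sub hVO.locInt) (fun φ hφ hc hs => ?_) (fun ε hε => ?_) (ext_subset ha)
      ((hV.smooth.continuousOn.continuousAt hext).sub
        (hVO.smooth.continuousOn.continuousAt hext)))
    · have e1 := hV.eqn φ hφ hc hs
      have e2 := hVO.eqn φ hφ hc hs
      rw [setIntegral_laplacian_hyp isOpen_hball subset_rfl _ hs] at e1 e2
      simp only [sub_mul]
      rw [integral_sub (integrable_mul_lapDensity_hyp hV.locInt subset_rfl hφ hc hs)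
        (integrable_mul_lapDensity_hyp hVO.locInt subset_rfl hφ hc hs)]
      linarith
    · have h := hlim.sub tendsto_VO
      rw [sub_self] at h
      obtain ⟨δ, hδ, hd⟩ := exists_of_eventually_atInf (Metric.tendsto_nhds.1 h ε hε)
      refine ⟨δ, hδ, fun x hx hlt => ?_⟩
      have := hd x hx hlt
      rw [Real.dist_eq, sub_zero] at this
      exact this.le
  · intro h
    refine ⟨hVO.congr isOpen_hball h, tendsto_VO.congr' ?_⟩
    have hb : ∀ᶠ x in atInf, x ∈ hball := mem_inf_of_right (mem_principal_self _)
    filter_upwards [hb, tendsto_one_sub_normSq.eventually_lt_const one_pos] with x hx hlt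
    refine (h x ⟨hx, ?_⟩).symm
    rintro rfl
    simp at hlt

/-! ### Regularity at the horizon -/

lemma pd_radius (M Q : ℝ) {x : E3} (hx : x ≠ 0) (i : Fin 3) :
    pd i (radius M Q) x = -(mu M Q / ‖x‖ ^ 3) * x i := by
  rw [pd, (hasFDerivAt_radius M Q hx).fderiv, smul_apply, innerSL_single, smul_eq_mul]

/-- Up to a radial term the differential carries a factor `1 - |x|²`, which compensates for the
`1/f` in the magnetic-type components `F_{ij}`. -/
lemma pd_coulomb_eq {a x : E3} (ha : a ∈ hball) (hx : x ∈ hball) (hxa : x ≠ a) (i : Fin 3) :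
    pd i (coulomb a) x = (1 - ‖x‖ ^ 2) * efield a x i + fderiv ℝ (coulomb a) x x * x i := by
  have := one_sub_normSq_pos hx
  rw [← gradDensity_coulomb ha hx hxa, gradDensity_hyp hx]
  field_simp
  ring

lemma contDiffAt_coulombFamily {M Q : ℝ} (h : |Q| < M) {a x : E3} (ha : a ∈ hball) (A B : ℝ)
    (hx : x ≠ a) (hx0 : x ≠ 0) : ContDiffAt ℝ ∞ (coulombFamily M Q a A B) x :=
  (((contDiffAt_coulomb ha hx).add contDiffAt_const).div
    ((contDiffAt_HH M Q hx0).mul contDiffAt_const)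
    (mul_pos (HH_pos h x) (HH_pos h a)).ne').add contDiffAt_const

/-- Dividing by `H` changes the differential, beyond the scaling, only by a radial term `κ x`. Its
value is irrelevant, as it drops out of the antisymmetrisation with `∂r`, itself radial. -/
lemma pd_coulombFamily {M Q : ℝ} (h : |Q| < M) {a x : E3} (ha : a ∈ hball) (A B : ℝ)
    (hx : x ≠ a) (hx0 : x ≠ 0) : ∃ κ : ℝ, ∀ i, pd i (coulombFamily M Q a A B) x =
      (HH M Q x * HH M Q a)⁻¹ * pd i (coulomb a) x + κ * x i := by
  have hHx := HH_pos h x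
  have hHa := HH_pos h a
  have hd1 := ((contDiffAt_coulomb ha hx).differentiableAt (by simp)).hasFDerivAt
  have hd3 := (hasDerivAt_inv hHx.ne').comp_hasFDerivAt _ (hasFDerivAt_HH M Q hx0)
  have hd4 := ((((hd1.add_const A).mul hd3).mul_const (HH M Q a)⁻¹).add_const B)
  have e : coulombFamily M Q a A B = fun y => ((fun y => coulomb a y + A) *
      ((fun y => y⁻¹) ∘ HH M Q)) y * (HH M Q a)⁻¹ + B := by
    ext y
    simp [coulombFamily]
    ring
  rw [← e] at hd4
  refine ⟨(HH M Q a)⁻¹ * ((coulomb a x + A) *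
    (-(HH M Q x ^ 2)⁻¹ * -(mu M Q / ‖x‖ ^ 3 / √(mu M Q)))), fun i => ?_⟩
  rw [pd, hd4.fderiv]
  simp only [smul_apply, add_apply, smul_eq_mul, innerSL_single, Function.comp_apply, pd]
  rw [mul_inv]
  ring

lemma isOpen_norm_gt (R : ℝ) : IsOpen {x : E3 | R < ‖x‖} := isOpen_lt continuous_const continuous_norm

/-- The components of the field of a member of the family in coordinates that are regular at the
horizon. -/
lemma horizonRegular_coulombFamily {M Q : ℝ} (h : |Q| < M) {a : E3} (ha : a ∈ ext) (A B : ℝ) :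
    HorizonRegular M Q (coulombFamily M Q a A B) := by
  have hb := ext_subset ha
  have hm := mu_pos h
  have hHa := HH_pos h a
  have hne : ∀ x : E3, ‖a‖ < ‖x‖ → x ≠ a ∧ x ≠ 0 := fun x hx =>
    ⟨fun e => by rw [e] at hx; exact hx.false,
      fun e => by rw [e, norm_zero] at hx; exact hx.not_ge (norm_nonneg a)⟩
  refine ⟨{x | ‖a‖ < ‖x‖}, isOpen_norm_gt _, fun x hx => ?_,
    -- The second family of components is what remains of `F_{ij}` after the factor `1 - |x|²` has
    -- cancelled; it is smooth up to and beyond the unit sphere.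
    fun i => pd i (coulombFamily M Q a A B), fun i j x => radius M Q x ^ 2 /
      (mu M Q * ‖x‖ * (HH M Q x * HH M Q a)) * (efield a x i * x j - efield a x j * x i),
    fun i x hx => ?_, fun i j x hx => ?_, fun x hx => ⟨fun i => rfl, fun i j => ?_⟩⟩
  · rw [mem_sphere_zero_iff_norm] at hx
    rw [Set.mem_ofPred_eq, hx]
    exact mem_hball.1 hb
  · exact (contDiffAt_pd (contDiffAt_coulombFamily h hb A B (hne x hx).1 (hne x hx).2)
      i).contDiffWithinAt
  · obtain ⟨hxa, hx0⟩ := hne x hx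
    have hE : ∀ i, ContDiffAt ℝ ∞ (fun y => efield a y i) x := fun i =>
      (EuclideanSpace.proj (𝕜 := ℝ) i).contDiff.contDiffAt.comp x (contDiffAt_efield hb hxa)
    refine ContDiffAt.contDiffWithinAt ?_
    refine (((contDiffAt_radius M Q hx0).pow 2).div ((contDiffAt_const.mul
      (contDiffAt_norm ℝ hx0)).mul ((contDiffAt_HH M Q hx0).mul contDiffAt_const)) ?_).mul
      (((hE i).mul (contDiffAt_apply j x)).sub ((hE j).mul (contDiffAt_apply i x)))
    exact (mul_pos (mul_pos hm (norm_pos_iff.2 hx0)) (mul_pos (HH_pos h x) hHa)).ne'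
  · obtain ⟨hxa, hx0⟩ := hne x hx.1
    obtain ⟨κ, hκ⟩ := pd_coulombFamily h hb A B hxa hx0
    have hHx := HH_pos h x
    have h1 := one_sub_normSq_pos hx.2
    have hr := radius_pos h x
    have hρ := norm_pos_iff.2 hx0
    rw [hκ, hκ, pd_radius M Q hx0, pd_radius M Q hx0, lapseSq_radius h hx0,
      pd_coulomb_eq hb hx.2 hxa, pd_coulomb_eq hb hx.2 hxa]
    field_simp
    ring

lemma HorizonRegular.congr {M Q : ℝ} {Φ Φ' : E3 → ℝ} (hΦ : HorizonRegular M Q Φ) {R : ℝ}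
    (hR : R < 1) (h : ∀ x ∈ hball, R < ‖x‖ → Φ' x = Φ x) : HorizonRegular M Q Φ' := by
  obtain ⟨U, hU, hs, Fv, Fs, h1, h2, h3⟩ := hΦ
  refine ⟨U ∩ {x | R < ‖x‖}, hU.inter (isOpen_norm_gt R), fun x hx => ⟨hs hx, ?_⟩, Fv, Fs,
    fun i => (h1 i).mono inter_subset_left, fun i j => (h2 i j).mono inter_subset_left,
    fun x hx => ?_⟩
  · rw [mem_sphere_zero_iff_norm] at hx
    rw [Set.mem_ofPred_eq, hx]
    exact hR
  · have e : ∀ i, pd i Φ' x = pd i Φ x := fun i => by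
      refine pd_congr ?_ i
      filter_upwards [isOpen_hball.mem_nhds hx.2, (isOpen_norm_gt R).mem_nhds hx.1.2] with y hy hyR
        using h y hy hyR
    simp only [e]
    exact h3 x ⟨hx.1.1, hx.2⟩

/-! ### Constancy on the horizon of a regular potential -/

lemma exists_annulus_subset {U : Set E3} (hU : IsOpen U) (hs : Metric.sphere 0 1 ⊆ U) {R₀ : ℝ}
    (hR₀ : R₀ < 1) : ∃ R, R₀ < R ∧ 0 < R ∧ R < 1 ∧ ∀ x : E3, R ≤ ‖x‖ → ‖x‖ ≤ 1 → x ∈ U := by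
  obtain ⟨δ, hδ, hsub⟩ := (isCompact_sphere (0 : E3) 1).exists_thickening_subset_open hU hs
  refine ⟨max ((1 + R₀) / 2) (max (1 / 2) (1 - δ / 2)), lt_max_of_lt_left (by linarith),
    lt_max_of_lt_right (lt_max_of_lt_left (by norm_num)),
    max_lt (by linarith) (max_lt (by norm_num) (by linarith)), fun x hx hx1 => hsub ?_⟩
  have h1 : 1 / 2 ≤ ‖x‖ := ((le_max_left _ _).trans (le_max_right _ _)).trans hx
  have h2 : 1 - δ / 2 ≤ ‖x‖ := ((le_max_right _ _).trans (le_max_right _ _)).trans hx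
  have hxp : 0 < ‖x‖ := by linarith
  rw [Metric.mem_thickening_iff]
  refine ⟨‖x‖⁻¹ • x, ?_, ?_⟩
  · rw [mem_sphere_zero_iff_norm, norm_smul, norm_inv, norm_norm, inv_mul_cancel₀ hxp.ne']
  · have e : x - ‖x‖⁻¹ • x = (1 - ‖x‖⁻¹) • x := by rw [sub_smul, one_smul]
    rw [dist_eq_norm, e, norm_smul, Real.norm_eq_abs, ← abs_of_pos hxp, ← abs_mul, abs_of_pos hxp,
      sub_mul, one_mul, inv_mul_cancel₀ hxp.ne', abs_lt]
    constructor <;> linarith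

lemma exists_unit_orthogonal (n e : E3) :
    ∃ m : E3, ‖m‖ = 1 ∧ inner ℝ n m = 0 ∧ inner ℝ e m = 0 := by
  have hne : (Submodule.span ℝ ({n, e} : Set E3))ᗮ ≠ ⊥ := by
    intro h
    rw [Submodule.orthogonal_eq_bot_iff] at h
    have h1 : Module.finrank ℝ (Submodule.span ℝ ({n, e} : Set E3)) ≤ 2 := by
      classical
      have := finrank_span_finset_le_card (R := ℝ) ({n, e} : Finset E3)
      rw [Finset.coe_pair] at this
      exact this.trans Finset.card_le_two
    rw [h, finrank_top, finrank_euclideanSpace_fin] at h1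
    omega
  obtain ⟨m, hm, hm0⟩ := Submodule.exists_mem_ne_zero_of_ne_bot hne
  rw [Submodule.mem_orthogonal] at hm
  refine ⟨‖m‖⁻¹ • m, ?_, ?_, ?_⟩
  · rw [norm_smul, norm_inv, norm_norm, inv_mul_cancel₀ (norm_ne_zero_iff.2 hm0)]
  · rw [real_inner_smul_right, hm n (Submodule.subset_span (by simp)), mul_zero]
  · rw [real_inner_smul_right, hm e (Submodule.subset_span (by simp)), mul_zero]

/-- A function with a small tangential derivative varies little over a sphere. -/
lemma abs_sub_le_of_tangential {Φ : E3 → ℝ} {s C : ℝ} (hs : 0 < s)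
    (hd : ∀ x : E3, ‖x‖ = s → DifferentiableAt ℝ Φ x)
    (hC : ∀ x w : E3, ‖x‖ = s → ‖w‖ = s → inner ℝ x w = 0 → |fderiv ℝ Φ x w| ≤ C)
    {n e : E3} (hn : ‖n‖ = 1) (he : ‖e‖ = 1) :
    |Φ (s • n) - Φ (s • e)| ≤ 4 * C := by
  -- Orthogonal directions are joined by a quarter of a great circle; its parameter length `π/2` is
  -- bounded by `2`.
  have key : ∀ n m : E3, ‖n‖ = 1 → ‖m‖ = 1 → inner ℝ n m = 0 →
      |Φ (s • m) - Φ (s • n)| ≤ 2 * C := by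
    intro n m hn hm hnm
    have hpyth : ∀ p q : ℝ, p ^ 2 + q ^ 2 = 1 → ‖s • (p • n + q • m)‖ = s := by
      intro p q hpq
      have h2 : ‖p • n + q • m‖ ^ 2 = 1 := by
        rw [@norm_add_sq ℝ, real_inner_smul_left, real_inner_smul_right, hnm, norm_smul, norm_smul,
          hn, hm]
        simpa using hpq
      rw [norm_smul, (pow_eq_one_iff_of_nonneg (norm_nonneg _) two_ne_zero).1 h2, mul_one,
        Real.norm_eq_abs, abs_of_pos hs]
    have hγ : ∀ t : ℝ, HasDerivAt (fun t => s • (Real.cos t • n + Real.sin t • m))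
        (s • (-Real.sin t • n + Real.cos t • m)) t := fun t =>
      (((Real.hasDerivAt_cos t).smul_const n).add
        ((Real.hasDerivAt_sin t).smul_const m)).const_smul s
    have hD : ∀ t : ℝ, HasDerivAt (fun t => Φ (s • (Real.cos t • n + Real.sin t • m)))
        (fderiv ℝ Φ (s • (Real.cos t • n + Real.sin t • m))
          (s • (-Real.sin t • n + Real.cos t • m))) t := fun t =>
      (hd _ (hpyth _ _ (Real.cos_sq_add_sin_sq t))).hasFDerivAt.comp_hasDerivAt t (hγ t)
    have hb := norm_image_sub_le_of_norm_deriv_le_segment' (f := fun t : ℝ =>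
      Φ (s • (Real.cos t • n + Real.sin t • m))) (a := 0) (b := Real.pi / 2) (C := C)
      (fun t _ => (hD t).hasDerivWithinAt) (fun t _ => by
        refine hC _ _ (hpyth _ _ (Real.cos_sq_add_sin_sq t)) (hpyth _ _ ?_) ?_
        · rw [neg_sq]
          exact Real.sin_sq_add_cos_sq t
        · simp only [real_inner_smul_left, real_inner_smul_right, inner_add_left, inner_add_right,
            hnm, real_inner_comm n m, real_inner_self_eq_norm_sq, hn, hm]
          ring) (Real.pi / 2) ⟨by positivity, le_rfl⟩
    simp only [Real.cos_pi_div_two, Real.sin_pi_div_two, Real.cos_zero, Real.sin_zero, zero_smul,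
      one_smul, zero_add, add_zero, sub_zero, Real.norm_eq_abs] at hb
    have hC0 : 0 ≤ C := by
      have := hC (s • n) (s • m) (by rw [norm_smul, hn, mul_one, Real.norm_eq_abs, abs_of_pos hs])
        (by rw [norm_smul, hm, mul_one, Real.norm_eq_abs, abs_of_pos hs])
        (by rw [real_inner_smul_left, real_inner_smul_right, hnm, mul_zero, mul_zero])
      exact (abs_nonneg _).trans this
    refine hb.trans ?_
    have : Real.pi / 2 ≤ 2 := by linarith [Real.pi_le_four]
    nlinarith
  -- Passing through a direction orthogonal to both end points treats all positions alike, antipodal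
  -- and equal points included.
  obtain ⟨m, hm, hnm, hem⟩ := exists_unit_orthogonal n e
  have h1 := key n m hn hm hnm
  have h2 := key e m he hm hem
  rw [abs_sub_comm] at h1
  calc |Φ (s • n) - Φ (s • e)| ≤ |Φ (s • n) - Φ (s • m)| + |Φ (s • m) - Φ (s • e)| :=
        abs_sub_le _ _ _
    _ ≤ 4 * C := by linarith

/-- A potential that is regular at the horizon is constant there. -/
lemma HorizonRegular.exists_limit {M Q : ℝ} (h : |Q| < M) {Φ : E3 → ℝ}
    (hΦ : HorizonRegular M Q Φ) {R₀ : ℝ} (hR₀ : R₀ < 1)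
    (hd : ∀ x ∈ hball, R₀ < ‖x‖ → DifferentiableAt ℝ Φ x) :
    ∃ ℓ C R : ℝ, R < 1 ∧ ∀ x ∈ hball, R < ‖x‖ → |Φ x - ℓ| ≤ C * (1 - ‖x‖ ^ 2) := by
  obtain ⟨U, hU, hs, Fv, Fs, h1, h2, h3⟩ := hΦ
  have hm := mu_pos h
  obtain ⟨R, hR0, hRp, hR1, hRU⟩ := exists_annulus_subset hU hs hR₀
  set K : Set E3 := {x | R ≤ ‖x‖ ∧ ‖x‖ ≤ 1} with hK
  have hKc : IsCompact K := by
    refine (isCompact_closedBall (0 : E3) 1).of_isClosed_subset ?_ fun x hx => by simpa using hx.2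
    exact (isClosed_le continuous_const continuous_norm).inter
      (isClosed_le continuous_norm continuous_const)
  have hKU : K ⊆ U := fun x hx => hRU x hx.1 hx.2
  have hbv : ∃ C, 0 ≤ C ∧ ∀ i, ∀ x ∈ K, |Fv i x| ≤ C := by
    choose C hC using fun i => hKc.exists_bound_of_continuousOn ((h1 i).continuousOn.mono hKU)
    refine ⟨∑ i, |C i|, Finset.sum_nonneg fun i _ => abs_nonneg _, fun i x hx => ?_⟩
    exact ((hC i x hx).trans (le_abs_self _)).trans
      (Finset.single_le_sum (f := fun i => |C i|) (fun i _ => abs_nonneg _) (Finset.mem_univ i))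
  have hbs : ∃ C, 0 ≤ C ∧ ∀ i j, ∀ x ∈ K, |Fs i j x| ≤ C := by
    choose C hC using fun p : Fin 3 × Fin 3 =>
      hKc.exists_bound_of_continuousOn ((h2 p.1 p.2).continuousOn.mono hKU)
    refine ⟨∑ p, |C p|, Finset.sum_nonneg fun i _ => abs_nonneg _, fun i j x hx => ?_⟩
    exact ((hC (i, j) x hx).trans (le_abs_self _)).trans
      (Finset.single_le_sum (f := fun p => |C p|) (fun i _ => abs_nonneg _)
        (Finset.mem_univ (i, j)))
  obtain ⟨Cv, hCv, hFv⟩ := hbv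
  obtain ⟨Cs, hCs, hFs⟩ := hbs
  have htan : ∀ x w : E3, R < ‖x‖ → ‖x‖ < 1 → ‖w‖ = ‖x‖ → inner ℝ x w = 0 →
      |fderiv ℝ Φ x w| ≤ 9 * Cs / mu M Q * (1 - ‖x‖ ^ 2) := by
    intro x w hxR hx1 hw hxw
    have hρ : 0 < ‖x‖ := hRp.trans hxR
    have hx0 : x ≠ 0 := norm_pos_iff.1 hρ
    have hxK : x ∈ K := ⟨hxR.le, hx1.le⟩
    have hxb : x ∈ hball := mem_hball.2 hx1
    have hr := radius_pos h x
    have hq := one_sub_normSq_pos hxb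
    have hrge : mu M Q / ‖x‖ ≤ radius M Q x := by
      rw [radius]
      linarith [M_pos h]
    obtain ⟨-, hs3⟩ := h3 x ⟨hKU hxK, hxb⟩
    -- Multiplying the bounded component `F_{ij}` by `f` shows that the angular part of `dΦ`
    -- vanishes to first order at the horizon.
    have hT : ∀ i j, (pd i Φ x * x j - pd j Φ x * x i) =
        Fs i j x * (mu M Q * (1 - ‖x‖ ^ 2) * ‖x‖ / radius M Q x ^ 2) := fun i j => by
      rw [hs3, pd_radius M Q hx0, pd_radius M Q hx0, lapseSq_radius h hx0]
      field_simp
      ring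
    -- Contraction with `w_i x_j`, where `w ⟂ x`, isolates the tangential derivative along `w`.
    have hsum : ∑ i, ∑ j, (pd i Φ x * x j - pd j Φ x * x i) * (w i * x j) =
        fderiv ℝ Φ x w * ‖x‖ ^ 2 := by
      have e1 := fderiv_eq_sum_pd Φ x w
      have e2 := inner_eq_sum x w
      have e3 := normSq_eq_sum x
      rw [hxw] at e2
      rw [e1, e3]
      simp only [Fin.sum_univ_three] at e2 ⊢
      linear_combination -(pd 0 Φ x * x 0 + pd 1 Φ x * x 1 + pd 2 Φ x * x 2) * -e2
    have hxi : ∀ (y : E3) (i : Fin 3), |y i| ≤ ‖y‖ := fun y i => PiLp.norm_apply_le y i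
    have hterm : ∀ i j, |(pd i Φ x * x j - pd j Φ x * x i) * (w i * x j)| ≤
        Cs / mu M Q * (1 - ‖x‖ ^ 2) * ‖x‖ ^ 2 := by
      intro i j
      rw [hT, abs_mul, abs_mul, abs_mul]
      have q1 : |mu M Q * (1 - ‖x‖ ^ 2) * ‖x‖ / radius M Q x ^ 2| ≤
          (1 - ‖x‖ ^ 2) / mu M Q := by
        rw [abs_of_pos (by positivity)]
        calc mu M Q * (1 - ‖x‖ ^ 2) * ‖x‖ / radius M Q x ^ 2
            ≤ mu M Q * (1 - ‖x‖ ^ 2) * 1 / (mu M Q / ‖x‖) ^ 2 := by gcongr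
          _ = (1 - ‖x‖ ^ 2) * ‖x‖ ^ 2 / mu M Q := by field_simp
          _ ≤ (1 - ‖x‖ ^ 2) * 1 / mu M Q := by
            gcongr
            nlinarith
          _ = _ := by rw [mul_one]
      have q2 := hxi w i
      rw [hw] at q2
      calc |Fs i j x| * |mu M Q * (1 - ‖x‖ ^ 2) * ‖x‖ / radius M Q x ^ 2| * (|w i| * |x j|)
          ≤ Cs * ((1 - ‖x‖ ^ 2) / mu M Q) * (‖x‖ * ‖x‖) := by
            gcongr
            · exact hFs i j x hxK
            · exact hxi x j
        _ = _ := by ring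
    have habs : |fderiv ℝ Φ x w * ‖x‖ ^ 2| ≤ 9 * (Cs / mu M Q * (1 - ‖x‖ ^ 2) * ‖x‖ ^ 2) := by
      rw [← hsum]
      refine (Finset.abs_sum_le_sum_abs _ _).trans ?_
      calc _ ≤ ∑ i : Fin 3, ∑ j : Fin 3, Cs / mu M Q * (1 - ‖x‖ ^ 2) * ‖x‖ ^ 2 :=
            Finset.sum_le_sum fun i _ => (Finset.abs_sum_le_sum_abs _ _).trans
              (Finset.sum_le_sum fun j _ => hterm i j)
        _ = _ := by
          simp only [Finset.sum_const, Finset.card_univ, Fintype.card_fin, nsmul_eq_mul]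
          ring
    rw [abs_mul, abs_of_pos (by positivity : 0 < ‖x‖ ^ 2)] at habs
    refine le_of_mul_le_mul_right (habs.trans_eq ?_) (by positivity : 0 < ‖x‖ ^ 2)
    ring
  set e : E3 := EuclideanSpace.single 0 1 with he
  have hen : ‖e‖ = 1 := by simp [he]
  have hse : ∀ s : ℝ, 0 < s → ‖s • e‖ = s := fun s hs => by
    rw [norm_smul, hen, mul_one, Real.norm_eq_abs, abs_of_pos hs]
  -- Along one fixed ray bounded derivatives suffice. The Lipschitz extension evaluated at `1`
  -- supplies the limit, and the tangential estimate carries it to all directions.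
  have hlip : LipschitzOnWith (3 * Cv).toNNReal (fun s : ℝ => Φ (s • e)) (Ioo R 1) := by
    refine (convex_Ioo R 1).lipschitzOnWith_of_nnnorm_hasDerivWithin_le
      (f' := fun s => fderiv ℝ Φ (s • e) e) (fun s hs => ?_) fun s hs => ?_
    · have hs0 : 0 < s := hRp.trans hs.1
      have h2 : HasDerivAt (fun t : ℝ => t • e) e s := by
        simpa using (hasDerivAt_id s).smul_const e
      exact ((hd (s • e) (by rw [mem_hball, hse s hs0]; exact hs.2)
        (by rw [hse s hs0]; exact hR0.trans hs.1)).hasFDerivAt.comp_hasDerivAt s h2).hasDerivWithinAt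
    · have hs0 : 0 < s := hRp.trans hs.1
      have hxK : s • e ∈ K := by
        rw [hK, Set.mem_ofPred_eq, hse s hs0]
        exact ⟨hs.1.le, hs.2.le⟩
      have hxb : s • e ∈ hball := by rw [mem_hball, hse s hs0]; exact hs.2
      rw [← NNReal.coe_le_coe, coe_nnnorm, Real.coe_toNNReal _ (by positivity), fderiv_eq_sum_pd,
        Real.norm_eq_abs]
      refine (Finset.abs_sum_le_sum_abs _ _).trans ?_
      calc _ ≤ ∑ i : Fin 3, Cv := Finset.sum_le_sum fun i _ => by
            rw [abs_mul, ← (h3 _ ⟨hKU hxK, hxb⟩).1 i]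
            have q1 : |e i| ≤ 1 := hen ▸ PiLp.norm_apply_le e i
            exact (mul_le_of_le_one_left (abs_nonneg _) q1).trans (hFv i _ hxK)
        _ = 3 * Cv := by simp
  obtain ⟨g, hg, hgeq⟩ := hlip.extend_real
  refine ⟨g 1, 4 * (9 * Cs / mu M Q) + 3 * Cv, R, hR1, fun x hx hxR => ?_⟩
  have hx1 := mem_hball.1 hx
  have hρ : 0 < ‖x‖ := hRp.trans hxR
  have t1 := abs_sub_le_of_tangential (Φ := Φ) (C := 9 * Cs / mu M Q * (1 - ‖x‖ ^ 2)) hρ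
    (fun y hy => hd y (by rw [mem_hball, hy]; exact hx1) (by rw [hy]; exact hR0.trans hxR))
    (fun y w hy hw hyw => by
      have := htan y w (by rw [hy]; exact hxR) (by rw [hy]; exact hx1) (hw.trans hy.symm) hyw
      rwa [hy] at this) (n := ‖x‖⁻¹ • x) (e := e)
    (by rw [norm_smul, norm_inv, norm_norm, inv_mul_cancel₀ hρ.ne']) hen
  rw [smul_smul, mul_inv_cancel₀ hρ.ne', one_smul] at t1
  have t2 : |Φ (‖x‖ • e) - g 1| ≤ 3 * Cv * (1 - ‖x‖) := by
    have e1 : Φ (‖x‖ • e) = g ‖x‖ := hgeq ⟨hxR, hx1⟩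
    have := hg.dist_le_mul ‖x‖ 1
    rw [Real.dist_eq, Real.dist_eq, abs_sub_comm ‖x‖, abs_of_pos (by linarith : 0 < 1 - ‖x‖),
      Real.coe_toNNReal _ (by positivity)] at this
    rw [e1]
    exact this
  calc |Φ x - g 1| ≤ |Φ x - Φ (‖x‖ • e)| + |Φ (‖x‖ • e) - g 1| := abs_sub_le _ _ _
    _ ≤ 4 * (9 * Cs / mu M Q * (1 - ‖x‖ ^ 2)) + 3 * Cv * (1 - ‖x‖ ^ 2) := by
      refine add_le_add t1 (t2.trans ?_)
      gcongr
      nlinarith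
    _ = _ := by ring

/-! ### The potential of a point charge -/

lemma tendsto_HH_atTop {M Q : ℝ} (h : |Q| < M) : Tendsto (HH M Q) (𝓝[≠] 0) atTop := by
  have hm := mu_pos h
  have h1 : Tendsto (fun x : E3 => M + mu M Q * ‖x‖⁻¹) (𝓝[≠] 0) atTop :=
    tendsto_atTop_add_const_left _ _
      ((tendsto_norm_nhdsNE_zero.inv_tendsto_nhdsGT_zero).const_mul_atTop hm)
  refine (h1.atTop_div_const (Real.sqrt_pos.2 hm)).congr fun x => ?_
  rw [HH_eq, radius, div_eq_mul_inv (mu M Q)]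

/-- `H` diverges at the centre while `coulomb a` is continuous there. -/
lemma tendsto_coulombFamily {M Q : ℝ} (h : |Q| < M) {a : E3} (ha : a ∈ ext) (A B : ℝ) :
    Tendsto (coulombFamily M Q a A B) (𝓝[≠] 0) (𝓝 B) := by
  have h1 : Tendsto (fun x => (HH M Q x * HH M Q a)⁻¹) (𝓝[≠] 0) (𝓝 0) :=
    ((tendsto_HH_atTop h).atTop_mul_const (HH_pos h a)).inv_tendsto_atTop
  have h2 : Tendsto (fun x => coulomb a x + A) (𝓝[≠] 0) (𝓝 (coulomb a 0 + A)) :=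
    ((contDiffAt_coulomb (ext_subset ha) (mem_ext.1 ha).2.symm).continuousAt.tendsto.mono_left
      nhdsWithin_le_nhds).add_const A
  have h3 := (h2.mul h1).add_const B
  rw [mul_zero, zero_add] at h3
  exact h3

lemma flux_congr {g : E3 → Matrix (Fin 3) (Fin 3) ℝ} {Φ Φ' : E3 → ℝ} {a : E3} {R : ℝ}
    (hΦ : ∀ x ∈ ext \ {a}, Φ x = Φ' x) (hR : ‖a‖ < R) (hR1 : R < 1) :
    flux g Φ R = flux g Φ' R := by
  have hR0 : 0 < R := (norm_nonneg a).trans_lt hR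
  rw [flux, flux]
  refine integral_congr_ae (.of_forall fun n => ?_)
  have hx : R • n.1 ∈ ext \ {a} :=
    ⟨mem_ext.2 ⟨by rw [norm_smul_sphere hR0.le]; exact hR1, smul_sphere_ne (by simpa using hR0) n⟩,
      smul_sphere_ne hR n⟩
  have hev : Φ =ᶠ[𝓝 (R • n.1)] Φ' := by
    filter_upwards [(isOpen_ext.sdiff isClosed_singleton).mem_nhds hx] with y hy using hΦ y hy
  simp only [gradDensity, pd_congr hev]

lemma flux_coulombFamily_eq_zero_iff {M Q : ℝ} (h : |Q| < M) {a : E3} (ha : a ∈ ext) (A B : ℝ)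
    {R : ℝ} (hR : ‖a‖ < R) (hR1 : R < 1) :
    flux (opt M Q) (coulombFamily M Q a A B) R = 0 ↔ A = M / (4 * Real.pi * mu M Q) := by
  have hm := mu_pos h
  have hpi := Real.pi_pos
  have hd : HH M Q a * √(mu M Q) ≠ 0 := (mul_pos (HH_pos h a) (Real.sqrt_pos.2 hm)).ne'
  rw [flux_coulombFamily h ha A B hR hR1, div_eq_zero_iff, or_iff_left hd, sub_eq_zero,
    eq_div_iff (by positivity), mul_comm A]

lemma HorizonRegular.exists_tendsto {M Q : ℝ} (h : |Q| < M) {Φ : E3 → ℝ}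
    (hΦ : HorizonRegular M Q Φ) {a : E3} (ha : a ∈ ext) (hd : ContDiffOn ℝ ∞ Φ (ext \ {a})) :
    ∃ ℓ, Tendsto Φ atInf (𝓝 ℓ) := by
  obtain ⟨ℓ, C, R, hR1, hb⟩ := hΦ.exists_limit h (mem_ext.1 ha).1 fun x hx hxa => by
    have hx' : x ∈ ext \ {a} := ⟨mem_ext.2 ⟨mem_hball.1 hx, norm_pos_iff.1
      ((norm_nonneg a).trans_lt hxa)⟩, fun e => by rw [e] at hxa; exact hxa.false⟩
    exact (hd.contDiffAt ((isOpen_ext.sdiff isClosed_singleton).mem_nhds hx')).differentiableAt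
      (by simp)
  refine ⟨ℓ, tendsto_iff_norm_sub_tendsto_zero.2 ?_⟩
  have hlim := tendsto_one_sub_normSq.const_mul C
  rw [mul_zero] at hlim
  refine squeeze_zero' (.of_forall fun x => norm_nonneg _) ?_ hlim
  have hball' : ∀ᶠ x in atInf, x ∈ hball := mem_inf_of_right (mem_principal_self _)
  have hpos : 0 < 1 - max R 0 ^ 2 := by
    have h1 : max R 0 < 1 := max_lt hR1 one_pos
    nlinarith [le_max_right R 0]
  filter_upwards [hball', tendsto_one_sub_normSq.eventually_lt_const hpos] with x hx hlt
  refine hb x hx ((le_max_left R 0).trans_lt ?_)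
  exact lt_of_pow_lt_pow_left₀ 2 (norm_nonneg x) (by linarith)

lemma tendsto_HH_atInf (M Q : ℝ) :
    Tendsto (HH M Q) atInf (𝓝 ((4 * Real.pi * mu M Q * (1 / (4 * Real.pi)) + M) / √(mu M Q))) :=
  ((tendsto_VO.const_mul _).add_const M).div_const _

/-- The difference of two Green's functions of the optical metric, multiplied by `H`, is weakly
harmonic for the hyperbolic metric. -/
lemma integral_HH_mul_sub {M Q : ℝ} (h : |Q| < M) {a : E3} {Φ P : E3 → ℝ}
    (hΦ : IsGreen (opt M Q) ext a Φ) (hP : IsGreen (opt M Q) ext a P) {φ : E3 → ℝ}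
    (hφ : ContDiff ℝ ∞ φ) (hc : HasCompactSupport φ) (hs : tsupport φ ⊆ ext) :
    ∫ x, HH M Q x * (Φ x - P x) * lapDensity hyp φ x = 0 := by
  -- Testing the optical equation with `φ/H` produces the hyperbolic Laplacian of `φ` itself.
  set ψ : E3 → ℝ := fun x => (HH M Q x)⁻¹ * φ x with hψdef
  have hψ : ContDiff ℝ ∞ ψ := contDiff_mul_of_tsupport
    (fun x hx => (contDiffAt_HH M Q (mem_ext.1 hx).2).inv (HH_pos h x).ne') hφ hs
  have hψc : HasCompactSupport ψ := hc.mul_left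
  have hψs : tsupport ψ ⊆ ext := tsupport_mul_subset_right.trans hs
  have hHψ : (fun x => HH M Q x * ψ x) = φ := funext fun x => by
    simp only [hψdef]
    rw [mul_inv_cancel_left₀ (HH_pos h x).ne']
  have hop : ∀ x, lapDensity (opt M Q) ψ x = HH M Q x * lapDensity hyp φ x := fun x => by
    rw [lapDensity_opt_test h hψ hψs, hHψ]
  have hz : ∀ x, x ∉ tsupport φ → lapDensity hyp φ x = 0 := fun x hx =>
    lapDensity_eq_zero_of_notMem hx
  have hm : Continuous fun x => HH M Q x * lapDensity hyp φ x := by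
    rw [continuous_iff_continuousAt]
    intro x
    by_cases hx : x ∈ tsupport φ
    · exact (contDiffAt_HH M Q (mem_ext.1 (hs hx)).2).continuousAt.mul
        (continuous_lapDensity_hyp hφ (hs.trans ext_subset)).continuousAt
    · refine (continuousAt_const (y := (0 : ℝ))).congr ?_
      filter_upwards [(isClosed_tsupport φ).isOpen_compl.mem_nhds hx] with y hy
      rw [hz y hy, mul_zero]
  have hz' : ∀ x, x ∉ tsupport φ → HH M Q x * lapDensity hyp φ x = 0 := fun x hx => by
    rw [hz x hx, mul_zero]
  have hi : ∀ G : E3 → ℝ, LocallyIntegrableOn G ext →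
      Integrable fun x => G x * (HH M Q x * lapDensity hyp φ x) := fun G hG =>
    LocallyIntegrableOn.integrable_mul_of_tsupport hG hm (hasCompactSupport_of_eq_zero hc hz')
      ((tsupport_subset_of_eq_zero hz').trans hs)
  have e1 := hΦ.eqn ψ hψ hψc hψs
  have e2 := hP.eqn ψ hψ hψc hψs
  rw [setIntegral_laplacian_opt h _ hψs] at e1 e2
  simp only [hop] at e1 e2
  have e : ∀ x, HH M Q x * (Φ x - P x) * lapDensity hyp φ x =
      Φ x * (HH M Q x * lapDensity hyp φ x) - P x * (HH M Q x * lapDensity hyp φ x) := fun x => by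
    ring
  simp only [e]
  rw [integral_sub (hi Φ hΦ.locInt) (hi P hP.locInt)]
  linarith

/-- Green's functions of the optical metric that vanish at the flat end and are regular at the
horizon form a one-parameter family. -/
lemma exists_eq_coulombFamily {M Q : ℝ} (h : |Q| < M) {a : E3} (ha : a ∈ ext) {Φ : E3 → ℝ}
    (hG : IsGreen (opt M Q) ext a Φ) (hinf : Tendsto Φ (𝓝[≠] 0) (𝓝 0))
    (hH : HorizonRegular M Q Φ) : ∃ A, ∀ x ∈ ext \ {a}, Φ x = coulombFamily M Q a A 0 x := by
  have hHa := HH_pos h a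
  have hm := mu_pos h
  have hsm := Real.sqrt_pos.2 hm
  set P := coulombFamily M Q a 0 0 with hP
  have hPG : IsGreen (opt M Q) ext a P := isGreen_coulombFamily h ha 0 0
  obtain ⟨ℓ₁, hℓ₁⟩ := hH.exists_tendsto h ha hG.smooth
  obtain ⟨ℓ₂, hℓ₂⟩ := (horizonRegular_coulombFamily h ha 0 0).exists_tendsto h ha hPG.smooth
  set H₁ := (4 * Real.pi * mu M Q * (1 / (4 * Real.pi)) + M) / √(mu M Q) with hH₁
  -- The limit of `H (Φ - P)` at the horizon, where `H` tends to `H₁`. Subtracting this constant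
  -- keeps the function weakly harmonic and makes it vanish at the boundary.
  set c := H₁ * (ℓ₁ - ℓ₂) with hcdef
  set u : E3 → ℝ := fun x => HH M Q x * (Φ x - P x) - c with hu
  have hbdry : Tendsto u atInf (𝓝 0) := by
    have := ((tendsto_HH_atInf M Q).mul (hℓ₁.sub hℓ₂)).sub_const c
    rwa [← hH₁, ← hcdef, sub_self] at this
  -- `H |x|` stays bounded at the centre and `Φ - P → 0`, so the singularity is `o(1/|x|)`.
  have hcenter : Tendsto (fun x => |u x| * ‖x‖) (𝓝[≠] 0) (𝓝 0) := by
    have hn : Tendsto (fun x : E3 => ‖x‖) (𝓝[≠] 0) (𝓝 0) :=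
      tendsto_norm_nhdsNE_zero.mono_right nhdsWithin_le_nhds
    have h1 : Tendsto (fun x : E3 => (M * ‖x‖ + mu M Q) / √(mu M Q)) (𝓝[≠] 0)
        (𝓝 ((M * 0 + mu M Q) / √(mu M Q))) := ((hn.const_mul M).add_const _).div_const _
    have h2 : Tendsto (fun x => Φ x - P x) (𝓝[≠] 0) (𝓝 (0 - 0)) :=
      hinf.sub (tendsto_coulombFamily h ha 0 0)
    have h3 := ((h1.mul h2).sub (hn.const_mul c)).abs
    rw [sub_zero, mul_zero, mul_zero, sub_zero, abs_zero] at h3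
    refine h3.congr' ?_
    filter_upwards [self_mem_nhdsWithin] with x hx
    have hx0 : 0 < ‖x‖ := norm_pos_iff.2 hx
    rw [← abs_of_pos hx0, ← abs_mul, abs_of_pos hx0]
    congr 1
    simp only [hu]
    rw [HH_eq, radius]
    field_simp
  have hcenter' : ∀ d > 0, ∃ δ > 0, ∀ x : E3, x ≠ 0 → ‖x‖ < δ → |u x| * ‖x‖ ≤ d := by
    intro d hd
    obtain ⟨δ, hδ, hsub⟩ := Metric.mem_nhdsWithin_iff.1 (hcenter.eventually_lt_const hd)
    exact ⟨δ, hδ, fun x hx0 hx => (hsub ⟨by simpa using hx, hx0⟩).le⟩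
  have huext : LocallyIntegrableOn u ext := by
    have h1 : LocallyIntegrableOn (fun x => HH M Q x * (Φ x - P x)) ext :=
      (hG.locInt.sub hPG.locInt).continuousOn_mul
        (fun x hx => (contDiffAt_HH M Q (mem_ext.1 hx).2).continuousAt.continuousWithinAt)
        isOpen_ext.isLocallyClosed
    exact h1.sub ((locallyIntegrable_const c).locallyIntegrableOn ext)
  obtain ⟨δ₀, hδ₀, hd₀⟩ := hcenter' 1 one_pos
  have hub := locallyIntegrableOn_hball_of_ext huext hδ₀ hd₀
  have hL : ∀ φ : E3 → ℝ, ContDiff ℝ ∞ φ → HasCompactSupport φ → tsupport φ ⊆ ext →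
      ∫ x, u x * lapDensity hyp φ x = 0 := by
    intro φ hφ hc hs
    have hconst := integral_lapDensity (g := hyp) (φ := φ)
      (contDiff_gradDensity_hyp hφ (hs.trans ext_subset)) hc c
    have hi : Integrable fun x => HH M Q x * (Φ x - P x) * lapDensity hyp φ x := by
      have := (integrable_mul_lapDensity_hyp huext ext_subset hφ hc hs).add hconst.1
      refine this.congr (.of_forall fun x => ?_)
      simp only [hu, Pi.add_apply]
      ring
    simp only [hu, sub_mul _ c]
    rw [integral_sub hi hconst.1, hconst.2, sub_zero]
    exact integral_HH_mul_sub h hG hPG hφ hc hs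
  -- From `H (Φ - P) = c`: adding `c/H` to `P` amounts to `A = c H(a)`.
  refine ⟨c * HH M Q a, fun x hx => ?_⟩
  have hxn := (isOpen_ext.sdiff isClosed_singleton).mem_nhds hx
  have hux : u x = 0 := by
    refine eq_zero_of_weakly_harmonic hub
      (fun φ hφ hc hs => weakly_harmonic_of_removable hub hcenter' hL hφ hc hs)
      (fun ε hε => ?_) (ext_subset hx.1) ?_
    · obtain ⟨δ, hδ, hd⟩ := exists_of_eventually_atInf (Metric.tendsto_nhds.1 hbdry ε hε)
      refine ⟨δ, hδ, fun y hy hlt => ?_⟩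
      have := hd y hy hlt
      rw [Real.dist_eq, sub_zero] at this
      exact this.le
    · exact ((contDiffAt_HH M Q (mem_ext.1 hx.1).2).continuousAt.mul
        ((hG.smooth.continuousOn.continuousAt hxn).sub
          (hPG.smooth.continuousOn.continuousAt hxn))).sub continuousAt_const
  have hHx := HH_pos h x
  simp only [hu, hP, coulombFamily] at hux
  rw [coulombFamily]
  field_simp at hux ⊢
  linarith

/-- The potential of a point charge outside a hole without net charge. -/
theorem isPointChargePotential_iff {M Q : ℝ} (h : |Q| < M) {a : E3} (ha : a ∈ ext) (Φ : E3 → ℝ) :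
    IsPointChargePotential M Q a Φ ↔
      ∀ x ∈ ext \ {a}, Φ x = coulombFamily M Q a (M / (4 * Real.pi * mu M Q)) 0 x := by
  constructor
  · intro hΦ
    obtain ⟨A, hA⟩ := exists_eq_coulombFamily h ha hΦ.green hΦ.infinity hΦ.horizon
    -- A single sphere determines the constant, as the flux does not depend on the radius.
    obtain ⟨R, hR, hR1⟩ := exists_between (mem_ext.1 ha).1
    have hf := hΦ.gauss R hR hR1
    rw [flux_congr hA hR hR1, flux_coulombFamily_eq_zero_iff h ha A 0 hR hR1] at hf
    rwa [hf] at hA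
  · intro hΦ
    refine ⟨(isGreen_coulombFamily h ha _ 0).congr isOpen_ext hΦ,
      (tendsto_coulombFamily h ha (M / (4 * Real.pi * mu M Q)) 0).congr' ?_,
      (horizonRegular_coulombFamily h ha _ 0).congr (mem_ext.1 ha).1 fun x hx hxa => hΦ x ?_,
      fun R hR hR1 => ?_⟩
    · filter_upwards [self_mem_nhdsWithin, mem_nhdsWithin_of_mem_nhds
        (isOpen_hball.mem_nhds zero_mem_hball), mem_nhdsWithin_of_mem_nhds
        (isOpen_ne.mem_nhds (mem_ext.1 ha).2.symm)] with x hx0 hx hxa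
      exact (hΦ x ⟨⟨hx, hx0⟩, hxa⟩).symm
    · exact ⟨mem_ext.2 ⟨mem_hball.1 hx, norm_pos_iff.1 ((norm_nonneg a).trans_lt hxa)⟩,
        fun e => by rw [e] at hxa; exact hxa.false⟩
    · rw [flux_congr hΦ hR hR1, flux_coulombFamily_eq_zero_iff h ha _ 0 hR hR1]

/-! ### Decay as the charge approaches the horizon -/

/-- By Cauchy–Schwarz `1 - a·x ≥ 1 - |a||x|`, and `(1 - |a||x|)² - (1 - |x|²)(1 - |a|²) = (|a| -
|x|)²`. -/
lemma sq_norm_sub_norm_le_quad {a x : E3} (ha : a ∈ hball) (hx : x ∈ hball) :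
    (‖a‖ - ‖x‖) ^ 2 ≤ quad a x := by
  have h1 := real_inner_le_norm a x
  have h2 : ‖a‖ * ‖x‖ ≤ 1 := by
    have := mem_hball.1 ha
    have := mem_hball.1 hx
    nlinarith [norm_nonneg a, norm_nonneg x]
  rw [quad_eq]
  nlinarith [mul_nonneg (sub_nonneg.2 h1) (sub_nonneg.2 h2)]

/-- Rationalising the numerator `1 - a·x - √q`, where `q = quad a x`, gives `(1 - |x|²)(1 - |a|²)`,
while the denominators are bounded below by the gap between the radii. -/
lemma abs_coulomb_sub_le {a x : E3} (ha : a ∈ hball) (hx : x ∈ hball) {k : ℝ} (hk : 0 < k)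
    (hkx : k ≤ ‖a‖ - ‖x‖) : |coulomb a x - 1 / (4 * Real.pi)| ≤ (1 - ‖a‖ ^ 2) / k ^ 2 := by
  have hpi := Real.pi_gt_three
  have hσ := one_sub_normSq_pos ha
  have hρ := one_sub_normSq_pos hx
  have hy := one_sub_inner_pos ha (mem_hball.1 hx).le
  have hk2 : k ^ 2 ≤ quad a x :=
    (pow_le_pow_left₀ hk.le hkx 2).trans (sq_norm_sub_norm_le_quad ha hx)
  have hq : 0 < quad a x := (pow_pos hk 2).trans_le hk2
  have hs := Real.sqrt_pos.2 hq
  have hss := Real.sq_sqrt hq.le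
  have e : coulomb a x - 1 / (4 * Real.pi) = (1 - ‖x‖ ^ 2) * (1 - ‖a‖ ^ 2) /
      (4 * Real.pi * (√(quad a x) * (1 - inner ℝ a x + √(quad a x)))) := by
    have hqe := quad_eq a x
    rw [coulomb]
    field_simp
    nlinarith
  rw [e, abs_of_pos (by positivity)]
  have hd : k ^ 2 ≤ 4 * Real.pi * (√(quad a x) * (1 - inner ℝ a x + √(quad a x))) := by
    have h1 : quad a x ≤ √(quad a x) * (1 - inner ℝ a x + √(quad a x)) := by nlinarith
    have h2 : 0 < √(quad a x) * (1 - inner ℝ a x + √(quad a x)) := by positivity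
    nlinarith
  calc _ ≤ 1 * (1 - ‖a‖ ^ 2) / k ^ 2 := by
        gcongr
        nlinarith [sq_nonneg ‖x‖]
    _ = _ := by rw [one_mul]

lemma one_sub_normSq_le_exp {a : E3} (ha : a ∈ hball) :
    1 - ‖a‖ ^ 2 ≤ 4 * Real.exp (-2 * hdist a 0) := by
  rw [one_sub_normSq_eq ha]
  have h1 := exp_div_two_le_cosh (hdist a 0)
  have h2 := Real.exp_pos (hdist a 0)
  calc (Real.cosh (hdist a 0) ^ 2)⁻¹ ≤ ((Real.exp (hdist a 0) / 2) ^ 2)⁻¹ := by gcongr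
    _ = 4 * Real.exp (-2 * hdist a 0) := by
      rw [show -2 * hdist a 0 = -(hdist a 0 + hdist a 0) by ring, Real.exp_neg, Real.exp_add]
      field_simp
      norm_num

lemma norm_le_of_hdist_le {x : E3} (hx : x ∈ hball) {R : ℝ} (hR : 0 ≤ R) (h : hdist x 0 ≤ R) :
    ‖x‖ ≤ √(1 - (Real.cosh R ^ 2)⁻¹) := by
  refine Real.le_sqrt_of_sq_le ?_
  have h1 := one_sub_normSq_eq hx
  have h2 : Real.cosh (hdist x 0) ≤ Real.cosh R := by
    rw [Real.cosh_le_cosh, abs_of_nonneg (hdist_zero_nonneg hx), abs_of_nonneg hR]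
    exact h
  have h3 : (Real.cosh R ^ 2)⁻¹ ≤ (Real.cosh (hdist x 0) ^ 2)⁻¹ := by
    have := Real.cosh_pos (hdist x 0)
    gcongr
  linarith

lemma le_norm_of_le_hdist {x : E3} (hx : x ∈ hball) {R : ℝ} (hR : 0 ≤ R) (h : R ≤ hdist x 0) :
    √(1 - (Real.cosh R ^ 2)⁻¹) ≤ ‖x‖ := by
  rw [Real.sqrt_le_left (norm_nonneg x)]
  have h1 := one_sub_normSq_eq hx
  have h2 : Real.cosh R ≤ Real.cosh (hdist x 0) := by
    rw [Real.cosh_le_cosh, abs_of_nonneg (hdist_zero_nonneg hx), abs_of_nonneg hR]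
    exact h
  have h3 : (Real.cosh (hdist x 0) ^ 2)⁻¹ ≤ (Real.cosh R ^ 2)⁻¹ := by
    have := Real.cosh_pos R
    gcongr
  linarith

lemma sqrt_one_sub_inv_cosh_lt {R S : ℝ} (hR : 0 ≤ R) (hRS : R < S) :
    √(1 - (Real.cosh R ^ 2)⁻¹) < √(1 - (Real.cosh S ^ 2)⁻¹) := by
  have h0 := Real.cosh_pos R
  have h1 : Real.cosh R < Real.cosh S := by
    rw [Real.cosh_lt_cosh, abs_of_nonneg hR, abs_of_nonneg (hR.trans hRS.le)]
    exact hRS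
  have h2 : (Real.cosh S ^ 2)⁻¹ < (Real.cosh R ^ 2)⁻¹ := by gcongr
  refine Real.sqrt_lt_sqrt ?_ (by linarith)
  have : (Real.cosh R ^ 2)⁻¹ ≤ 1 := inv_le_one_of_one_le₀ (one_le_pow₀ (Real.one_le_cosh R))
  linarith

/-- The constant that kills the flux also cancels the leading terms, as `4πμ · 1/(4π) + M = μ + M`
is the limit of `r(a)` at the horizon. What is left is of order `1 - |a|²`. -/
lemma coulombFamily_sub_eq {M Q : ℝ} (h : |Q| < M) {a : E3} (ha : a ∈ ext) {x : E3} :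
    coulombFamily M Q a (M / (4 * Real.pi * mu M Q)) 0 x - 1 / (4 * Real.pi * radius M Q x) =
      (4 * Real.pi * mu M Q * (coulomb a x - 1 / (4 * Real.pi)) - mu M Q * ((1 - ‖a‖) / ‖a‖)) /
        (4 * Real.pi * (radius M Q x * radius M Q a)) := by
  have hm := mu_pos h
  have hsm := Real.sqrt_pos.2 hm
  have hsq : √(mu M Q) ^ 2 = mu M Q := Real.sq_sqrt hm.le
  have hpi := Real.pi_pos
  have hrx := radius_pos h x
  have hra := radius_pos h a
  have han := norm_pos_iff.2 (mem_ext.1 ha).2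
  have e1 : coulombFamily M Q a (M / (4 * Real.pi * mu M Q)) 0 x =
      (4 * Real.pi * mu M Q * coulomb a x + M) / (4 * Real.pi * (radius M Q x * radius M Q a)) := by
    rw [coulombFamily, HH_eq, HH_eq, div_mul_div_comm, ← pow_two, hsq]
    field_simp
    ring
  have e2 : 1 / (4 * Real.pi * radius M Q x) =
      radius M Q a / (4 * Real.pi * (radius M Q x * radius M Q a)) := by
    field_simp
  rw [e1, e2, ← sub_div]
  congr 1
  rw [radius]
  field_simp
  ring

lemma M_le_radius {M Q : ℝ} (h : |Q| < M) (x : E3) : M ≤ radius M Q x := by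
  have := div_nonneg (mu_pos h).le (norm_nonneg x)
  rw [radius]
  linarith

lemma abs_coulombFamily_sub_le {M Q : ℝ} (h : |Q| < M) {a x : E3} (ha : a ∈ ext) (hx : x ∈ hball)
    {k : ℝ} (hk : 0 < k) (hkx : k ≤ ‖a‖ - ‖x‖) :
    |coulombFamily M Q a (M / (4 * Real.pi * mu M Q)) 0 x - 1 / (4 * Real.pi * radius M Q x)| ≤
      (4 * Real.pi * mu M Q / k ^ 2 + mu M Q / k) / (4 * Real.pi * (M * M)) * (1 - ‖a‖ ^ 2) := by
  have hm := mu_pos h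
  have hM := M_pos h
  have hpi := Real.pi_pos
  have hb := ext_subset ha
  have hσ := one_sub_normSq_pos hb
  have ha1 := mem_hball.1 hb
  have han := norm_pos_iff.2 (mem_ext.1 ha).2
  have hka : k ≤ ‖a‖ := by linarith [norm_nonneg x]
  have hra := M_le_radius h a
  have hrx := M_le_radius h x
  have hrap := radius_pos h a
  have hrxp := radius_pos h x
  have h1 := abs_coulomb_sub_le hb hx hk hkx
  have h2 : (1 - ‖a‖) / ‖a‖ ≤ (1 - ‖a‖ ^ 2) / k := by
    gcongr
    nlinarith
  have h3 : 0 ≤ (1 - ‖a‖) / ‖a‖ := div_nonneg (by linarith) han.le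
  rw [coulombFamily_sub_eq h ha, abs_div,
    abs_of_pos (by positivity : 0 < 4 * Real.pi * (radius M Q x * radius M Q a))]
  calc _ ≤ (4 * Real.pi * mu M Q * ((1 - ‖a‖ ^ 2) / k ^ 2) + mu M Q * ((1 - ‖a‖ ^ 2) / k)) /
        (4 * Real.pi * (M * M)) := by
        gcongr
        refine (abs_sub _ _).trans ?_
        rw [abs_mul, abs_mul (mu M Q), abs_of_pos hm, abs_of_nonneg h3,
          abs_of_pos (by positivity : 0 < 4 * Real.pi * mu M Q)]
        gcongr
    _ = _ := by ring

instance : NeZero sphereMeasure := ⟨fun h0 => by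
  have h := sphereMeasure_real_univ
  rw [h0] at h
  have := Real.pi_pos
  simp at h⟩

/-- A function within `b` of a constant on the sphere through `x` has a non-monopole part of size
at most `2 b`. -/
lemma abs_nonMonopole_le {Φ : E3 → ℝ} {x : E3} {k b : ℝ}
    (hc : ∀ y : E3, ‖y‖ = ‖x‖ → ContinuousAt Φ y)
    (hb : ∀ y : E3, ‖y‖ = ‖x‖ → |Φ y - k| ≤ b) : |nonMonopole Φ x| ≤ 2 * b := by
  have hn : ∀ n : Metric.sphere (0 : E3) 1, ‖‖x‖ • n.1‖ = ‖x‖ := fun n =>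
    norm_smul_sphere (norm_nonneg x) n
  have hi : Integrable (fun n : Metric.sphere (0 : E3) 1 => Φ (‖x‖ • n.1)) sphereMeasure := by
    refine Continuous.integrable_of_hasCompactSupport ?_ (HasCompactSupport.of_compactSpace _)
    rw [continuous_iff_continuousAt]
    intro n
    have h2 : ContinuousAt (fun n : Metric.sphere (0 : E3) 1 => ‖x‖ • n.1) n := by fun_prop
    exact (hc _ (hn n)).comp_of_eq h2 rfl
  have hmem := (convex_closedBall k b).average_mem Metric.isClosed_closedBall
    (.of_forall fun n : Metric.sphere (0 : E3) 1 => by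
      rw [Metric.mem_closedBall, Real.dist_eq]
      exact hb _ (hn n)) hi
  rw [Metric.mem_closedBall, Real.dist_eq, abs_sub_comm] at hmem
  rw [nonMonopole]
  have h2 := abs_sub_le (Φ x) k (⨍ n, Φ (‖x‖ • n.1) ∂sphereMeasure)
  linarith [hb x rfl]

lemma Gtilde_eq (M Q : ℝ) {T : E3 → E3} (hT : IsHypIsometry T) {a : E3} (ha : a ∈ ext)
    (h0 : T a = 0) {x : E3} (hx : x ∈ hball) :
    Gtilde M Q T a x = coulombFamily M Q a (M / (4 * Real.pi * mu M Q)) 0 x := by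
  rw [Gtilde, hT.VO_comp ha h0 hx, coulombFamily, add_zero]

/-- The potential of a charge near the horizon is exponentially close to a monopole. -/
theorem exists_decay {M Q : ℝ} (h : |Q| < M) (R : ℝ) :
    ∃ C : ℝ, ∀ x₀ ∈ ext, R + 1 ≤ hdist x₀ 0 →
      ∀ T : E3 → E3, IsHypIsometry T → T x₀ = 0 → ∀ x ∈ ext, hdist x 0 ≤ R →
        |VO (T x) - 1 / (4 * Real.pi)| ≤ C * Real.exp (-2 * hdist x₀ 0) ∧
        |Gtilde M Q T x₀ x - 1 / (4 * Real.pi * radius M Q x)| ≤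
          C * Real.exp (-2 * hdist x₀ 0) ∧
        |nonMonopole (Gtilde M Q T x₀) x| ≤ C * Real.exp (-2 * hdist x₀ 0) := by
  rcases lt_or_ge R 0 with hR | hR
  -- A negative bound on the distance is met by no point.
  · exact ⟨0, fun x₀ _ _ T _ _ x hx hxR =>
      absurd (hdist_zero_nonneg (ext_subset hx)) (by linarith)⟩
  have hm := mu_pos h
  have hM := M_pos h
  have hpi := Real.pi_pos
  -- The least gap between the radii of a point at distance at least `R + 1` and one at distance at
  -- most `R`.
  set k := √(1 - (Real.cosh (R + 1) ^ 2)⁻¹) - √(1 - (Real.cosh R ^ 2)⁻¹) with hk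
  have hkp : 0 < k := sub_pos.2 (sqrt_one_sub_inv_cosh_lt hR (lt_add_one R))
  set C₁ := (k ^ 2)⁻¹ with hC₁
  set C₂ := (4 * Real.pi * mu M Q / k ^ 2 + mu M Q / k) / (4 * Real.pi * (M * M)) with hC₂
  have p₁ : 0 < C₁ := by positivity
  have p₂ : 0 < C₂ := by positivity
  -- The `4` comes from `1 - |x₀|² ≤ 4 e^{-2D}`, the `2` from subtracting the spherical mean.
  refine ⟨4 * (C₁ + 2 * C₂), fun x₀ hx₀ hD T hT hT0 x hx hxR => ?_⟩
  have hb := ext_subset hx₀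
  have hxb := ext_subset hx
  have hexp := one_sub_normSq_le_exp hb
  have hσ := one_sub_normSq_pos hb
  have hE := Real.exp_pos (-2 * hdist x₀ 0)
  have hk1 : k ≤ ‖x₀‖ - ‖x‖ := by
    have := norm_le_of_hdist_le hxb hR hxR
    have := le_norm_of_le_hdist hb (by linarith) hD
    linarith
  have hgap : ∀ y : E3, ‖y‖ = ‖x‖ → y ∈ hball ∧ k ≤ ‖x₀‖ - ‖y‖ := fun y hy => by
    rw [mem_hball, hy]
    exact ⟨mem_hball.1 hxb, hk1⟩
  -- The estimate is needed on the whole sphere through `x`, where `1/(4πr)` is constant, in order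
  -- to control the mean as well.
  have hG : ∀ y : E3, ‖y‖ = ‖x‖ →
      |Gtilde M Q T x₀ y - 1 / (4 * Real.pi * radius M Q x)| ≤
        C₂ * (4 * Real.exp (-2 * hdist x₀ 0)) := fun y hy => by
    have hr : radius M Q x = radius M Q y := by rw [radius, radius, hy]
    rw [Gtilde_eq M Q hT hx₀ hT0 (hgap y hy).1, hr]
    refine (abs_coulombFamily_sub_le h hx₀ (hgap y hy).1 hkp (hgap y hy).2).trans ?_
    gcongr
  refine ⟨?_, ?_, ?_⟩
  · rw [hT.VO_comp hx₀ hT0 hxb]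
    refine (abs_coulomb_sub_le hb hxb hkp hk1).trans ?_
    rw [div_eq_mul_inv, ← hC₁]
    nlinarith [mul_pos p₂ hE]
  · exact (hG x rfl).trans (by nlinarith [mul_pos p₂ hE, mul_pos p₁ hE])
  · refine (abs_nonMonopole_le (fun y hy => ?_) hG).trans
      (by nlinarith [mul_pos p₂ hE, mul_pos p₁ hE])
    have hya : y ≠ x₀ := fun e => by
      have := (hgap y hy).2
      rw [e] at this
      linarith
    have hy0 : y ≠ 0 := norm_pos_iff.1 (hy ▸ norm_pos_iff.2 (mem_ext.1 hx).2)
    refine (contDiffAt_coulombFamily h hb (M / (4 * Real.pi * mu M Q)) 0 hya hy0).continuousAt.congr ?_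
    filter_upwards [isOpen_hball.mem_nhds (hgap y hy).1] with z hz using
      (Gtilde_eq M Q hT hx₀ hT0 hz).symm

end OpticalBH

end

open OpticalBH in
theorem mainTheorem1 (M Q : ℝ) (hMQ : |Q| < M) :
    -- the Beltrami ball minus `O` is the black hole exterior, and the optical metric is `H⁴ h`
    (BijOn (toRN M Q) ext {y | M + mu M Q < ‖y‖} ∧ ContDiffOn ℝ ∞ (toRN M Q) ext ∧
      ∀ x ∈ ext, opt M Q x = (HH M Q x) ^ 4 • hyp x) ∧
    -- `H` is positive and harmonic
    (∀ x ∈ ext, 0 < HH M Q x ∧ laplacian hyp (HH M Q) x = 0) ∧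
    -- `V_O` is the hyperbolic Green's function with limit `1/(4π)` at infinity
    (∀ V : E3 → ℝ,
      (IsGreen hyp hball 0 V ∧
        Tendsto V (comap (fun x => hdist x 0) atTop ⊓ 𝓟 hball) (𝓝 (1 / (4 * Real.pi)))) ↔
      ∀ x ∈ ext, V x = VO x) ∧
    -- the potential of a point charge at `x₀`
    (∀ x₀ ∈ ext,
      (∃ T : E3 → E3, IsHypIsometry T ∧ T x₀ = 0) ∧
      ∀ T : E3 → E3, IsHypIsometry T → T x₀ = 0 →
        (∀ Φ : E3 → ℝ, IsPointChargePotential M Q x₀ Φ ↔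
          ∀ x ∈ ext \ {x₀}, Φ x = Gtilde M Q T x₀ x) ∧
        SolvesMaxwellStaticCharge (rnSpacetime M Q) ext x₀ (staticForm (Gtilde M Q T x₀)) ∧
        -- the additive constants are fixed by Gauss's law and by the value at infinity
        ∀ A B : ℝ,
          IsGreen (opt M Q) ext x₀ (greenFamily M Q T x₀ A B) ∧
          HorizonRegular M Q (greenFamily M Q T x₀ A B) ∧
          Tendsto (greenFamily M Q T x₀ A B) (𝓝[≠] 0) (𝓝 B) ∧
          ∀ R : ℝ, ‖x₀‖ < R → R < 1 →
            (flux (opt M Q) (greenFamily M Q T x₀ A B) R = 0 ↔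
              A = M / (4 * Real.pi * mu M Q))) ∧
    -- exponential decay as `x₀` approaches the horizon
    (∀ R : ℝ, ∃ C : ℝ, ∀ x₀ ∈ ext, R + 1 ≤ hdist x₀ 0 →
      ∀ T : E3 → E3, IsHypIsometry T → T x₀ = 0 → ∀ x ∈ ext, hdist x 0 ≤ R →
        |VO (T x) - 1 / (4 * Real.pi)| ≤ C * Real.exp (-2 * hdist x₀ 0) ∧
        |Gtilde M Q T x₀ x - 1 / (4 * Real.pi * radius M Q x)| ≤
          C * Real.exp (-2 * hdist x₀ 0) ∧
        |nonMonopole (Gtilde M Q T x₀) x| ≤ C * Real.exp (-2 * hdist x₀ 0)) := by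
  refine ⟨⟨bijOn_toRN hMQ, contDiffOn_toRN M Q, fun x hx => opt_eq hMQ hx⟩,
    fun x hx => ⟨HH_pos hMQ x, laplacian_HH hMQ hx⟩, isGreen_and_tendsto_iff, fun x₀ hx₀ =>
    ⟨⟨swap x₀, isHypIsometry_swap hx₀, swap_self hx₀⟩, fun T hT hT0 => ?_⟩, exists_decay hMQ⟩
  have hG : ∀ x ∈ ext, Gtilde M Q T x₀ x =
      coulombFamily M Q x₀ (M / (4 * Real.pi * mu M Q)) 0 x := fun x hx =>
    Gtilde_eq M Q hT hx₀ hT0 (ext_subset hx)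
  have hF : ∀ A B, ∀ x ∈ hball, greenFamily M Q T x₀ A B x = coulombFamily M Q x₀ A B x :=
    fun A B x hx => greenFamily_eq M Q hT hx₀ hT0 A B hx
  refine ⟨fun Φ => ?_, solvesMaxwell_of_isGreen hMQ hx₀ (isGreen_coulombFamily hMQ hx₀ _ 0)
    (hasPole_coulombFamily hMQ x₀ _ 0) hG, fun A B => ⟨?_, ?_, ?_, fun R hR hR1 => ?_⟩⟩
  · rw [isPointChargePotential_iff hMQ hx₀]
    exact forall₂_congr fun x hx => by rw [hG x hx.1]
  · exact (isGreen_coulombFamily hMQ hx₀ A B).congr isOpen_ext fun x hx =>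
      hF A B x (ext_subset hx.1)
  · exact (horizonRegular_coulombFamily hMQ hx₀ A B).congr (mem_ext.1 hx₀).1 fun x hx _ =>
      hF A B x hx
  · refine (tendsto_coulombFamily hMQ hx₀ A B).congr' ?_
    filter_upwards [mem_nhdsWithin_of_mem_nhds (isOpen_hball.mem_nhds zero_mem_hball)] with x hx
      using (hF A B x hx).symm
  · rw [flux_congr (fun x hx => hF A B x (ext_subset hx.1)) hR hR1,
      flux_coulombFamily_eq_zero_iff hMQ hx₀ A B hR hR1]
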